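/- **Setting.** Groupoids $\mathcal G\rightrightarrows\mathcal P$ are written with composition from left to right, and $\mathcal P$ is identified with the set of identity arrows of $\mathcal G$. Let $\mathcal T$ be a finite double groupoid, i.e. a groupoid object in the category of groupoids whose set $\mathcal B$ of boxes is finite. It consists of groupoids $\mathcal H\rightrightarrows\mathcal P$ (horizontal arrows, source $l$, target $r$), $\mathcal V\rightrightarrows\mathcal P$ (vertical arrows, source $t$, target $b$), $\mathcal B\rightrightarrows\mathcal H$ (vertical composition of boxes, source $t$, target $b$) and $\mathcal B\rightrightarrows\mathcal V$ (horizontal composition, source $l$, target $r$). Write $XY$ for the horizontal composition of boxes (when $r(X)=l(Y)$), $\begin{smallmatrix}A\\B\end{smallmatrix}$ for the vertical composition (when $b(A)=t(B)$), $A^h$ and $A^v$ for the horizontal and vertical inverses, $A^{-1}=(A^h)^v$, $\mathrm{id}\,x$ ($x\in\mathcal H$) and $\mathrm{id}\,g$ ($g\in\mathcal V$) for the identity boxes of the two groupoid structures on $\mathcal B$, and $tl(A),tr(A),bl(A),br(A)\in\mathcal P$ for the four vertices of a box. *Core groupoids.* $\mathbf D=\{D\in\mathcal B: l(D),b(D)\in\mathcal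 P\}$ is a groupoid over $\mathcal P$ with source $s(D)=tr(D)$, target $e(D)=tl(D)$ and composition (for $e(D)=s(L)$) $D\diamond L$ = the row $(\mathrm{id}\,t(L))\,D$ placed above $L$. $\mathbf E=\{E\in\mathcal B: r(E),t(E)\in\mathcal P\}$ is a groupoid over $\mathcal P$ with source $s(E)=bl(E)$, target $e(E)=br(E)$ and composition (for $e(M)=s(E)$) $M\circ E$ = $E$ placed above the row $M\,(\mathrm{id}\,b(E))$. In both, the identity at $P\in\mathcal P$ is the identity box $\Theta_P$. If $t(A)\in\mathcal P$ put $\phi(A)=\begin{smallmatrix}A^{-1}\\ \mathrm{id}\,r(A)\end{smallmatrix}\in\mathbf D$; if $b(A)\in\mathcal P$ put $\psi(A)=\begin{smallmatrix}\mathrm{id}\,l(A)\\ A^{-1}\end{smallmatrix}\in\mathbf E$. *The deformed structure.* Let $\Bbbk$ be a field of characteristic zero, $\vartheta:\mathcal P\to\Bbbk^\times$ a function and $\daleth(B)=\vartheta(bl(B))$. Let $\Bbbk^{(\vartheta)}\mathcal T$ be the vector space with basis $\mathcal B$, with product $A.B=\begin{smallmatrix}A\\B\end{smallmatrix}$ if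 $b(A)=t(B)$ and $A.B=0$ otherwise, unit $\mathbf 1=\sum_{x\in\mathcal H}\mathrm{id}\,x$, coproduct $\Delta(A)=\sum_{XY=A}\daleth(Y)\,X\otimes Y$, and counit $\varepsilon(A)=\daleth(A)^{-1}$ if $A\in\mathcal V$ (i.e. $A=\mathrm{id}\,g$ for some $g\in\mathcal V$), $\varepsilon(A)=0$ otherwise. This is an associative unital algebra and a coassociative counital coalgebra. Set $${}_D\mathbf 1=\sum_{z\in\mathcal H,\ r(z)=e(D)}(\mathrm{id}\,z)\,D,\qquad \mathbf 1_E=\sum_{x\in\mathcal H,\ l(x)=e(E)}E\,(\mathrm{id}\,x).$$ *Weak Hopf algebras.* An algebra and coalgebra $H$ is a weak bialgebra if $\Delta(ab)=\Delta(a)\Delta(b)$, $\Delta^{(2)}(1)=(\Delta(1)\otimes1)(1\otimes\Delta(1))=(1\otimes\Delta(1))(\Delta(1)\otimes1)$ and $\varepsilon(abc)=\varepsilon(ab_1)\varepsilon(b_2c)=\varepsilon(ab_2)\varepsilon(b_1c)$. Its source and target maps are $\epsilon_s(h)=(\mathrm{id}\otimes\varepsilon)((1\otimes h)\Delta(1))$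 and $\epsilon_t(h)=(\varepsilon\otimes\mathrm{id})(\Delta(1)(h\otimes1))$, and their images are the source and target subalgebras. An antipode is a linear map $\mathcal S:H\to H$ with $m(\mathrm{id}\otimes\mathcal S)\Delta=\epsilon_t$, $m(\mathcal S\otimes\mathrm{id})\Delta=\epsilon_s$ and $m^{(2)}(\mathcal S\otimes\mathrm{id}\otimes\mathcal S)\Delta^{(2)}=\mathcal S$; a weak Hopf algebra is a weak bialgebra that has an antipode. **Theorem.** $\Bbbk^{(\vartheta)}\mathcal T$ is a weak bialgebra if and only if $$\sum_{V\in\mathcal B:\ t(V)=x,\ r(V)=g}\daleth(V)=1\qquad\text{for all } (g,x)\in\mathcal V\times\mathcal H \text{ with } t(g)=r(x).$$ When this condition holds, $\Bbbk^{(\vartheta)}\mathcal T$ is a weak Hopf algebra whose underlying algebra is semisimple, and: 1. its antipode is given, for all $A\in\mathcal B$, by $\displaystyle \mathcal S(A)=\frac{\daleth(A^{-1})}{\daleth(A^h)}\,A^{-1}=\frac{\vartheta(tr(A))}{\vartheta(br(A))}\,A^{-1}$; 2. for all $A\in\mathcal B$, $\epsilon_s(A)={}_{\phi(A)}\mathbf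 1$ if $t(A)\in\mathcal P$, and $\epsilon_s(A)=0$ otherwise; 3. for all $A\in\mathcal B$, $\displaystyle \epsilon_t(A)=\frac{\daleth(A^{-1})}{\daleth(A^h)}\,\mathbf 1_{\psi(A)}$ if $b(A)\in\mathcal P$, and $\epsilon_t(A)=0$ otherwise; 4. the source and target subalgebras are (unital) subalgebras isomorphic, as algebras, to the groupoid algebra $\Bbbk\mathbf D$ and to $(\Bbbk\mathbf E)^{\mathrm{op}}$, respectively. -/

import Mathlib

open scoped TensorProduct

universe u v

/-! ### Groupoids presented by their sets of arrows -/

/-- A groupoid `G ⇉ P` with set of arrows `G` and base `P`. Composition is written from left to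
right: `comp f g` is defined when `tgt f = src g`. -/
structure ArrowGroupoid (G : Type u) (P : Type u) where
  src : G → P
  tgt : G → P
  id : P → G
  inv : G → G
  comp : (f g : G) → tgt f = src g → G
  src_id : ∀ p, src (id p) = p
  tgt_id : ∀ p, tgt (id p) = p
  src_inv : ∀ f, src (inv f) = tgt f
  tgt_inv : ∀ f, tgt (inv f) = src f
  src_comp : ∀ f g h, src (comp f g h) = src f
  tgt_comp : ∀ f g h, tgt (comp f g h) = tgt g
  id_comp : ∀ f, comp (id (src f)) f (tgt_id _) = f
  comp_id : ∀ f, comp f (id (tgt f)) (src_id _).symm = f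
  assoc : ∀ f g k (h₁ : tgt f = src g) (h₂ : tgt g = src k),
    comp (comp f g h₁) k ((tgt_comp _ _ _).trans h₂) =
      comp f (comp g k h₂) (h₁.trans (src_comp _ _ _).symm)
  comp_inv : ∀ f, comp f (inv f) (src_inv f).symm = id (src f)
  inv_comp : ∀ f, comp (inv f) f (tgt_inv f) = id (tgt f)

namespace ArrowGroupoid

variable {G P : Type u} (𝒢 : ArrowGroupoid G P)

/-- The arrow `f` lies in the base, identified with the set of identity arrows. -/
def IsId (f : G) : Prop := f ∈ Set.range 𝒢.id

theorem isId_id (p : P) : 𝒢.IsId (𝒢.id p) := ⟨p, rfl⟩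

variable {𝒢} in
theorem IsId.of_eq {f g : G} (h : 𝒢.IsId g) (e : f = g) : 𝒢.IsId f := e ▸ h

theorem IsId.eq_src {f : G} (h : 𝒢.IsId f) : f = 𝒢.id (𝒢.src f) := by
  obtain ⟨p, rfl⟩ := h
  rw [𝒢.src_id]

theorem IsId.eq_tgt {f : G} (h : 𝒢.IsId f) : f = 𝒢.id (𝒢.tgt f) := by
  obtain ⟨p, rfl⟩ := h
  rw [𝒢.tgt_id]

theorem IsId.src_eq_tgt {f : G} (h : 𝒢.IsId f) : 𝒢.src f = 𝒢.tgt f := by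
  obtain ⟨p, rfl⟩ := h
  rw [𝒢.tgt_id, 𝒢.src_id]

theorem comp_congr {f f' g g' : G} (hf : f = f') (hg : g = g') (h : 𝒢.tgt f = 𝒢.src g) :
    𝒢.comp f g h = 𝒢.comp f' g' (by rw [← hf, ← hg]; exact h) := by
  subst hf; subst hg; rfl

theorem id_comp_of {e f : G} (he : 𝒢.IsId e) (h : 𝒢.tgt e = 𝒢.src f) : 𝒢.comp e f h = f := by
  obtain ⟨p, rfl⟩ := he
  have hp : p = 𝒢.src f := by rw [← h, 𝒢.tgt_id]
  subst hp
  exact 𝒢.id_comp f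

theorem comp_id_of {e f : G} (he : 𝒢.IsId e) (h : 𝒢.tgt f = 𝒢.src e) : 𝒢.comp f e h = f := by
  obtain ⟨p, rfl⟩ := he
  have hp : p = 𝒢.tgt f := by rw [h, 𝒢.src_id]
  subst hp
  exact 𝒢.comp_id f

/-- An arrow with a one-sided inverse `g` has `g` as its inverse. -/
theorem eq_inv_of_comp {f g : G} (h : 𝒢.tgt f = 𝒢.src g) (hfg : 𝒢.IsId (𝒢.comp f g h)) :
    g = 𝒢.inv f := by
  have h2 : 𝒢.src f = 𝒢.tgt g := by
    have := IsId.src_eq_tgt 𝒢 hfg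
    rwa [𝒢.src_comp, 𝒢.tgt_comp] at this
  have h1 := 𝒢.assoc (𝒢.inv f) f g (𝒢.tgt_inv f) h
  rw [𝒢.comp_congr (𝒢.inv_comp f) rfl, 𝒢.id_comp_of (𝒢.isId_id _),
    𝒢.comp_id_of hfg] at h1
  exact h1

theorem inv_id {e : G} (he : 𝒢.IsId e) : 𝒢.inv e = e := by
  refine (𝒢.eq_inv_of_comp (IsId.src_eq_tgt 𝒢 he).symm ?_).symm
  rw [𝒢.id_comp_of he]
  exact he

end ArrowGroupoid

/-! ### The groupoid algebra -/

/-- The vector space `k𝒢` with basis the arrows of the groupoid `𝒢`. -/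
def GroupoidAlgebra (k : Type v) [Field k] {G P : Type u} (_𝒢 : ArrowGroupoid G P) :
    Type (max u v) := G →₀ k

namespace GroupoidAlgebra

section

variable (k : Type v) [Field k] {G P : Type u} (𝒢 : ArrowGroupoid G P)

noncomputable instance : AddCommGroup (GroupoidAlgebra k 𝒢) :=
  inferInstanceAs (AddCommGroup (G →₀ k))

noncomputable instance : Module k (GroupoidAlgebra k 𝒢) :=
  inferInstanceAs (Module k (G →₀ k))

/-- The arrow `f`, as an element of the basis of `k𝒢`. -/
noncomputable def of (f : G) : GroupoidAlgebra k 𝒢 := (Finsupp.single f 1 : G →₀ k)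

/-- The linear map with prescribed values on the basis of arrows. -/
noncomputable def lift {M : Type*} [AddCommGroup M] [Module k M] (φ : G → M) :
    GroupoidAlgebra k 𝒢 →ₗ[k] M :=
  (Finsupp.linearCombination k φ : (G →₀ k) →ₗ[k] M)

variable {k 𝒢}

@[simp]
theorem lift_of {M : Type*} [AddCommGroup M] [Module k M] (φ : G → M) (f : G) :
    lift k 𝒢 φ (of k 𝒢 f) = φ f := by
  unfold lift of
  exact (Finsupp.linearCombination_single k 1 f).trans (one_smul k _)

theorem hom_ext {M : Type*} [AddCommMonoid M] [Module k M] {S T : GroupoidAlgebra k 𝒢 →ₗ[k] M}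
    (h : ∀ f, S (of k 𝒢 f) = T (of k 𝒢 f)) : S = T := by
  have : ∀ S T : (G →₀ k) →ₗ[k] M,
      (∀ f, S (Finsupp.single f 1) = T (Finsupp.single f 1)) → S = T :=
    fun S T h => Finsupp.lhom_ext' fun f => LinearMap.ext_ring (h f)
  exact this S T h

variable (k 𝒢)

open Classical in
/-- The product of two arrows: their composition if they are composable, and `0` otherwise. -/
noncomputable def mulArrows (f g : G) : GroupoidAlgebra k 𝒢 :=
  if h : 𝒢.tgt f = 𝒢.src g then of k 𝒢 (𝒢.comp f g h) else 0

/-- The bilinear extension of the product of arrows. -/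
noncomputable def mulMap :
    GroupoidAlgebra k 𝒢 →ₗ[k] GroupoidAlgebra k 𝒢 →ₗ[k] GroupoidAlgebra k 𝒢 :=
  lift k 𝒢 fun f => lift k 𝒢 fun g => mulArrows k 𝒢 f g

noncomputable instance : Mul (GroupoidAlgebra k 𝒢) := ⟨fun a b => mulMap k 𝒢 a b⟩

/-- The unit is the sum of all identity arrows. -/
noncomputable instance : One (GroupoidAlgebra k 𝒢) := ⟨∑ᶠ p : P, of k 𝒢 (𝒢.id p)⟩

theorem mul_def (a b : GroupoidAlgebra k 𝒢) : a * b = mulMap k 𝒢 a b := rfl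

theorem one_def : (1 : GroupoidAlgebra k 𝒢) = ∑ᶠ p : P, of k 𝒢 (𝒢.id p) := rfl

theorem of_mul_of (f g : G) : of k 𝒢 f * of k 𝒢 g = mulArrows k 𝒢 f g := by
  simp [mul_def, mulMap]

theorem mulArrows_pos {f g : G} (h : 𝒢.tgt f = 𝒢.src g) :
    mulArrows k 𝒢 f g = of k 𝒢 (𝒢.comp f g h) := dif_pos h

theorem mulArrows_neg {f g : G} (h : ¬ 𝒢.tgt f = 𝒢.src g) : mulArrows k 𝒢 f g = 0 := dif_neg h

variable {k 𝒢} in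
theorem induction_of {p : GroupoidAlgebra k 𝒢 → Prop} (a : GroupoidAlgebra k 𝒢) (h0 : p 0)
    (hadd : ∀ x y, p x → p y → p (x + y)) (hof : ∀ (c : k) (f : G), p (c • of k 𝒢 f)) : p a := by
  refine Finsupp.induction_linear (motive := p) a h0 hadd fun f c => ?_
  have h := hof c f
  have e : c • of k 𝒢 f = (Finsupp.single f c : G →₀ k) :=
    (Finsupp.smul_single_one f c)
  rw [e] at h
  exact h

theorem mulArrows_assoc (f g h : G) :
    mulMap k 𝒢 (mulArrows k 𝒢 f g) (of k 𝒢 h) = mulMap k 𝒢 (of k 𝒢 f) (mulArrows k 𝒢 g h) := by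
  simp only [mulMap]
  by_cases h₁ : 𝒢.tgt f = 𝒢.src g
  · by_cases h₂ : 𝒢.tgt g = 𝒢.src h
    · rw [mulArrows_pos k 𝒢 h₁, mulArrows_pos k 𝒢 h₂]
      simp only [lift_of]
      rw [mulArrows_pos k 𝒢 ((𝒢.tgt_comp _ _ _).trans h₂),
        mulArrows_pos k 𝒢 (h₁.trans (𝒢.src_comp _ _ _).symm), 𝒢.assoc f g h h₁ h₂]
    · rw [mulArrows_pos k 𝒢 h₁, mulArrows_neg k 𝒢 h₂]
      simp only [lift_of, map_zero]
      exact mulArrows_neg k 𝒢 fun e => h₂ ((𝒢.tgt_comp _ _ h₁).symm.trans e)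
  · by_cases h₂ : 𝒢.tgt g = 𝒢.src h
    · rw [mulArrows_neg k 𝒢 h₁, mulArrows_pos k 𝒢 h₂]
      simp only [lift_of, map_zero, LinearMap.zero_apply]
      exact (mulArrows_neg k 𝒢 fun e => h₁ (e.trans (𝒢.src_comp _ _ h₂))).symm
    · rw [mulArrows_neg k 𝒢 h₁, mulArrows_neg k 𝒢 h₂]
      simp

theorem mulMap_assoc (a b c : GroupoidAlgebra k 𝒢) :
    mulMap k 𝒢 (mulMap k 𝒢 a b) c = mulMap k 𝒢 a (mulMap k 𝒢 b c) := by
  induction a using induction_of with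
  | h0 => simp
  | hadd x y hx hy => simp [hx, hy]
  | hof r f =>
  induction b using induction_of with
  | h0 => simp
  | hadd x y hx hy => simp only [map_add, LinearMap.add_apply, hx, hy]
  | hof s g =>
  induction c using induction_of with
  | h0 => simp
  | hadd x y hx hy => simp only [map_add, hx, hy]
  | hof t h =>
    simp only [map_smul, LinearMap.smul_apply]
    have e₁ : mulMap k 𝒢 (of k 𝒢 f) (of k 𝒢 g) = mulArrows k 𝒢 f g := of_mul_of k 𝒢 f g
    have e₂ : mulMap k 𝒢 (of k 𝒢 g) (of k 𝒢 h) = mulArrows k 𝒢 g h := of_mul_of k 𝒢 g h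
    rw [e₁, e₂, mulArrows_assoc]

theorem one_mul_aux [Finite P] (a : GroupoidAlgebra k 𝒢) :
    mulMap k 𝒢 (∑ᶠ p : P, of k 𝒢 (𝒢.id p)) a = a := by
  cases nonempty_fintype P
  rw [finsum_eq_sum_of_fintype]
  induction a using induction_of with
  | h0 => simp
  | hadd x y hx hy => rw [map_add, hx, hy]
  | hof r f =>
    rw [map_smul, map_sum, LinearMap.sum_apply, Finset.sum_eq_single (𝒢.src f)]
    · congr 1
      exact (of_mul_of k 𝒢 _ f).trans
        ((mulArrows_pos k 𝒢 (𝒢.tgt_id _)).trans (by rw [𝒢.id_comp]))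
    · intro p _ hp
      exact (of_mul_of k 𝒢 _ f).trans
        (mulArrows_neg k 𝒢 fun e => hp ((𝒢.tgt_id p).symm.trans e))
    · simp

theorem mul_one_aux [Finite P] (a : GroupoidAlgebra k 𝒢) :
    mulMap k 𝒢 a (∑ᶠ p : P, of k 𝒢 (𝒢.id p)) = a := by
  cases nonempty_fintype P
  rw [finsum_eq_sum_of_fintype]
  induction a using induction_of with
  | h0 => simp
  | hadd x y hx hy => rw [map_add, LinearMap.add_apply, hx, hy]
  | hof r f =>
    rw [map_smul, LinearMap.smul_apply, map_sum, Finset.sum_eq_single (𝒢.tgt f)]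
    · congr 1
      exact (of_mul_of k 𝒢 f _).trans
        ((mulArrows_pos k 𝒢 (𝒢.src_id _).symm).trans (by rw [𝒢.comp_id]))
    · intro p _ hp
      exact (of_mul_of k 𝒢 f _).trans
        (mulArrows_neg k 𝒢 fun e => hp ((𝒢.src_id p).symm.trans e.symm))
    · simp

noncomputable instance [Finite P] : Ring (GroupoidAlgebra k 𝒢) :=
  { (inferInstance : AddCommGroup (GroupoidAlgebra k 𝒢)),
    (inferInstance : Mul (GroupoidAlgebra k 𝒢)),
    (inferInstance : One (GroupoidAlgebra k 𝒢)) with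
    left_distrib := fun a b c => map_add (mulMap k 𝒢 a) b c
    right_distrib := fun a b c => by simp [mul_def]
    zero_mul := fun a => by simp [mul_def]
    mul_zero := fun a => by simp [mul_def]
    mul_assoc := mulMap_assoc k 𝒢
    one_mul := one_mul_aux k 𝒢
    mul_one := mul_one_aux k 𝒢 }

noncomputable instance [Finite P] : Algebra k (GroupoidAlgebra k 𝒢) :=
  Algebra.ofModule (fun r a b => by simp [mul_def]) (fun r a b => by simp [mul_def])

end

end GroupoidAlgebra

/-! ### Weak bialgebras and weak Hopf algebras -/

section WeakHopf

open Coalgebra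

variable (k : Type*) (H : Type*) [Field k] [Ring H] [Algebra k H] [Coalgebra k H]

/-- The compatibility conditions that make an algebra and coalgebra `H` a weak bialgebra.
The comultiplication is multiplicative,
`Δ⁽²⁾(1) = (Δ(1) ⊗ 1)(1 ⊗ Δ(1)) = (1 ⊗ Δ(1))(Δ(1) ⊗ 1)`, and
`ε(abc) = ε(ab₁)ε(b₂c) = ε(ab₂)ε(b₁c)`. Triple tensors are bracketed as `H ⊗ (H ⊗ H)`. -/
structure IsWeakBialgebra : Prop where
  comul_mul : ∀ a b : H, comul (R := k) (a * b) = comul (R := k) a * comul (R := k) b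
  comul_one_left : (comul (R := k)).lTensor H (comul (R := k) (1 : H)) =
    Algebra.TensorProduct.assoc k k k H H H (comul (R := k) (1 : H) ⊗ₜ[k] (1 : H)) *
      ((1 : H) ⊗ₜ[k] comul (R := k) (1 : H))
  comul_one_right : (comul (R := k)).lTensor H (comul (R := k) (1 : H)) =
    ((1 : H) ⊗ₜ[k] comul (R := k) (1 : H)) *
      Algebra.TensorProduct.assoc k k k H H H (comul (R := k) (1 : H) ⊗ₜ[k] (1 : H))
  counit_mul_left : ∀ a b c : H, counit (R := k) (a * b * c) =
    LinearMap.mul' k k (TensorProduct.map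
      (counit (R := k) ∘ₗ LinearMap.mulLeft k a) (counit (R := k) ∘ₗ LinearMap.mulRight k c)
      (comul (R := k) b))
  counit_mul_right : ∀ a b c : H, counit (R := k) (a * b * c) =
    LinearMap.mul' k k (TensorProduct.map
      (counit (R := k) ∘ₗ LinearMap.mulRight k c) (counit (R := k) ∘ₗ LinearMap.mulLeft k a)
      (comul (R := k) b))

/-- The source map `ε_s(h) = (id ⊗ ε)((1 ⊗ h) Δ(1))`. -/
noncomputable def sourceMap : H →ₗ[k] H :=
  TensorProduct.rid k H ∘ₗ (counit (R := k) (A := H)).lTensor H ∘ₗ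
    LinearMap.mulRight k (comul (R := k) (1 : H)) ∘ₗ TensorProduct.mk k H H 1

/-- The target map `ε_t(h) = (ε ⊗ id)(Δ(1) (h ⊗ 1))`. -/
noncomputable def targetMap : H →ₗ[k] H :=
  TensorProduct.lid k H ∘ₗ (counit (R := k) (A := H)).rTensor H ∘ₗ
    LinearMap.mulLeft k (comul (R := k) (1 : H)) ∘ₗ (TensorProduct.mk k H H).flip 1

variable {k H} in
/-- `S` is an antipode: `m (id ⊗ S) Δ = ε_t`, `m (S ⊗ id) Δ = ε_s` and
`m⁽²⁾ (S ⊗ id ⊗ S) Δ⁽²⁾ = S`. -/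
structure IsAntipode (S : H →ₗ[k] H) : Prop where
  mul_id_antipode : LinearMap.mul' k H ∘ₗ S.lTensor H ∘ₗ comul = targetMap k H
  mul_antipode_id : LinearMap.mul' k H ∘ₗ S.rTensor H ∘ₗ comul = sourceMap k H
  antipode_id_antipode : LinearMap.mul' k H ∘ₗ
    TensorProduct.map S (LinearMap.mul' k H ∘ₗ S.lTensor H) ∘ₗ comul.lTensor H ∘ₗ comul = S

/-- A weak Hopf algebra (quantum groupoid): a weak bialgebra that has an antipode. -/
structure IsWeakHopfAlgebra : Prop extends IsWeakBialgebra k H where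
  exists_antipode : ∃ S : H →ₗ[k] H, IsAntipode S

end WeakHopf

/-! ### Double groupoids -/

/-- A double groupoid (a groupoid object in the category of groupoids): sets of points,
horizontal arrows, vertical arrows and boxes, and four groupoids on them.
Sources and targets are: left and right for `hor` and `boxH`, top and bottom for `ver` and `boxV`.
The hypotheses `h'` in the fields only say that the displayed composition makes sense; they follow
from the other hypotheses and fields. -/
structure DoubleGroupoid where
  Pt : Type u
  Hor : Type u
  Ver : Type u
  Box : Type u
  hor : ArrowGroupoid Hor Pt
  ver : ArrowGroupoid Ver Pt
  /-- vertical composition of boxes -/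
  boxV : ArrowGroupoid Box Hor
  /-- horizontal composition of boxes -/
  boxH : ArrowGroupoid Box Ver
  tl_eq : ∀ A, hor.src (boxV.src A) = ver.src (boxH.src A)
  tr_eq : ∀ A, hor.tgt (boxV.src A) = ver.src (boxH.tgt A)
  bl_eq : ∀ A, hor.src (boxV.tgt A) = ver.tgt (boxH.src A)
  br_eq : ∀ A, hor.tgt (boxV.tgt A) = ver.tgt (boxH.tgt A)
  top_hcomp : ∀ A B h h', boxV.src (boxH.comp A B h) = hor.comp (boxV.src A) (boxV.src B) h'
  bottom_hcomp : ∀ A B h h', boxV.tgt (boxH.comp A B h) = hor.comp (boxV.tgt A) (boxV.tgt B) h'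
  left_vcomp : ∀ A B h h', boxH.src (boxV.comp A B h) = ver.comp (boxH.src A) (boxH.src B) h'
  right_vcomp : ∀ A B h h', boxH.tgt (boxV.comp A B h) = ver.comp (boxH.tgt A) (boxH.tgt B) h'
  left_id : ∀ x, boxH.src (boxV.id x) = ver.id (hor.src x)
  right_id : ∀ x, boxH.tgt (boxV.id x) = ver.id (hor.tgt x)
  top_id : ∀ g, boxV.src (boxH.id g) = hor.id (ver.src g)
  bottom_id : ∀ g, boxV.tgt (boxH.id g) = hor.id (ver.tgt g)
  id_id : ∀ p, boxV.id (hor.id p) = boxH.id (ver.id p)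
  hcomp_id : ∀ x y h h', boxH.comp (boxV.id x) (boxV.id y) h' = boxV.id (hor.comp x y h)
  vcomp_id : ∀ f g h h', boxV.comp (boxH.id f) (boxH.id g) h' = boxH.id (ver.comp f g h)
  /-- the interchange law -/
  interchange : ∀ A B C D hAB hCD hAC hBD h₁' h₂',
    boxV.comp (boxH.comp A B hAB) (boxH.comp C D hCD) h₁' =
      boxH.comp (boxV.comp A C hAC) (boxV.comp B D hBD) h₂'

namespace DoubleGroupoid

variable (T : DoubleGroupoid.{u})

instance [Finite T.Box] : Finite T.Hor :=
  Finite.of_injective T.boxV.id fun x y h => by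
    rw [← T.boxV.src_id x, h, T.boxV.src_id]

instance [Finite T.Box] : Finite T.Ver :=
  Finite.of_injective T.boxH.id fun x y h => by
    rw [← T.boxH.src_id x, h, T.boxH.src_id]

instance [Finite T.Box] : Finite T.Pt :=
  Finite.of_injective T.hor.id fun x y h => by
    rw [← T.hor.src_id x, h, T.hor.src_id]

variable {T}

/-- The four sides of a box. -/
abbrev top (A : T.Box) : T.Hor := T.boxV.src A
abbrev bottom (A : T.Box) : T.Hor := T.boxV.tgt A
abbrev left (A : T.Box) : T.Ver := T.boxH.src A
abbrev right (A : T.Box) : T.Ver := T.boxH.tgt A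

/-- The four vertices of a box. -/
abbrev tl (A : T.Box) : T.Pt := T.hor.src (top A)
abbrev tr (A : T.Box) : T.Pt := T.hor.tgt (top A)
abbrev bl (A : T.Box) : T.Pt := T.hor.src (bottom A)
abbrev br (A : T.Box) : T.Pt := T.hor.tgt (bottom A)

/-- The horizontal inverse `A^h`, the vertical inverse `A^v`, and `A⁻¹ = (A^h)^v`. -/
abbrev hinv (A : T.Box) : T.Box := T.boxH.inv A
abbrev vinv (A : T.Box) : T.Box := T.boxV.inv A
abbrev tinv (A : T.Box) : T.Box := vinv (hinv A)

/-- Composability of two adjacent sides, for horizontally or vertically composable boxes. -/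
theorem top_comp {A B : T.Box} (h : right A = left B) : T.hor.tgt (top A) = T.hor.src (top B) := by
  rw [T.tr_eq, T.tl_eq]; exact congrArg _ h

theorem bottom_comp {A B : T.Box} (h : right A = left B) :
    T.hor.tgt (bottom A) = T.hor.src (bottom B) := by
  rw [T.br_eq, T.bl_eq]; exact congrArg _ h

theorem left_comp {A B : T.Box} (h : bottom A = top B) :
    T.ver.tgt (left A) = T.ver.src (left B) := by
  rw [← T.bl_eq, ← T.tl_eq]; exact congrArg _ h

theorem right_comp {A B : T.Box} (h : bottom A = top B) :
    T.ver.tgt (right A) = T.ver.src (right B) := by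
  rw [← T.br_eq, ← T.tr_eq]; exact congrArg _ h

theorem top_hinv (A : T.Box) : top (hinv A) = T.hor.inv (top A) := by
  have h : right A = left (hinv A) := (T.boxH.src_inv A).symm
  refine T.hor.eq_inv_of_comp (top_comp h) ?_
  rw [← T.top_hcomp A (hinv A) h (top_comp h), T.boxH.comp_inv, T.top_id]
  exact T.hor.isId_id _

theorem bottom_hinv (A : T.Box) : bottom (hinv A) = T.hor.inv (bottom A) := by
  have h : right A = left (hinv A) := (T.boxH.src_inv A).symm
  refine T.hor.eq_inv_of_comp (bottom_comp h) ?_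
  rw [← T.bottom_hcomp A (hinv A) h (bottom_comp h), T.boxH.comp_inv, T.bottom_id]
  exact T.hor.isId_id _

theorem left_vinv (A : T.Box) : left (vinv A) = T.ver.inv (left A) := by
  have h : bottom A = top (vinv A) := (T.boxV.src_inv A).symm
  refine T.ver.eq_inv_of_comp (left_comp h) ?_
  rw [← T.left_vcomp A (vinv A) h (left_comp h), T.boxV.comp_inv, T.left_id]
  exact T.ver.isId_id _

theorem right_vinv (A : T.Box) : right (vinv A) = T.ver.inv (right A) := by
  have h : bottom A = top (vinv A) := (T.boxV.src_inv A).symm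
  refine T.ver.eq_inv_of_comp (right_comp h) ?_
  rw [← T.right_vcomp A (vinv A) h (right_comp h), T.boxV.comp_inv, T.right_id]
  exact T.ver.isId_id _

theorem top_tinv (A : T.Box) : top (tinv A) = T.hor.inv (bottom A) :=
  (T.boxV.src_inv _).trans (bottom_hinv A)

theorem bottom_tinv (A : T.Box) : bottom (tinv A) = T.hor.inv (top A) :=
  (T.boxV.tgt_inv _).trans (top_hinv A)

theorem left_tinv (A : T.Box) : left (tinv A) = T.ver.inv (right A) :=
  (left_vinv _).trans (congrArg _ (T.boxH.src_inv A))

theorem right_tinv (A : T.Box) : right (tinv A) = T.ver.inv (left A) :=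
  (right_vinv _).trans (congrArg _ (T.boxH.tgt_inv A))

theorem hcomp_vcomp_id {x : T.Hor} {X Y : T.Box} (hX : right (T.boxV.id x) = left X)
    (hY : right (T.boxV.id x) = left Y) (hXY : bottom X = top Y)
    (h : right (T.boxV.id x) = left (T.boxV.comp X Y hXY))
    (h' : bottom (T.boxH.comp _ X hX) = top (T.boxH.comp _ Y hY)) :
    T.boxH.comp (T.boxV.id x) (T.boxV.comp X Y hXY) h =
      T.boxV.comp (T.boxH.comp _ X hX) (T.boxH.comp _ Y hY) h' := by
  have hx : bottom (T.boxV.id x) = top (T.boxV.id x) :=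
    (T.boxV.tgt_id x).trans (T.boxV.src_id x).symm
  have e : T.boxV.comp (T.boxV.id x) (T.boxV.id x) hx = T.boxV.id x :=
    T.boxV.id_comp_of (T.boxV.isId_id x) hx
  have h2 : right (T.boxV.comp (T.boxV.id x) (T.boxV.id x) hx) = left (T.boxV.comp X Y hXY) := by
    rw [e]; exact h
  rw [T.interchange _ X _ Y hX hY hx hXY h' h2]
  exact T.boxH.comp_congr e.symm rfl h

theorem vcomp_hcomp_id {x : T.Hor} {X Y : T.Box} (hX : right X = left (T.boxV.id x))
    (hY : right Y = left (T.boxV.id x)) (hXY : bottom X = top Y)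
    (h : right (T.boxV.comp X Y hXY) = left (T.boxV.id x))
    (h' : bottom (T.boxH.comp X _ hX) = top (T.boxH.comp Y _ hY)) :
    T.boxH.comp (T.boxV.comp X Y hXY) (T.boxV.id x) h =
      T.boxV.comp (T.boxH.comp X _ hX) (T.boxH.comp Y _ hY) h' := by
  have hx : bottom (T.boxV.id x) = top (T.boxV.id x) :=
    (T.boxV.tgt_id x).trans (T.boxV.src_id x).symm
  have e : T.boxV.comp (T.boxV.id x) (T.boxV.id x) hx = T.boxV.id x :=
    T.boxV.id_comp_of (T.boxV.isId_id x) hx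
  have h2 : right (T.boxV.comp X Y hXY) = left (T.boxV.comp (T.boxV.id x) (T.boxV.id x) hx) := by
    rw [e]; exact h
  rw [T.interchange X _ Y _ hX hY hXY hx h' h2]
  exact T.boxH.comp_congr rfl e.symm h

/-! ### The core groupoids -/

variable (T) in
/-- The set `D` of boxes whose left and bottom sides are identities. -/
abbrev CoreD : Type u := {D : T.Box // T.ver.IsId (left D) ∧ T.hor.IsId (bottom D)}

variable (T) in
/-- The set `E` of boxes whose right and top sides are identities. -/
abbrev CoreE : Type u := {E : T.Box // T.ver.IsId (right E) ∧ T.hor.IsId (top E)}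

section CoreD

theorem left_eq_of_isId {D : T.Box} (hD : T.ver.IsId (left D)) : left D = T.ver.id (tl D) :=
  (ArrowGroupoid.IsId.eq_src _ hD).trans (congrArg _ (T.tl_eq D).symm)

theorem right_eq_of_isId {E : T.Box} (hE : T.ver.IsId (right E)) : right E = T.ver.id (br E) :=
  (ArrowGroupoid.IsId.eq_tgt _ hE).trans (congrArg _ (T.br_eq E).symm)

/-- A vertical identity box can be put to the left of `D` when `l(D)` is an identity. -/
theorem id_left_comp {x : T.Hor} {D : T.Box} (hD : T.ver.IsId (left D))
    (h : T.hor.tgt x = tl D) : right (T.boxV.id x) = left D :=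
  (T.right_id x).trans ((congrArg _ h).trans (left_eq_of_isId hD).symm)

/-- A vertical identity box can be put to the right of `E` when `r(E)` is an identity. -/
theorem id_right_comp {x : T.Hor} {E : T.Box} (hE : T.ver.IsId (right E))
    (h : br E = T.hor.src x) : right E = left (T.boxV.id x) :=
  (right_eq_of_isId hE).trans ((congrArg _ h).trans (T.left_id x).symm)

theorem top_id_left {x : T.Hor} {D : T.Box} (h : right (T.boxV.id x) = left D)
    (h' : T.hor.tgt x = tl D) :
    top (T.boxH.comp (T.boxV.id x) D h) = T.hor.comp x (top D) h' :=
  (T.top_hcomp _ _ h (top_comp h)).trans (T.hor.comp_congr (T.boxV.src_id x) rfl _)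

theorem bottom_id_left {x : T.Hor} {D : T.Box} (h : right (T.boxV.id x) = left D)
    (hb : T.hor.IsId (bottom D)) : bottom (T.boxH.comp (T.boxV.id x) D h) = x :=
  (T.bottom_hcomp _ _ h (bottom_comp h)).trans
    ((T.hor.comp_id_of hb _).trans (T.boxV.tgt_id x))

theorem left_id_left {x : T.Hor} {D : T.Box} (h : right (T.boxV.id x) = left D) :
    left (T.boxH.comp (T.boxV.id x) D h) = T.ver.id (T.hor.src x) :=
  (T.boxH.src_comp _ _ _).trans (T.left_id x)

theorem bottom_id_right {x : T.Hor} {E : T.Box} (h : right E = left (T.boxV.id x))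
    (h' : T.hor.tgt (bottom E) = T.hor.src x) :
    bottom (T.boxH.comp E (T.boxV.id x) h) = T.hor.comp (bottom E) x h' :=
  (T.bottom_hcomp _ _ h (bottom_comp h)).trans (T.hor.comp_congr rfl (T.boxV.tgt_id x) _)

theorem top_id_right {x : T.Hor} {E : T.Box} (h : right E = left (T.boxV.id x))
    (ht : T.hor.IsId (top E)) : top (T.boxH.comp E (T.boxV.id x) h) = x :=
  (T.top_hcomp _ _ h (top_comp h)).trans
    ((T.hor.id_comp_of ht _).trans (T.boxV.src_id x))

theorem right_id_right {x : T.Hor} {E : T.Box} (h : right E = left (T.boxV.id x)) :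
    right (T.boxH.comp E (T.boxV.id x) h) = T.ver.id (T.hor.tgt x) :=
  (T.boxH.tgt_comp _ _ _).trans (T.right_id x)

/-- The composition `D ⋄ L`: the box `id t(L)` followed by `D` in the first row, above the row
consisting of `L` (followed by `id r(L)`). -/
def CoreD.comp (D L : T.CoreD) (h : tl D.1 = tr L.1) : T.CoreD :=
  ⟨T.boxV.comp (T.boxH.comp (T.boxV.id (top L.1)) D.1 (id_left_comp D.2.1 h.symm)) L.1
    (bottom_id_left _ D.2.2), by
    constructor
    · have h₁ : right (T.boxV.id (top L.1)) = left D.1 := id_left_comp D.2.1 h.symm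
      have h₂ := T.left_vcomp _ L.1 (bottom_id_left h₁ D.2.2)
        (left_comp (bottom_id_left h₁ D.2.2))
      rw [T.ver.id_comp_of ⟨_, (left_id_left h₁).symm⟩] at h₂
      exact L.2.1.of_eq h₂
    · exact L.2.2.of_eq (T.boxV.tgt_comp _ _ _)⟩

theorem CoreD.top_comp (D L : T.CoreD) (h : tl D.1 = tr L.1) :
    top (D.comp L h).1 = T.hor.comp (top L.1) (top D.1) h.symm :=
  (T.boxV.src_comp _ _ _).trans (top_id_left _ h.symm)

/-- The identity `Θ_P` of the core groupoid `D`. -/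
def CoreD.id (p : T.Pt) : T.CoreD :=
  ⟨T.boxV.id (T.hor.id p), by
    constructor
    · rw [left, T.left_id]; exact T.ver.isId_id _
    · rw [bottom, T.boxV.tgt_id]; exact T.hor.isId_id _⟩

/-- The inverse `D^[-1] = (id t(D)⁻¹ D)^v`. -/
def CoreD.inv (D : T.CoreD) : T.CoreD :=
  ⟨vinv (T.boxH.comp (T.boxV.id (T.hor.inv (top D.1))) D.1
    (id_left_comp D.2.1 (T.hor.tgt_inv _))), by
    constructor
    · rw [left_vinv, left_id_left, T.ver.inv_id (T.ver.isId_id _)]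
      exact T.ver.isId_id _
    · rw [bottom, T.boxV.tgt_inv]
      refine ⟨T.hor.tgt (top D.1), ?_⟩
      rw [← T.hor.inv_comp]
      exact (top_id_left _ (T.hor.tgt_inv _)).symm⟩

theorem CoreD.top_inv (D : T.CoreD) : top D.inv.1 = T.hor.inv (top D.1) :=
  (T.boxV.src_inv _).trans (bottom_id_left _ D.2.2)

variable (T) in
/-- The core groupoid `D ⇉ P`, with source `rt(D)` and target `lt(D)`. -/
def coreD : ArrowGroupoid T.CoreD T.Pt where
  src D := tr D.1
  tgt D := tl D.1
  id := CoreD.id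
  inv := CoreD.inv
  comp := CoreD.comp
  src_id p := (congrArg _ (T.boxV.src_id _)).trans (T.hor.tgt_id p)
  tgt_id p := (congrArg _ (T.boxV.src_id _)).trans (T.hor.src_id p)
  src_inv D := (congrArg _ D.top_inv).trans (T.hor.tgt_inv _)
  tgt_inv D := (congrArg _ D.top_inv).trans (T.hor.src_inv _)
  src_comp D L h := (congrArg _ (D.top_comp L h)).trans (T.hor.tgt_comp _ _ _)
  tgt_comp D L h := (congrArg _ (D.top_comp L h)).trans (T.hor.src_comp _ _ _)
  id_comp L := by
    apply Subtype.ext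
    refine T.boxV.id_comp_of ?_ _
    refine ⟨top L.1, ?_⟩
    refine Eq.symm (T.boxH.comp_id_of ?_ _)
    refine ⟨T.ver.id (tr L.1), ?_⟩
    exact (T.id_id _).symm
  comp_id D := by
    apply Subtype.ext
    refine (T.boxV.comp_id_of ⟨_, rfl⟩ _).trans ?_
    refine T.boxH.id_comp_of ⟨T.ver.id (tl D.1), ?_⟩ _
    rw [← T.id_id]
    exact congrArg T.boxV.id (T.boxV.src_id _).symm
  assoc D L K h₁ h₂ := by
    apply Subtype.ext
    have a₁ : right (T.boxV.id (top L.1)) = left D.1 := id_left_comp D.2.1 h₁.symm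
    have a₂ : right (T.boxV.id (top K.1)) = left L.1 := id_left_comp L.2.1 h₂.symm
    have a₃ : right (T.boxV.id (top K.1)) = left (T.boxV.id (top L.1)) := by
      rw [left, T.left_id, right, T.right_id]
      exact congrArg _ h₂.symm
    have a₄ : right (T.boxV.id (top K.1)) = left (T.boxH.comp _ D.1 a₁) :=
      a₃.trans (T.boxH.src_comp _ _ _).symm
    have b₁ : bottom (T.boxH.comp _ D.1 a₁) = top L.1 := bottom_id_left _ D.2.2
    have b₂ : bottom (T.boxH.comp _ L.1 a₂) = top K.1 := bottom_id_left _ L.2.2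
    have b₃ : bottom (T.boxH.comp _ _ a₄) = top (T.boxH.comp _ L.1 a₂) := by
      refine (T.bottom_hcomp _ _ a₄ (bottom_comp a₄)).trans ?_
      refine Eq.trans ?_ (T.top_hcomp _ _ a₂ (DoubleGroupoid.top_comp a₂)).symm
      exact T.hor.comp_congr ((T.boxV.tgt_id _).trans (T.boxV.src_id _).symm) b₁ _
    have c₁ : right (T.boxV.id (top K.1)) = left (T.boxV.comp _ L.1 b₁) :=
      id_left_comp (D.comp L h₁).2.1
        (h₂.symm.trans ((congrArg _ (D.top_comp L h₁)).trans (T.hor.src_comp _ _ _)).symm)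
    have e₁ := hcomp_vcomp_id a₄ a₂ b₁ c₁ b₃
    have e₂ : T.boxH.comp (T.boxV.id (top K.1)) (T.boxH.comp _ D.1 a₁) a₄ =
        T.boxH.comp (T.boxV.id (top (L.comp K h₂).1)) D.1
          (id_left_comp D.2.1 (h₁.trans ((congrArg _ (L.top_comp K h₂)).trans
            (T.hor.tgt_comp _ _ _)).symm).symm) := by
      rw [← T.boxH.assoc _ _ _ a₃ a₁]
      refine T.boxH.comp_congr ?_ rfl _
      rw [T.hcomp_id _ _ h₂.symm]
      exact congrArg _ (L.top_comp K h₂).symm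
    refine (T.boxV.comp_congr e₁ rfl _).trans ?_
    refine (T.boxV.assoc _ _ K.1 b₃ b₂).trans ?_
    exact T.boxV.comp_congr e₂ rfl _
  comp_inv D := by
    apply Subtype.ext
    have h₁ : right (T.boxV.id (T.hor.inv (top D.1))) = left D.1 :=
      id_left_comp D.2.1 (T.hor.tgt_inv _)
    have e : T.boxH.comp (T.boxV.id (top D.inv.1)) D.1
        (id_left_comp D.2.1 ((congrArg _ D.top_inv).trans (T.hor.tgt_inv _))) =
        T.boxH.comp _ D.1 h₁ :=
      T.boxH.comp_congr (congrArg _ D.top_inv) rfl _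
    refine (T.boxV.comp_congr e rfl _).trans ?_
    refine (T.boxV.comp_inv _).trans (congrArg T.boxV.id ?_)
    exact (top_id_left h₁ (T.hor.tgt_inv _)).trans (T.hor.inv_comp _)
  inv_comp D := by
    apply Subtype.ext
    have h₁ : right (T.boxV.id (T.hor.inv (top D.1))) = left D.1 :=
      id_left_comp D.2.1 (T.hor.tgt_inv _)
    have h₂ : right (T.boxV.id (top D.1)) = left D.inv.1 :=
      id_left_comp D.inv.2.1 ((congrArg _ D.top_inv).trans (T.hor.src_inv _)).symm
    have h₃ : right (T.boxV.id (top D.1)) = left (T.boxV.id (T.hor.inv (top D.1))) :=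
      (T.right_id _).trans ((congrArg _ (T.hor.src_inv _).symm).trans (T.left_id _).symm)
    have h₄ : right (T.boxV.id (top D.1)) = left (T.boxH.comp _ D.1 h₁) :=
      h₃.trans (T.boxH.src_comp _ _ _).symm
    have e₁ : T.boxH.comp (T.boxV.id (top D.1)) (T.boxH.comp _ D.1 h₁) h₄ = D.1 := by
      rw [← T.boxH.assoc _ _ _ h₃ h₁]
      refine T.boxH.id_comp_of ?_ _
      rw [T.hcomp_id _ _ (T.hor.src_inv _).symm, T.hor.comp_inv, T.id_id]
      exact T.boxH.isId_id _
    have h₅ : bottom D.inv.1 = top (T.boxH.comp _ D.1 h₁) := T.boxV.tgt_inv _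
    have h₆ : bottom (T.boxH.comp _ D.inv.1 h₂) = top (T.boxH.comp _ _ h₄) :=
      (bottom_id_left h₂ D.inv.2.2).trans (congrArg _ e₁).symm
    have e₂ : T.boxV.comp D.inv.1 (T.boxH.comp _ D.1 h₁) h₅ =
        T.boxV.id (T.hor.inv (top D.1)) :=
      (T.boxV.inv_comp _).trans (congrArg _ (bottom_id_left h₁ D.2.2))
    have h₇ : right (T.boxV.id (top D.1)) =
        left (T.boxV.comp D.inv.1 (T.boxH.comp _ D.1 h₁) h₅) :=
      h₃.trans (congrArg left e₂).symm
    refine (T.boxV.comp_congr rfl e₁.symm _).trans ?_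
    refine (hcomp_vcomp_id h₂ h₄ h₅ h₇ h₆).symm.trans ?_
    refine (T.boxH.comp_congr rfl e₂ _).trans ?_
    refine (T.hcomp_id _ _ (T.hor.src_inv _).symm _).trans (congrArg _ ?_)
    exact T.hor.comp_inv _

end CoreD

section CoreE

/-- The composition `M ∘ E`: the first row consists of `E` (preceded by `id l(E)`), above the row
consisting of `M` followed by `id b(E)`. -/
def CoreE.comp (M E : T.CoreE) (h : br M.1 = bl E.1) : T.CoreE :=
  ⟨T.boxV.comp E.1 (T.boxH.comp M.1 (T.boxV.id (bottom E.1)) (id_right_comp M.2.1 h))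
    (top_id_right _ M.2.2).symm, by
    constructor
    · have h₁ : right M.1 = left (T.boxV.id (bottom E.1)) := id_right_comp M.2.1 h
      have h₂ := T.right_vcomp E.1 _ (top_id_right h₁ M.2.2).symm
        (right_comp (top_id_right h₁ M.2.2).symm)
      rw [T.ver.id_comp_of E.2.1] at h₂
      exact ⟨_, (h₂.trans (right_id_right h₁)).symm⟩
    · exact E.2.2.of_eq (T.boxV.src_comp _ _ _)⟩

theorem CoreE.bottom_comp (M E : T.CoreE) (h : br M.1 = bl E.1) :
    bottom (M.comp E h).1 = T.hor.comp (bottom M.1) (bottom E.1) h :=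
  (T.boxV.tgt_comp _ _ _).trans (bottom_id_right _ h)

/-- The identity `Θ_P` of the core groupoid `E`. -/
def CoreE.id (p : T.Pt) : T.CoreE :=
  ⟨T.boxV.id (T.hor.id p), by
    constructor
    · rw [right, T.right_id]; exact T.ver.isId_id _
    · rw [top, T.boxV.src_id]; exact T.hor.isId_id _⟩

/-- The inverse `E^(-1) = (E id b(E)⁻¹)^v`. -/
def CoreE.inv (E : T.CoreE) : T.CoreE :=
  ⟨vinv (T.boxH.comp E.1 (T.boxV.id (T.hor.inv (bottom E.1)))
    (id_right_comp E.2.1 (T.hor.src_inv _).symm)), by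
    constructor
    · rw [right_vinv, right_id_right, T.ver.inv_id (T.ver.isId_id _)]
      exact T.ver.isId_id _
    · rw [top, T.boxV.src_inv]
      refine ⟨T.hor.src (bottom E.1), ?_⟩
      rw [← T.hor.comp_inv]
      exact (bottom_id_right _ (T.hor.src_inv _).symm).symm⟩

theorem CoreE.bottom_inv (E : T.CoreE) : bottom E.inv.1 = T.hor.inv (bottom E.1) :=
  (T.boxV.tgt_inv _).trans (top_id_right _ E.2.2)

variable (T) in
/-- The core groupoid `E ⇉ P`, with source `bl(E)` and target `br(E)`. -/
def coreE : ArrowGroupoid T.CoreE T.Pt where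
  src E := bl E.1
  tgt E := br E.1
  id := CoreE.id
  inv := CoreE.inv
  comp := CoreE.comp
  src_id p := (congrArg _ (T.boxV.tgt_id _)).trans (T.hor.src_id p)
  tgt_id p := (congrArg _ (T.boxV.tgt_id _)).trans (T.hor.tgt_id p)
  src_inv E := (congrArg _ E.bottom_inv).trans (T.hor.src_inv _)
  tgt_inv E := (congrArg _ E.bottom_inv).trans (T.hor.tgt_inv _)
  src_comp M E h := (congrArg _ (M.bottom_comp E h)).trans (T.hor.src_comp _ _ _)
  tgt_comp M E h := (congrArg _ (M.bottom_comp E h)).trans (T.hor.tgt_comp _ _ _)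
  id_comp E := by
    apply Subtype.ext
    refine T.boxV.comp_id_of ⟨bottom E.1, ?_⟩ _
    refine Eq.symm (T.boxH.id_comp_of ⟨T.ver.id (bl E.1), ?_⟩ _)
    exact (T.id_id _).symm
  comp_id M := by
    apply Subtype.ext
    refine (T.boxV.id_comp_of ⟨_, rfl⟩ _).trans ?_
    refine T.boxH.comp_id_of ⟨T.ver.id (br M.1), ?_⟩ _
    rw [← T.id_id]
    exact congrArg T.boxV.id (T.boxV.tgt_id _).symm
  assoc M N E h₁ h₂ := by
    apply Subtype.ext
    have a₁ : right M.1 = left (T.boxV.id (bottom N.1)) := id_right_comp M.2.1 h₁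
    have a₂ : right N.1 = left (T.boxV.id (bottom E.1)) := id_right_comp N.2.1 h₂
    have a₃ : right (T.boxV.id (bottom N.1)) = left (T.boxV.id (bottom E.1)) :=
      (T.right_id _).trans ((congrArg _ h₂).trans (T.left_id _).symm)
    have a₄ : right (T.boxH.comp M.1 _ a₁) = left (T.boxV.id (bottom E.1)) :=
      (T.boxH.tgt_comp _ _ _).trans a₃
    have b₁ : bottom N.1 = top (T.boxH.comp M.1 _ a₁) := (top_id_right a₁ M.2.2).symm
    have b₂ : bottom E.1 = top (T.boxH.comp N.1 _ a₂) := (top_id_right a₂ N.2.2).symm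
    have b₃ : bottom (T.boxH.comp N.1 _ a₂) = top (T.boxH.comp _ _ a₄) := by
      refine (T.bottom_hcomp _ _ a₂ (DoubleGroupoid.bottom_comp a₂)).trans ?_
      refine Eq.trans ?_ (T.top_hcomp _ _ a₄ (top_comp a₄)).symm
      exact T.hor.comp_congr b₁ ((T.boxV.tgt_id _).trans (T.boxV.src_id _).symm) _
    have c₁ : right (T.boxV.comp N.1 _ b₁) = left (T.boxV.id (bottom E.1)) :=
      id_right_comp (M.comp N h₁).2.1
        (((congrArg _ (M.bottom_comp N h₁)).trans (T.hor.tgt_comp _ _ _)).trans h₂)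
    have e₁ := vcomp_hcomp_id a₂ a₄ b₁ c₁ b₃
    have e₂ : T.boxH.comp (T.boxH.comp M.1 _ a₁) (T.boxV.id (bottom E.1)) a₄ =
        T.boxH.comp M.1 (T.boxV.id (bottom (N.comp E h₂).1))
          (id_right_comp M.2.1 (h₁.trans ((congrArg _ (N.bottom_comp E h₂)).trans
            (T.hor.src_comp _ _ _)).symm)) := by
      rw [T.boxH.assoc _ _ _ a₁ a₃]
      refine T.boxH.comp_congr rfl ?_ _
      rw [T.hcomp_id _ _ h₂]
      exact congrArg _ (N.bottom_comp E h₂).symm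
    refine (T.boxV.comp_congr rfl e₁ _).trans ?_
    refine (T.boxV.assoc E.1 _ _ b₂ b₃).symm.trans ?_
    exact T.boxV.comp_congr rfl e₂ _
  comp_inv E := by
    apply Subtype.ext
    have h₁ : right E.1 = left (T.boxV.id (T.hor.inv (bottom E.1))) :=
      id_right_comp E.2.1 (T.hor.src_inv _).symm
    have e : T.boxH.comp E.1 (T.boxV.id (bottom E.inv.1))
        (id_right_comp E.2.1 ((congrArg _ E.bottom_inv).trans (T.hor.src_inv _)).symm) =
        T.boxH.comp E.1 _ h₁ :=
      T.boxH.comp_congr rfl (congrArg _ E.bottom_inv) _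
    refine (T.boxV.comp_congr rfl e _).trans ?_
    refine (T.boxV.inv_comp _).trans (congrArg T.boxV.id ?_)
    exact (bottom_id_right h₁ (T.hor.src_inv _).symm).trans (T.hor.comp_inv _)
  inv_comp E := by
    apply Subtype.ext
    have h₁ : right E.1 = left (T.boxV.id (T.hor.inv (bottom E.1))) :=
      id_right_comp E.2.1 (T.hor.src_inv _).symm
    have h₂ : right E.inv.1 = left (T.boxV.id (bottom E.1)) :=
      id_right_comp E.inv.2.1 ((congrArg _ E.bottom_inv).trans (T.hor.tgt_inv _))
    have h₃ : right (T.boxV.id (T.hor.inv (bottom E.1))) = left (T.boxV.id (bottom E.1)) :=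
      (T.right_id _).trans ((congrArg _ (T.hor.tgt_inv _)).trans (T.left_id _).symm)
    have h₄ : right (T.boxH.comp E.1 _ h₁) = left (T.boxV.id (bottom E.1)) :=
      (T.boxH.tgt_comp _ _ _).trans h₃
    have e₁ : T.boxH.comp (T.boxH.comp E.1 _ h₁) (T.boxV.id (bottom E.1)) h₄ = E.1 := by
      rw [T.boxH.assoc _ _ _ h₁ h₃]
      refine T.boxH.comp_id_of ?_ _
      rw [T.hcomp_id _ _ (T.hor.tgt_inv _), T.hor.inv_comp, T.id_id]
      exact T.boxH.isId_id _
    have h₅ : bottom (T.boxH.comp E.1 _ h₁) = top E.inv.1 := (T.boxV.src_inv _).symm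
    have h₆ : bottom (T.boxH.comp _ _ h₄) = top (T.boxH.comp E.inv.1 _ h₂) :=
      (congrArg _ e₁).trans (top_id_right h₂ E.inv.2.2).symm
    have e₂ : T.boxV.comp (T.boxH.comp E.1 _ h₁) E.inv.1 h₅ =
        T.boxV.id (T.hor.inv (bottom E.1)) :=
      (T.boxV.comp_inv _).trans (congrArg _ (top_id_right h₁ E.2.2))
    have h₇ : right (T.boxV.comp (T.boxH.comp E.1 _ h₁) E.inv.1 h₅) =
        left (T.boxV.id (bottom E.1)) :=
      (congrArg right e₂).trans h₃
    refine (T.boxV.comp_congr e₁.symm rfl _).trans ?_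
    refine (vcomp_hcomp_id h₄ h₂ h₅ h₇ h₆).symm.trans ?_
    refine (T.boxH.comp_congr e₂ rfl _).trans ?_
    refine (T.hcomp_id _ _ (T.hor.tgt_inv _) _).trans (congrArg _ ?_)
    exact T.hor.inv_comp _

end CoreE

/-- The box `φ(A)`, with `A⁻¹` above `id r(A)`, for a box `A` whose top side is an identity. -/
def phi (A : T.Box) (h : T.hor.IsId (top A)) : T.CoreD :=
  have h₁ : bottom (tinv A) = top (T.boxH.id (right A)) := by
    rw [bottom_tinv, T.hor.inv_id h]
    refine (ArrowGroupoid.IsId.eq_tgt _ h).trans ?_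
    exact (congrArg _ (T.tr_eq A)).trans (T.top_id _).symm
  ⟨T.boxV.comp (tinv A) (T.boxH.id (right A)) h₁, by
    constructor
    · refine ⟨T.ver.tgt (right A), ?_⟩
      rw [left, T.left_vcomp _ _ h₁ (left_comp h₁), ← T.ver.inv_comp]
      exact T.ver.comp_congr (left_tinv A).symm (T.boxH.src_id _).symm _
    · exact (T.hor.isId_id _).of_eq ((T.boxV.tgt_comp _ _ _).trans (T.bottom_id _))⟩

/-- The box `ψ(A)`, with `id l(A)` above `A⁻¹`, for a box `A` whose bottom side is an identity. -/
def psi (A : T.Box) (h : T.hor.IsId (bottom A)) : T.CoreE :=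
  have h₁ : bottom (T.boxH.id (left A)) = top (tinv A) := by
    rw [top_tinv, T.hor.inv_id h, bottom, T.bottom_id, ← T.bl_eq]
    exact (ArrowGroupoid.IsId.eq_src _ h).symm
  ⟨T.boxV.comp (T.boxH.id (left A)) (tinv A) h₁, by
    constructor
    · refine ⟨T.ver.src (left A), ?_⟩
      rw [right, T.right_vcomp _ _ h₁ (right_comp h₁), ← T.ver.comp_inv]
      exact T.ver.comp_congr (T.boxH.tgt_id _).symm (right_tinv A).symm _
    · exact (T.hor.isId_id _).of_eq ((T.boxV.src_comp _ _ _).trans (T.top_id _))⟩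

/-! ### The deformed structure -/

variable (T) in
/-- The vector space `k^(ϑ)T` with basis the boxes of `T`. -/
def Deformed (k : Type v) [Field k] (_ϑ : T.Pt → kˣ) : Type (max u v) :=
  GroupoidAlgebra k T.boxV

namespace Deformed

variable {k : Type v} [Field k] (ϑ : T.Pt → kˣ)

noncomputable instance : AddCommGroup (T.Deformed k ϑ) :=
  inferInstanceAs (AddCommGroup (GroupoidAlgebra k T.boxV))

noncomputable instance : Module k (T.Deformed k ϑ) :=
  inferInstanceAs (Module k (GroupoidAlgebra k T.boxV))

/-- The multiplication is that of the groupoid algebra of the vertical composition groupoid. -/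
noncomputable instance [Finite T.Box] : Ring (T.Deformed k ϑ) :=
  inferInstanceAs (Ring (GroupoidAlgebra k T.boxV))

noncomputable instance [Finite T.Box] : Algebra k (T.Deformed k ϑ) :=
  inferInstanceAs (Algebra k (GroupoidAlgebra k T.boxV))

/-- The box `A`, as an element of the basis of `k^(ϑ)T`. -/
noncomputable def box (A : T.Box) : T.Deformed k ϑ := GroupoidAlgebra.of k T.boxV A

/-- The linear map with prescribed values on the basis of boxes. -/
noncomputable def lift {M : Type*} [AddCommGroup M] [Module k M] (φ : T.Box → M) :
    T.Deformed k ϑ →ₗ[k] M :=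
  GroupoidAlgebra.lift k T.boxV φ

@[simp]
theorem lift_box {M : Type*} [AddCommGroup M] [Module k M] (φ : T.Box → M) (A : T.Box) :
    lift ϑ φ (box ϑ A) = φ A :=
  GroupoidAlgebra.lift_of φ A

theorem hom_ext {M : Type*} [AddCommMonoid M] [Module k M] {R S : T.Deformed k ϑ →ₗ[k] M}
    (h : ∀ A, R (box ϑ A) = S (box ϑ A)) : R = S :=
  GroupoidAlgebra.hom_ext h

/-- The weight `ℸ(B) = ϑ(bl(B))`. -/
def daleth (B : T.Box) : k := ϑ (bl B)

end Deformed

/-- `X` and `Y` are horizontally composable, with composition `A`. -/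
def IsHComp (X Y A : T.Box) : Prop := ∃ h : right X = left Y, T.boxH.comp X Y h = A

namespace Deformed

variable {k : Type v} [Field k] (ϑ : T.Pt → kˣ)

/-- The value `Δ(A) = ∑_{XY = A} ℸ(Y) X ⊗ Y` of the comultiplication on a box `A`. -/
noncomputable def comulBox (A : T.Box) : T.Deformed k ϑ ⊗[k] T.Deformed k ϑ :=
  ∑ᶠ q : {q : T.Box × T.Box // IsHComp q.1 q.2 A}, daleth ϑ q.1.2 • (box ϑ q.1.1 ⊗ₜ box ϑ q.1.2)

open Classical in
/-- The value of the counit on a box `A`: it is `ℸ(A)⁻¹` if `A` is a horizontal identity, and `0`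
otherwise. -/
noncomputable def counitBox (A : T.Box) : k :=
  if T.boxH.IsId A then (daleth ϑ A)⁻¹ else 0

open Classical in
theorem comulBox_eq [Fintype T.Box] (A : T.Box) : comulBox ϑ A =
    ∑ q ∈ Finset.univ.filter (fun q : T.Box × T.Box => IsHComp q.1 q.2 A),
      daleth ϑ q.2 • (box ϑ q.1 ⊗ₜ[k] box ϑ q.2) := by
  rw [comulBox, finsum_eq_sum_of_fintype]
  exact (Finset.sum_subtype _ (fun q => by simp)
    (fun q : T.Box × T.Box => daleth ϑ q.2 • (box ϑ q.1 ⊗ₜ[k] box ϑ q.2))).symm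

theorem daleth_hcomp {X Y A : T.Box} (h : IsHComp X Y A) : daleth ϑ A = daleth ϑ X := by
  obtain ⟨h, rfl⟩ := h
  unfold daleth bl bottom
  rw [T.bottom_hcomp _ _ h (bottom_comp h), T.hor.src_comp]

theorem isHComp_assoc {U V X Y A : T.Box} (h₁ : IsHComp X Y A) (h₂ : IsHComp U V X) :
    ∃ Z, IsHComp U Z A ∧ IsHComp V Y Z := by
  obtain ⟨h₁, rfl⟩ := h₁
  obtain ⟨h₂, rfl⟩ := h₂
  have h₃ : right V = left Y := (T.boxH.tgt_comp _ _ _).symm.trans h₁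
  exact ⟨_, ⟨_, (T.boxH.assoc U V Y h₂ h₃).symm⟩, ⟨h₃, rfl⟩⟩

theorem isHComp_assoc' {U V Z Y A : T.Box} (h₁ : IsHComp U Z A) (h₂ : IsHComp V Y Z) :
    ∃ X, IsHComp X Y A ∧ IsHComp U V X := by
  obtain ⟨h₁, rfl⟩ := h₁
  obtain ⟨h₂, rfl⟩ := h₂
  have h₃ : right U = left V := h₁.trans (T.boxH.src_comp _ _ _)
  exact ⟨_, ⟨_, T.boxH.assoc U V Y h₃ h₂⟩, ⟨h₃, rfl⟩⟩

theorem isHComp_unique {X Y A B : T.Box} (h₁ : IsHComp X Y A) (h₂ : IsHComp X Y B) : A = B := by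
  obtain ⟨h₁, rfl⟩ := h₁
  obtain ⟨h₂, rfl⟩ := h₂
  rfl

theorem isHComp_id_left (A : T.Box) : IsHComp (T.boxH.id (left A)) A A :=
  ⟨T.boxH.tgt_id _, T.boxH.id_comp A⟩

theorem isHComp_id_right (A : T.Box) : IsHComp A (T.boxH.id (right A)) A :=
  ⟨(T.boxH.src_id _).symm, T.boxH.comp_id A⟩

theorem eq_of_isHComp_left {X Y A : T.Box} (h : IsHComp X Y A) (hX : T.boxH.IsId X) :
    X = T.boxH.id (left A) ∧ Y = A := by
  obtain ⟨h, rfl⟩ := h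
  have := T.boxH.id_comp_of hX h
  refine ⟨?_, this.symm⟩
  rw [left, T.boxH.src_comp]
  exact ArrowGroupoid.IsId.eq_src _ hX

theorem eq_of_isHComp_right {X Y A : T.Box} (h : IsHComp X Y A) (hY : T.boxH.IsId Y) :
    X = A ∧ Y = T.boxH.id (right A) := by
  obtain ⟨h, rfl⟩ := h
  have := T.boxH.comp_id_of hY h
  refine ⟨this.symm, ?_⟩
  rw [right, T.boxH.tgt_comp]
  exact ArrowGroupoid.IsId.eq_tgt _ hY

theorem daleth_ne_zero (A : T.Box) : daleth ϑ A ≠ 0 := (ϑ (bl A)).ne_zero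

open Classical in
theorem sum_hcomp_assoc [Fintype T.Box] {M : Type*} [AddCommMonoid M] (A : T.Box)
    (F : T.Box → T.Box → T.Box → M) :
    (∑ p ∈ Finset.univ.filter (fun p : T.Box × T.Box => IsHComp p.1 p.2 A),
      ∑ q ∈ Finset.univ.filter (fun q : T.Box × T.Box => IsHComp q.1 q.2 p.1), F q.1 q.2 p.2) =
    ∑ p ∈ Finset.univ.filter (fun p : T.Box × T.Box => IsHComp p.1 p.2 A),
      ∑ q ∈ Finset.univ.filter (fun q : T.Box × T.Box => IsHComp q.1 q.2 p.2),
        F p.1 q.1 q.2 := by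
  let hm : T.Box → T.Box → T.Box := fun X Y =>
    if h : right X = left Y then T.boxH.comp X Y h else X
  have hm_eq : ∀ {X Y A : T.Box}, IsHComp X Y A → hm X Y = A := by
    rintro X Y A ⟨h, rfl⟩
    exact dif_pos h
  rw [Finset.sum_sigma', Finset.sum_sigma']
  refine Finset.sum_nbij' (fun x => ⟨(x.2.1, hm x.2.2 x.1.2), (x.2.2, x.1.2)⟩)
    (fun x => ⟨(hm x.1.1 x.2.1, x.2.2), (x.1.1, x.2.1)⟩) ?_ ?_ ?_ ?_ ?_
  · rintro ⟨⟨X, Y⟩, ⟨U, V⟩⟩ hx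
    simp only [Finset.mem_sigma, Finset.mem_filter, Finset.mem_univ, true_and] at hx ⊢
    obtain ⟨Z, h₁, h₂⟩ := isHComp_assoc hx.1 hx.2
    rw [hm_eq h₂]
    exact ⟨h₁, h₂⟩
  · rintro ⟨⟨U, Z⟩, ⟨V, Y⟩⟩ hx
    simp only [Finset.mem_sigma, Finset.mem_filter, Finset.mem_univ, true_and] at hx ⊢
    obtain ⟨X, h₁, h₂⟩ := isHComp_assoc' hx.1 hx.2
    rw [hm_eq h₂]
    exact ⟨h₁, h₂⟩
  · rintro ⟨⟨X, Y⟩, ⟨U, V⟩⟩ hx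
    simp only [Finset.mem_sigma, Finset.mem_filter, Finset.mem_univ, true_and] at hx ⊢
    rw [hm_eq hx.2]
  · rintro ⟨⟨U, Z⟩, ⟨V, Y⟩⟩ hx
    simp only [Finset.mem_sigma, Finset.mem_filter, Finset.mem_univ, true_and] at hx ⊢
    rw [hm_eq hx.2]
  · intro x _
    rfl

noncomputable instance [Finite T.Box] : Coalgebra k (T.Deformed k ϑ) where
  comul := lift ϑ (comulBox ϑ)
  counit := lift ϑ (counitBox ϑ)
  coassoc := by
    classical
    cases nonempty_fintype T.Box
    refine hom_ext ϑ fun A => ?_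
    have e₁ : ((TensorProduct.assoc k (T.Deformed k ϑ) (T.Deformed k ϑ)
        (T.Deformed k ϑ)).toLinearMap ∘ₗ (lift ϑ (comulBox ϑ)).rTensor _ ∘ₗ lift ϑ (comulBox ϑ))
           (box ϑ A) =
        ∑ p ∈ Finset.univ.filter (fun p : T.Box × T.Box => IsHComp p.1 p.2 A),
          ∑ q ∈ Finset.univ.filter (fun q : T.Box × T.Box => IsHComp q.1 q.2 p.1),
            (daleth ϑ q.2 * daleth ϑ p.2) •
              (box ϑ q.1 ⊗ₜ[k] (box ϑ q.2 ⊗ₜ[k] box ϑ p.2)) := by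
      simp only [LinearMap.comp_apply, lift_box, comulBox_eq, map_sum, map_smul,
        LinearMap.rTensor_tmul, TensorProduct.sum_tmul, Finset.smul_sum, LinearEquiv.coe_coe]
      refine Finset.sum_congr rfl fun p _ => Finset.sum_congr rfl fun q _ => ?_
      rw [← TensorProduct.smul_tmul', map_smul, TensorProduct.assoc_tmul, smul_smul, mul_comm]
    have e₂ : ((lift ϑ (comulBox ϑ)).lTensor _ ∘ₗ lift ϑ (comulBox ϑ)) (box ϑ A) =
        ∑ p ∈ Finset.univ.filter (fun p : T.Box × T.Box => IsHComp p.1 p.2 A),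
          ∑ q ∈ Finset.univ.filter (fun q : T.Box × T.Box => IsHComp q.1 q.2 p.2),
            (daleth ϑ q.1 * daleth ϑ q.2) •
              (box ϑ p.1 ⊗ₜ[k] (box ϑ q.1 ⊗ₜ[k] box ϑ q.2)) := by
      simp only [LinearMap.comp_apply, lift_box, comulBox_eq, map_sum, map_smul,
        LinearMap.lTensor_tmul, TensorProduct.tmul_sum, Finset.smul_sum]
      refine Finset.sum_congr rfl fun p _ => Finset.sum_congr rfl fun q hq => ?_
      rw [TensorProduct.tmul_smul, smul_smul,
        daleth_hcomp ϑ (Finset.mem_filter.mp hq).2]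
    exact (e₁.trans (sum_hcomp_assoc A fun U V Y => (daleth ϑ V * daleth ϑ Y) •
      (box ϑ U ⊗ₜ[k] (box ϑ V ⊗ₜ[k] box ϑ Y)))).trans e₂.symm
  rTensor_counit_comp_comul := by
    classical
    cases nonempty_fintype T.Box
    refine hom_ext ϑ fun A => ?_
    simp only [LinearMap.comp_apply, lift_box, comulBox_eq, map_sum, map_smul,
      LinearMap.rTensor_tmul]
    rw [Finset.sum_eq_single (T.boxH.id (left A), A)]
    · rw [counitBox, if_pos (T.boxH.isId_id _), ← daleth_hcomp ϑ (isHComp_id_left A),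
        TensorProduct.smul_tmul', smul_eq_mul, mul_inv_cancel₀ (daleth_ne_zero ϑ A)]
      rfl
    · rintro ⟨X, Y⟩ hq hne
      have hn : ¬ T.boxH.IsId X := fun hX => hne
        (Prod.ext_iff.mpr (eq_of_isHComp_left (Finset.mem_filter.mp hq).2 hX))
      rw [counitBox, if_neg hn, TensorProduct.zero_tmul, smul_zero]
    · intro hn
      exact absurd (Finset.mem_filter.mpr ⟨Finset.mem_univ (_, A), isHComp_id_left A⟩) hn
  lTensor_counit_comp_comul := by
    classical
    cases nonempty_fintype T.Box
    refine hom_ext ϑ fun A => ?_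
    simp only [LinearMap.comp_apply, lift_box, comulBox_eq, map_sum, map_smul,
      LinearMap.lTensor_tmul]
    rw [Finset.sum_eq_single (A, T.boxH.id (right A))]
    · rw [counitBox, if_pos (T.boxH.isId_id _), ← TensorProduct.tmul_smul, smul_eq_mul,
        mul_inv_cancel₀ (daleth_ne_zero ϑ _)]
      rfl
    · rintro ⟨X, Y⟩ hq hne
      have hn : ¬ T.boxH.IsId Y := fun hY => hne
        (Prod.ext_iff.mpr (eq_of_isHComp_right (Finset.mem_filter.mp hq).2 hY))
      rw [counitBox, if_neg hn, TensorProduct.tmul_zero, smul_zero]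
    · intro hn
      exact absurd (Finset.mem_filter.mpr ⟨Finset.mem_univ (A, _), isHComp_id_right A⟩) hn

/-- The element `_D1 = ∑ {id z, D}`, the sum over `z ∈ H` with `r(z) = e(D) = lt(D)`. -/
noncomputable def oneD (D : T.CoreD) : T.Deformed k ϑ :=
  ∑ᶠ z : {z : T.Hor // T.hor.tgt z = T.coreD.tgt D},
    box ϑ (T.boxH.comp (T.boxV.id z.1) D.1 (id_left_comp D.2.1 z.2))

/-- The element `1_E = ∑ {E, id x}`, the sum over `x ∈ H` with `l(x) = e(E) = br(E)`. -/
noncomputable def oneE (E : T.CoreE) : T.Deformed k ϑ :=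
  ∑ᶠ x : {x : T.Hor // T.hor.src x = T.coreE.tgt E},
    box ϑ (T.boxH.comp E.1 (T.boxV.id x.1) (id_right_comp E.2.1 x.2.symm))

end Deformed

end DoubleGroupoid

open DoubleGroupoid DoubleGroupoid.Deformed

/-!
# Weak Hopf algebras from double groupoids

The algebra is the groupoid algebra of the vertical composition of boxes, so it is semisimple by
the groupoid form of Maschke's theorem (`GroupoidAlgebra.isSemisimpleRing`): a linear projection
onto a left ideal is averaged over the separability idempotent.

The axioms that involve `Δ(1)` or `ε` hold without any condition. Both families reduce to one
geometric fact, `DoubleGroupoid.isIdRow_iff`: a row `U V W` is a vertical identity exactly when `V`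
is cut by a horizontal line into `Y` above `Z` such that `U Y` and `Z W` are vertical identities, and
then the cut is unique. Read in `T`, this is the first formula for `Δ⁽²⁾(1)`; turning `T` upside down
gives the second one, and transposing gives the two formulas for `ε(abc)`.

The normalization condition is therefore equivalent to multiplicativity of `Δ`. If `C` is `A` above
`B`, a factorization `A = XY` contributes to `Δ(A)Δ(B)` the weight `ℸ(Y)` times the part of `Δ(C)`
whose first factors have top side `top X` (`comul_mul_comul`). The weights of the factorizations
with a given `top X` are those of the boxes `Y` with prescribed top and right sides
(`sum_daleth_right`), so normalization turns the weighted sum over factorizations into a plain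
sum over horizontal arrows (`IsNormalized.sum_smul_top`). Conversely, `A = id g` and `B = id g⁻¹`
isolate a single weighted sum (`isNormalized_of_comul_mul`).

The formulas for `ε_s` and `ε_t` are read off from `Δ(1)`: the boxes that occur are those of the form
`(id z) φ(A)` and `ψ(A) (id x)` (`isIdPair_isIdColumn_iff_phi`, `isIdPair_isIdColumn_iff_psi`).
The antipode axioms follow from the interchange law and the two weighted summation formulas
`IsNormalized.sum_smul_top` and `IsNormalized.sum_smul_bottom`; an antipode is unique because it is a
relative convolution inverse of the identity (`IsAntipode.unique`). Finally `D ↦ _D1` and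
`E ↦ 1_E` are multiplicative, respectively antimultiplicative, and injective since `D` is the only
summand of `_D1` in the core groupoid; as `φ` and `ψ` are onto the core groupoids, their images are
the source and target subalgebras.
-/

/-! ### Composition in a groupoid as a relation -/

namespace ArrowGroupoid

variable {G P : Type u} (𝒢 : ArrowGroupoid G P)

/-- `f` and `g` are composable, with composition `h`. Composition is treated as a relation so that
identities between composites need no transport of composability proofs. -/
def IsComp (f g h : G) : Prop := ∃ e : 𝒢.tgt f = 𝒢.src g, 𝒢.comp f g e = h

variable {𝒢}

theorem exists_isComp {f g : G} (e : 𝒢.tgt f = 𝒢.src g) : ∃ h, 𝒢.IsComp f g h := ⟨_, e, rfl⟩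

theorem isComp_inv_right (f : G) : 𝒢.IsComp f (𝒢.inv f) (𝒢.id (𝒢.src f)) := ⟨_, 𝒢.comp_inv f⟩

theorem isComp_inv_left (f : G) : 𝒢.IsComp (𝒢.inv f) f (𝒢.id (𝒢.tgt f)) := ⟨_, 𝒢.inv_comp f⟩

theorem isComp_id_left (f : G) : 𝒢.IsComp (𝒢.id (𝒢.src f)) f f := ⟨_, 𝒢.id_comp f⟩

theorem isComp_id_right (f : G) : 𝒢.IsComp f (𝒢.id (𝒢.tgt f)) f := ⟨_, 𝒢.comp_id f⟩

theorem inv_inv (f : G) : 𝒢.inv (𝒢.inv f) = f :=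
  (𝒢.eq_inv_of_comp (𝒢.tgt_inv f) ((𝒢.isId_id _).of_eq (𝒢.inv_comp f))).symm

namespace IsComp

variable {f g h k x y z f' g' h' : G}

theorem composable (H : 𝒢.IsComp f g h) : 𝒢.tgt f = 𝒢.src g := H.1

theorem src (H : 𝒢.IsComp f g h) : 𝒢.src h = 𝒢.src f := by
  obtain ⟨e, rfl⟩ := H; exact 𝒢.src_comp _ _ _

theorem tgt (H : 𝒢.IsComp f g h) : 𝒢.tgt h = 𝒢.tgt g := by
  obtain ⟨e, rfl⟩ := H; exact 𝒢.tgt_comp _ _ _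

theorem unique (H : 𝒢.IsComp f g h) (H' : 𝒢.IsComp f g h') : h = h' := by
  obtain ⟨e, rfl⟩ := H; obtain ⟨e', rfl⟩ := H'; rfl

theorem assoc (H : 𝒢.IsComp f g x) (H' : 𝒢.IsComp x k y) :
    ∃ z, 𝒢.IsComp g k z ∧ 𝒢.IsComp f z y := by
  obtain ⟨e, rfl⟩ := H; obtain ⟨e', rfl⟩ := H'
  exact ⟨_, ⟨(𝒢.tgt_comp _ _ e).symm.trans e', rfl⟩, ⟨_, (𝒢.assoc f g k e _).symm⟩⟩

theorem assoc' (H : 𝒢.IsComp g k z) (H' : 𝒢.IsComp f z y) :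
    ∃ x, 𝒢.IsComp f g x ∧ 𝒢.IsComp x k y := by
  obtain ⟨e, rfl⟩ := H; obtain ⟨e', rfl⟩ := H'
  exact ⟨_, ⟨e'.trans (𝒢.src_comp _ _ e), rfl⟩, ⟨_, 𝒢.assoc f g k _ e⟩⟩

theorem eq_right (H : 𝒢.IsComp f g h) (hf : 𝒢.IsId f) : h = g := by
  obtain ⟨e, rfl⟩ := H; exact 𝒢.id_comp_of hf e

theorem eq_left (H : 𝒢.IsComp f g h) (hg : 𝒢.IsId g) : h = f := by
  obtain ⟨e, rfl⟩ := H; exact 𝒢.comp_id_of hg e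

theorem eq_inv (H : 𝒢.IsComp f g h) (hh : 𝒢.IsId h) : g = 𝒢.inv f := by
  obtain ⟨e, rfl⟩ := H; exact 𝒢.eq_inv_of_comp e hh

theorem inv_left (H : 𝒢.IsComp f g h) : 𝒢.IsComp (𝒢.inv f) h g := by
  obtain ⟨y, hy⟩ := exists_isComp ((𝒢.tgt_inv f).trans H.src.symm)
  obtain ⟨x, hx, hx'⟩ := H.assoc' hy
  have hid : 𝒢.IsId x := (𝒢.isId_id _).of_eq (hx.unique (isComp_inv_left f))
  rwa [hx'.eq_right hid] at hy

theorem inv_right (H : 𝒢.IsComp f g h) : 𝒢.IsComp h (𝒢.inv g) f := by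
  obtain ⟨y, hy⟩ := exists_isComp (H.tgt.trans (𝒢.src_inv g).symm)
  obtain ⟨x, hx, hx'⟩ := H.assoc hy
  have hid : 𝒢.IsId x := (𝒢.isId_id _).of_eq (hx.unique (isComp_inv_right g))
  rwa [hx'.eq_left hid] at hy

theorem inv (H : 𝒢.IsComp f g h) : 𝒢.IsComp (𝒢.inv g) (𝒢.inv f) (𝒢.inv h) :=
  H.inv_left.inv_right.inv_left

theorem left_cancel (H : 𝒢.IsComp f g h) (H' : 𝒢.IsComp f g' h) : g = g' :=
  H.inv_left.unique H'.inv_left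

theorem right_cancel (H : 𝒢.IsComp f g h) (H' : 𝒢.IsComp f' g h) : f = f' :=
  H.inv_right.unique H'.inv_right

end IsComp

theorem IsComp.isId_of_eq {f g : G} (H : 𝒢.IsComp f g f) : 𝒢.IsId g :=
  (𝒢.isId_id _).of_eq (H.left_cancel (isComp_id_right f))

theorem isComp_of_isId_left {e f : G} (he : 𝒢.IsId e) (h : 𝒢.tgt e = 𝒢.src f) :
    𝒢.IsComp e f f := ⟨h, 𝒢.id_comp_of he h⟩

theorem isComp_of_isId_right {e f : G} (he : 𝒢.IsId e) (h : 𝒢.tgt f = 𝒢.src e) :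
    𝒢.IsComp f e f := ⟨h, 𝒢.comp_id_of he h⟩

variable (𝒢) in
/-- The opposite groupoid. -/
def op : ArrowGroupoid G P where
  src := 𝒢.tgt
  tgt := 𝒢.src
  id := 𝒢.id
  inv := 𝒢.inv
  comp f g h := 𝒢.comp g f h.symm
  src_id := 𝒢.tgt_id
  tgt_id := 𝒢.src_id
  src_inv := 𝒢.tgt_inv
  tgt_inv := 𝒢.src_inv
  src_comp _ _ _ := 𝒢.tgt_comp _ _ _
  tgt_comp _ _ _ := 𝒢.src_comp _ _ _
  id_comp := 𝒢.comp_id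
  comp_id := 𝒢.id_comp
  assoc f g k h₁ h₂ := (𝒢.assoc k g f h₂.symm h₁.symm).symm
  comp_inv := 𝒢.inv_comp
  inv_comp := 𝒢.comp_inv

theorem op_isComp {f g h : G} : 𝒢.op.IsComp f g h ↔ 𝒢.IsComp g f h :=
  ⟨fun ⟨e, H⟩ => ⟨e.symm, H⟩, fun ⟨e, H⟩ => ⟨e.symm, H⟩⟩

end ArrowGroupoid

/-! ### Maschke's theorem for groupoid algebras -/

namespace GroupoidAlgebra

variable (k : Type v) [Field k] {G P : Type u} (𝒢 : ArrowGroupoid G P)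

variable {𝒢} in
theorem of_mul_of_isComp {f g h : G} (H : 𝒢.IsComp f g h) :
    of k 𝒢 f * of k 𝒢 g = of k 𝒢 h := by
  obtain ⟨e, rfl⟩ := H
  rw [of_mul_of, mulArrows_pos k 𝒢 e]

variable {𝒢} in
theorem of_mul_of_eq_zero {f g : G} (H : ¬ 𝒢.tgt f = 𝒢.src g) :
    of k 𝒢 f * of k 𝒢 g = 0 := by
  rw [of_mul_of, mulArrows_neg k 𝒢 H]

open Classical in
/-- Left translation by `a` is a bijection between the arrows with the source of `f` and those
with the source of `af`. -/
theorem card_star_eq [Fintype G] {a f g : G} (h : 𝒢.IsComp a f g) :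
    (Finset.univ.filter fun x => 𝒢.src x = 𝒢.src f).card =
      (Finset.univ.filter fun x => 𝒢.src x = 𝒢.src g).card := by
  have key : ∀ {a f g : G}, 𝒢.IsComp a f g →
      (Finset.univ.filter fun x => 𝒢.src x = 𝒢.src f).card ≤
      (Finset.univ.filter fun x => 𝒢.src x = 𝒢.src g).card := by
    intro a f g h
    have hc : ∀ x, 𝒢.src x = 𝒢.src f → ∃ y, 𝒢.IsComp a x y := fun x hx =>
      ArrowGroupoid.exists_isComp (h.composable.trans hx.symm)
    choose! t ht using hc
    refine Finset.card_le_card_of_injOn t (fun x hx => ?_) (fun x hx y hy e => ?_)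
    · simp only [Finset.coe_filter, Finset.mem_univ, true_and, Set.mem_ofPred_eq] at hx ⊢
      exact (ht x hx).src.trans h.src.symm
    · simp only [Finset.coe_filter, Finset.mem_univ, true_and, Set.mem_ofPred_eq] at hx hy
      have h1 := ht x hx
      have h2 := ht y hy
      rw [← e] at h2
      exact h1.left_cancel h2
  exact le_antisymm (key h) (key h.inv_left)

/-- The algebra of a finite groupoid over a field of characteristic zero is semisimple: averaging a
linear projection `π` onto a left ideal over the separability idempotent
`∑ c(f) f ⊗ f⁻¹`, where `c(f)⁻¹` is the number of arrows with the same source as `f`,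
gives a module projection. -/
theorem isSemisimpleRing [CharZero k] [Finite G] [Finite P] :
    IsSemisimpleRing (GroupoidAlgebra k 𝒢) := by
  classical
  cases nonempty_fintype G
  cases nonempty_fintype P
  let c : G → k := fun f => ((Finset.univ.filter fun x => 𝒢.src x = 𝒢.src f).card : k)⁻¹
  have hc : ∀ {a f g : G}, 𝒢.IsComp a f g → c f = c g := fun h => by
    simp only [c, card_star_eq 𝒢 h]
  refine { exists_isCompl := fun N => ?_ }
  let N' : Submodule k (GroupoidAlgebra k 𝒢) := N.restrictScalars k
  obtain ⟨π, hπ⟩ := N'.subtype.exists_leftInverse_of_injective N'.ker_subtype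
  have hπ' : ∀ x (hx : x ∈ N), (π x : GroupoidAlgebra k 𝒢) = x := fun x hx =>
    congrArg Subtype.val (LinearMap.congr_fun hπ ⟨x, hx⟩)
  let avg : GroupoidAlgebra k 𝒢 →ₗ[k] GroupoidAlgebra k 𝒢 := ∑ f : G, c f •
    (LinearMap.mulLeft k (of k 𝒢 f) ∘ₗ N'.subtype ∘ₗ π ∘ₗ LinearMap.mulLeft k (of k 𝒢 (𝒢.inv f)))
  have avg_apply : ∀ m, avg m =
      ∑ f : G, c f • (of k 𝒢 f * (π (of k 𝒢 (𝒢.inv f) * m) : GroupoidAlgebra k 𝒢)) := fun m => by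
    simp [avg]
  have avg_mem : ∀ m, avg m ∈ N := fun m => by
    rw [avg_apply]
    exact N'.sum_mem fun f _ => N'.smul_mem _ (N.smul_mem _ (π _).2)
  have avg_of : ∀ a m, avg (of k 𝒢 a * m) = of k 𝒢 a * avg m := fun a m => by
    have restrict : ∀ (F : G → GroupoidAlgebra k 𝒢) (p : P), (∀ f, F f ≠ 0 → 𝒢.src f = p) →
        ∑ f, F f = ∑ f ∈ Finset.univ.filter (fun f => 𝒢.src f = p), F f :=
      fun F p h => (Finset.sum_filter_of_ne fun f _ hf => h f hf).symm
    rw [avg_apply, avg_apply, Finset.mul_sum]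
    -- the nonzero terms of the two sides correspond under the translation `f ↦ g = af`
    refine (restrict _ (𝒢.src a) ?_).trans (Eq.trans ?_ (restrict _ (𝒢.tgt a) ?_).symm)
    · intro g hg
      by_contra hn
      refine hg ?_
      rw [← mul_assoc (of k 𝒢 (𝒢.inv g)),
        of_mul_of_eq_zero k fun e => hn ((𝒢.tgt_inv g).symm.trans e), zero_mul, map_zero]
      simp
    · have hex : ∀ f, 𝒢.src f = 𝒢.tgt a → ∃ g, 𝒢.IsComp a f g := fun f hf =>
        ArrowGroupoid.exists_isComp hf.symm
      choose! t ht using hex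
      symm
      refine Finset.sum_bij (fun f _ => t f) (fun f hf => ?_) (fun f hf f' hf' e => ?_)
        (fun g hg => ?_) (fun f hf => ?_)
      · simp only [Finset.mem_filter, Finset.mem_univ, true_and] at hf ⊢
        exact (ht f hf).src
      · simp only [Finset.mem_filter, Finset.mem_univ, true_and] at hf hf'
        have h := ht f' hf'
        rw [← e] at h
        exact (ht f hf).left_cancel h
      · simp only [Finset.mem_filter, Finset.mem_univ, true_and] at hg
        obtain ⟨f, hf⟩ := 𝒢.exists_isComp ((𝒢.tgt_inv a).trans hg.symm)
        have hf' := hf.inv_left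
        rw [ArrowGroupoid.inv_inv] at hf'
        have hs := hf'.composable.symm
        exact ⟨f, by simpa using hs, (ht f hs).unique hf'⟩
      · simp only [Finset.mem_filter, Finset.mem_univ, true_and] at hf
        have h := ht f hf
        have h' := h.inv.inv_right
        rw [ArrowGroupoid.inv_inv] at h'
        rw [mul_smul_comm, ← mul_assoc, of_mul_of_isComp k h, hc h, ← mul_assoc,
          of_mul_of_isComp k h']
    · intro f hf
      by_contra hn
      refine hf ?_
      rw [mul_smul_comm, ← mul_assoc, of_mul_of_eq_zero k fun e => hn e.symm, zero_mul, smul_zero]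
  have avg_mul : ∀ a m, avg (a * m) = a * avg m := fun a m => by
    induction a using induction_of with
    | h0 => simp
    | hadd x y hx hy => rw [add_mul, map_add, hx, hy, add_mul]
    | hof r f => rw [smul_mul_assoc, map_smul, avg_of, smul_mul_assoc]
  have avg_id : ∀ x, x ∈ N → avg x = x := fun x hx => by
    have h : avg x = (∑ f : G, c f • of k 𝒢 (𝒢.id (𝒢.src f))) * x := by
      rw [avg_apply, Finset.sum_mul]
      refine Finset.sum_congr rfl fun f _ => ?_
      rw [show (π (of k 𝒢 (𝒢.inv f) * x) : GroupoidAlgebra k 𝒢) = _ from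
          hπ' _ (N.smul_mem (of k 𝒢 (𝒢.inv f)) hx), ← mul_assoc,
        of_mul_of_isComp k (𝒢.isComp_inv_right f), smul_mul_assoc]
    have h1 : (∑ f : G, c f • of k 𝒢 (𝒢.id (𝒢.src f))) = 1 := by
      rw [one_def, finsum_eq_sum_of_fintype, ← Finset.sum_fiberwise (g := 𝒢.src)]
      refine Finset.sum_congr rfl fun p _ => ?_
      have hp : ∀ f ∈ Finset.univ.filter (fun f => 𝒢.src f = p),
          c f • of k 𝒢 (𝒢.id (𝒢.src f)) =
          ((Finset.univ.filter fun x => 𝒢.src x = p).card : k)⁻¹ • of k 𝒢 (𝒢.id p) := by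
        intro f hf
        obtain rfl := (Finset.mem_filter.mp hf).2
        rfl
      rw [Finset.sum_congr rfl hp, Finset.sum_const, ← Nat.cast_smul_eq_nsmul k, smul_smul,
        mul_inv_cancel₀, one_smul]
      rw [Nat.cast_ne_zero]
      exact Finset.card_ne_zero_of_mem
        (Finset.mem_filter.mpr ⟨Finset.mem_univ (𝒢.id p), 𝒢.src_id p⟩)
    rw [h, h1, one_mul]
  let proj : GroupoidAlgebra k 𝒢 →ₗ[GroupoidAlgebra k 𝒢] N :=
    { toFun := fun m => ⟨avg m, avg_mem m⟩
      map_add' := fun x y => Subtype.ext (map_add avg x y)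
      map_smul' := fun a x => Subtype.ext (avg_mul a x) }
  exact ⟨_, LinearMap.isCompl_of_proj (f := proj) fun x => Subtype.ext (avg_id x.1 x.2)⟩

end GroupoidAlgebra

/-! ### Symmetries of double groupoids and the interchange law -/

namespace DoubleGroupoid

open ArrowGroupoid

/-- The transposed double groupoid, with rows and columns exchanged. -/
def transpose (T : DoubleGroupoid.{u}) : DoubleGroupoid.{u} where
  Pt := T.Pt
  Hor := T.Ver
  Ver := T.Hor
  Box := T.Box
  hor := T.ver
  ver := T.hor
  boxV := T.boxH
  boxH := T.boxV
  tl_eq A := (T.tl_eq A).symm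
  tr_eq A := (T.bl_eq A).symm
  bl_eq A := (T.tr_eq A).symm
  br_eq A := (T.br_eq A).symm
  top_hcomp := T.left_vcomp
  bottom_hcomp := T.right_vcomp
  left_vcomp := T.top_hcomp
  right_vcomp := T.bottom_hcomp
  left_id := T.top_id
  right_id := T.bottom_id
  top_id := T.left_id
  bottom_id := T.right_id
  id_id p := (T.id_id p).symm
  hcomp_id := T.vcomp_id
  vcomp_id := T.hcomp_id
  interchange A B C D hAB hCD hAC hBD h₁' h₂' :=
    (T.interchange A C B D hAC hBD hAB hCD h₂' h₁').symm

/-- The double groupoid turned upside down. -/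
def vflip (T : DoubleGroupoid.{u}) : DoubleGroupoid.{u} where
  Pt := T.Pt
  Hor := T.Hor
  Ver := T.Ver
  Box := T.Box
  hor := T.hor
  ver := T.ver.op
  boxV := T.boxV.op
  boxH := T.boxH
  tl_eq := T.bl_eq
  tr_eq := T.br_eq
  bl_eq := T.tl_eq
  br_eq := T.tr_eq
  top_hcomp := T.bottom_hcomp
  bottom_hcomp := T.top_hcomp
  left_vcomp A B h h' := T.left_vcomp B A h.symm h'.symm
  right_vcomp A B h h' := T.right_vcomp B A h.symm h'.symm
  left_id := T.left_id
  right_id := T.right_id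
  top_id := T.bottom_id
  bottom_id := T.top_id
  id_id := T.id_id
  hcomp_id := T.hcomp_id
  vcomp_id f g h h' := T.vcomp_id g f h.symm h'.symm
  interchange A B C D hAB hCD hAC hBD h₁' h₂' :=
    T.interchange C D A B hCD hAB hAC.symm hBD.symm h₁'.symm h₂'

variable {T : DoubleGroupoid.{u}}

theorem isComp_top {A B C : T.Box} (h : T.boxH.IsComp A B C) :
    T.hor.IsComp (top A) (top B) (top C) := by
  obtain ⟨e, rfl⟩ := h
  exact ⟨top_comp e, (T.top_hcomp _ _ e (top_comp e)).symm⟩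

theorem isComp_bottom {A B C : T.Box} (h : T.boxH.IsComp A B C) :
    T.hor.IsComp (bottom A) (bottom B) (bottom C) := by
  obtain ⟨e, rfl⟩ := h
  exact ⟨bottom_comp e, (T.bottom_hcomp _ _ e (bottom_comp e)).symm⟩

theorem isComp_left {A B C : T.Box} (h : T.boxV.IsComp A B C) :
    T.ver.IsComp (left A) (left B) (left C) :=
  isComp_top (T := T.transpose) h

theorem isComp_right {A B C : T.Box} (h : T.boxV.IsComp A B C) :
    T.ver.IsComp (right A) (right B) (right C) :=
  isComp_bottom (T := T.transpose) h

theorem isId_left {A : T.Box} (h : T.boxV.IsId A) : T.ver.IsId (left A) := by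
  obtain ⟨x, rfl⟩ := h
  exact ⟨_, (T.left_id x).symm⟩

theorem isId_right {A : T.Box} (h : T.boxV.IsId A) : T.ver.IsId (right A) := by
  obtain ⟨x, rfl⟩ := h
  exact ⟨_, (T.right_id x).symm⟩

theorem isId_top {A : T.Box} (h : T.boxH.IsId A) : T.hor.IsId (top A) :=
  isId_left (T := T.transpose) h

theorem isId_bottom {A : T.Box} (h : T.boxH.IsId A) : T.hor.IsId (bottom A) :=
  isId_right (T := T.transpose) h

theorem isId_hcomp {A B C : T.Box} (h : T.boxH.IsComp A B C) (hA : T.boxV.IsId A)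
    (hB : T.boxV.IsId B) : T.boxV.IsId C := by
  obtain ⟨x, rfl⟩ := hA
  obtain ⟨y, rfl⟩ := hB
  obtain ⟨e, rfl⟩ := h
  have hxy : T.hor.tgt x = T.hor.src y := by
    have := top_comp e
    rwa [top, top, T.boxV.src_id, T.boxV.src_id] at this
  exact ⟨_, (T.hcomp_id x y hxy e).symm⟩

theorem isId_vcomp {A B C : T.Box} (h : T.boxV.IsComp A B C) (hA : T.boxH.IsId A)
    (hB : T.boxH.IsId B) : T.boxH.IsId C :=
  isId_hcomp (T := T.transpose) h hA hB

/-- The interchange law for a two by two array of boxes with rows `P`, `Q` and columns `R`, `S`. -/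
theorem isComp_interchange {A B C D P Q R S : T.Box} (hP : T.boxH.IsComp A B P)
    (hQ : T.boxH.IsComp C D Q) (hR : T.boxV.IsComp A C R) (hS : T.boxV.IsComp B D S) :
    ∃ Z, T.boxV.IsComp P Q Z ∧ T.boxH.IsComp R S Z := by
  have h₁ : bottom P = top Q := by
    have h := isComp_bottom hP
    have h' := isComp_top hQ
    rw [← show bottom A = top C from hR.composable,
      ← show bottom B = top D from hS.composable] at h'
    exact h.unique h'
  have h₂ : right R = left S := by
    have h := isComp_right hR
    have h' := isComp_left hS
    rw [← show right A = left B from hP.composable,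
      ← show right C = left D from hQ.composable] at h'
    exact h.unique h'
  obtain ⟨e₁, rfl⟩ := hP
  obtain ⟨e₂, rfl⟩ := hQ
  obtain ⟨e₃, rfl⟩ := hR
  obtain ⟨e₄, rfl⟩ := hS
  exact ⟨_, ⟨h₁, rfl⟩, ⟨h₂, (T.interchange A B C D e₁ e₂ e₃ e₄ h₁ h₂).symm⟩⟩

/-- The interchange law when the composite of the rows is already known. -/
theorem isComp_columns {A B C D P Q R S Z : T.Box} (hP : T.boxH.IsComp A B P)
    (hQ : T.boxH.IsComp C D Q) (hR : T.boxV.IsComp A C R) (hS : T.boxV.IsComp B D S)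
    (hZ : T.boxV.IsComp P Q Z) : T.boxH.IsComp R S Z := by
  obtain ⟨Z', h, h'⟩ := isComp_interchange hP hQ hR hS
  rwa [hZ.unique h]

/-- The interchange law when the composite of the columns is already known. -/
theorem isComp_rows {A B C D P Q R S Z : T.Box} (hP : T.boxH.IsComp A B P)
    (hQ : T.boxH.IsComp C D Q) (hR : T.boxV.IsComp A C R) (hS : T.boxV.IsComp B D S)
    (hZ : T.boxH.IsComp R S Z) : T.boxV.IsComp P Q Z :=
  isComp_columns (T := T.transpose) hR hS hP hQ hZ

/-- The horizontal inverse is a functor for vertical composition. -/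
theorem isComp_hinv {A B C : T.Box} (h : T.boxV.IsComp A B C) :
    T.boxV.IsComp (hinv A) (hinv B) (hinv C) := by
  have e : bottom (hinv A) = top (hinv B) := by
    rw [bottom_hinv, top_hinv]
    exact congrArg _ h.composable
  obtain ⟨C', hC'⟩ := exists_isComp e
  obtain ⟨Z, hZ, hZ'⟩ := isComp_interchange (T.boxH.isComp_inv_right A) (T.boxH.isComp_inv_right B)
    h hC'
  have := hZ'.eq_inv (isId_vcomp hZ (T.boxH.isId_id _) (T.boxH.isId_id _))
  rwa [this] at hC'

/-- The vertical inverse is a functor for horizontal composition. -/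
theorem isComp_vinv {A B C : T.Box} (h : T.boxH.IsComp A B C) :
    T.boxH.IsComp (vinv A) (vinv B) (vinv C) :=
  isComp_hinv (T := T.transpose) h

theorem isId_hinv {A : T.Box} (h : T.boxV.IsId A) : T.boxV.IsId (hinv A) := by
  obtain ⟨x, rfl⟩ := h
  have h := isComp_hinv (T.boxV.isComp_id_left (T.boxV.id x))
  rw [T.boxV.src_id] at h
  exact (T.boxV.isId_id _).of_eq (h.right_cancel (isComp_of_isId_left (T.boxV.isId_id _)
    (T.boxV.tgt_id (top (hinv (T.boxV.id x))))))

theorem hinv_vinv (A : T.Box) : hinv (vinv A) = tinv A :=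
  (isComp_hinv (T.boxV.isComp_inv_right A)).eq_inv (isId_hinv (T.boxV.isId_id _))

/-- If `A = XY`, then `Yᵛ = X⁻¹Aᵛ`. -/
theorem isComp_tinv_left {X Y A : T.Box} (h : T.boxH.IsComp X Y A) :
    T.boxH.IsComp (tinv X) (vinv A) (vinv Y) := by
  rw [← hinv_vinv]
  exact (isComp_vinv h).inv_left

theorem isComp_tinv_right {X Y A : T.Box} (h : T.boxH.IsComp X Y A) :
    T.boxH.IsComp (vinv A) (tinv Y) (vinv X) := by
  rw [← hinv_vinv]
  exact (isComp_vinv h).inv_right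

theorem isComp_tinv {X Y A : T.Box} (h : T.boxH.IsComp X Y A) :
    T.boxH.IsComp (tinv Y) (tinv X) (tinv A) := by
  simp only [← hinv_vinv]
  exact (isComp_vinv h).inv

theorem tinv_tinv (A : T.Box) : tinv (tinv A) = A := by
  rw [tinv, hinv_vinv, tinv, hinv, T.boxH.inv_inv, vinv, T.boxV.inv_inv]

/-! ### Identity boxes attached to the sides of a box -/

theorem top_boxV_id (x : T.Hor) : top (T.boxV.id x) = x := T.boxV.src_id x

theorem bottom_boxV_id (x : T.Hor) : bottom (T.boxV.id x) = x := T.boxV.tgt_id x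

theorem isComp_id_left_of {x : T.Hor} {D : T.Box} (hD : T.ver.IsId (left D))
    (h : T.hor.tgt x = tl D) : ∃ K, T.boxH.IsComp (T.boxV.id x) D K :=
  exists_isComp (id_left_comp hD h)

theorem isComp_id_right_of {x : T.Hor} {E : T.Box} (hE : T.ver.IsId (right E))
    (h : br E = T.hor.src x) : ∃ K, T.boxH.IsComp E (T.boxV.id x) K :=
  exists_isComp (id_right_comp hE h)

theorem isComp_hor_id {x y z : T.Hor} (h : T.hor.IsComp x y z) :
    T.boxH.IsComp (T.boxV.id x) (T.boxV.id y) (T.boxV.id z) := by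
  obtain ⟨e, rfl⟩ := h
  have e' : right (T.boxV.id x) = left (T.boxV.id y) := by
    rw [right, left, T.right_id, T.left_id, e]
  exact ⟨e', T.hcomp_id x y e e'⟩

theorem eq_id_top {A : T.Box} (h : T.boxV.IsId A) : A = T.boxV.id (top A) := IsId.eq_src _ h

theorem eq_id_bottom {A : T.Box} (h : T.boxV.IsId A) : A = T.boxV.id (bottom A) := IsId.eq_tgt _ h

theorem bottom_id_left_of {x : T.Hor} {D K : T.Box} (hD : T.hor.IsId (bottom D))
    (h : T.boxH.IsComp (T.boxV.id x) D K) : bottom K = x := by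
  rw [(isComp_bottom h).eq_left hD]; exact T.boxV.tgt_id x

theorem top_id_right_of {x : T.Hor} {E K : T.Box} (hE : T.hor.IsId (top E))
    (h : T.boxH.IsComp E (T.boxV.id x) K) : top K = x := by
  rw [(isComp_top h).eq_right hE]; exact T.boxV.src_id x

/-! ### Rows whose composite is a vertical identity -/

/-- The boxes `U`, `V`, `W` form a row whose composite is a vertical identity. -/
def IsIdRow (U V W : T.Box) : Prop :=
  ∃ R e, T.boxH.IsComp V W R ∧ T.boxH.IsComp U R e ∧ T.boxV.IsId e

/-- The composite of the row `U`, `V` is a vertical identity. -/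
def IsIdPair (U V : T.Box) : Prop := ∃ e, T.boxH.IsComp U V e ∧ T.boxV.IsId e

theorem IsIdPair.eq_of_top_eq {U Y Y' : T.Box} (h : IsIdPair U Y) (h' : IsIdPair U Y')
    (ht : top Y = top Y') : Y = Y' := by
  obtain ⟨e, h, he⟩ := h
  obtain ⟨e', h', he'⟩ := h'
  have h₁ := isComp_top h
  rw [ht] at h₁
  have : e = e' := by
    rw [eq_id_top he, eq_id_top he', h₁.unique (isComp_top h')]
  subst this
  exact h.left_cancel h'

theorem IsIdPair.eq_of_bottom_eq {U U' Y : T.Box} (h : IsIdPair U Y) (h' : IsIdPair U' Y)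
    (hb : bottom U = bottom U') : U = U' := by
  obtain ⟨e, h, he⟩ := h
  obtain ⟨e', h', he'⟩ := h'
  have h₁ := isComp_bottom h
  rw [hb] at h₁
  have : e = e' := by
    rw [eq_id_bottom he, eq_id_bottom he', h₁.unique (isComp_bottom h')]
  subst this
  exact h.right_cancel h'

/-- If `UY` is a vertical identity and `V` is `Y` placed above `Z`, then `UV` is `Z` preceded by an
identity box. -/
theorem IsIdPair.isComp_of_isComp {U Y Z V : T.Box} (h : IsIdPair U Y)
    (hV : T.boxV.IsComp Y Z V) (hZ : T.ver.IsId (left Z)) :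
    ∃ N, T.boxH.IsComp U V N ∧ T.boxH.IsComp (T.boxV.id (bottom U)) Z N := by
  obtain ⟨e, h, he⟩ := h
  have ht : T.hor.tgt (bottom U) = tl Z :=
    (bottom_comp h.composable).trans (congrArg T.hor.src hV.composable)
  obtain ⟨N, hN⟩ := isComp_id_left_of hZ ht
  obtain ⟨Z', hZ, hZ'⟩ := isComp_interchange h hN (T.boxV.isComp_id_right U) hV
  rw [hZ.eq_right he] at hZ'
  exact ⟨N, hZ', hN⟩

/-- Rows `U`, `V`, `W` with composite a vertical identity correspond to pairs of rows `U`, `Y` and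
`Z`, `W` with the same property, where `V` is `Y` placed above `Z`. Applied to `T` and its three
symmetric forms, this gives all the axioms on the unit and the counit. -/
theorem isIdRow_iff {U V W : T.Box} : IsIdRow U V W ↔
    ∃ Y Z, IsIdPair U Y ∧ IsIdPair Z W ∧ T.boxV.IsComp Y Z V := by
  constructor
  · rintro ⟨R, e, hR, he, hid⟩
    obtain ⟨N, hN, hN'⟩ := hR.assoc' he
    -- `Y` is determined by `U Y = id (top N)`, and `Z` by `Y` above `Z` being `V`
    have hl : left U = left (T.boxV.id (top N)) := by
      have hU : T.ver.IsId (left U) := (isId_left hid).of_eq he.src.symm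
      rw [left_eq_of_isId hU, left, T.left_id]
      exact congrArg _ (isComp_top hN).src.symm
    obtain ⟨Y, hY⟩ := exists_isComp ((T.boxH.tgt_inv U).trans hl)
    have hUY := hY.inv_left
    rw [ArrowGroupoid.inv_inv] at hUY
    have ht : top Y = top V := by
      have h := isComp_top hUY
      rw [top_boxV_id] at h
      exact h.left_cancel (isComp_top hN)
    obtain ⟨Z, hZ⟩ := exists_isComp ((T.boxV.tgt_inv Y).trans ht)
    have hYZ := hZ.inv_left
    rw [ArrowGroupoid.inv_inv] at hYZ
    have hZid : T.ver.IsId (left Z) := by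
      have h := isComp_left hYZ
      rw [← show right U = left V from hN.composable, show right U = left Y from hUY.composable]
        at h
      exact h.isId_of_eq
    have hp : IsIdPair U Y := ⟨_, hUY, T.boxV.isId_id _⟩
    obtain ⟨N', h₁, h₂⟩ := hp.isComp_of_isComp hYZ hZid
    rw [← hN.unique h₁] at h₂
    obtain ⟨f, hf, hf'⟩ := h₂.assoc hN'
    exact ⟨Y, Z, hp, ⟨f, hf, isId_hcomp hf'.inv_left (isId_hinv (T.boxV.isId_id _)) hid⟩, hYZ⟩
  · rintro ⟨Y, Z, hY, ⟨f, hf, hfid⟩, hV⟩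
    have hZid : T.ver.IsId (left Z) := (isId_left hfid).of_eq hf.src.symm
    obtain ⟨N, hN, hN'⟩ := hY.isComp_of_isComp hV hZid
    obtain ⟨y, hy⟩ := exists_isComp (hN'.tgt.trans hf.composable)
    obtain ⟨f', hf', hy'⟩ := hN'.assoc hy
    obtain ⟨R, hR, hR'⟩ := hN.assoc hy
    rw [hf'.unique hf] at hy'
    exact ⟨R, y, hR, hR', isId_hcomp hy' (T.boxV.isId_id _) hfid⟩

/-- The decomposition in `isIdRow_iff` is unique: `Y` has the top side of `V`, and `Z` its bottom
side. -/
theorem IsIdPair.eq_and_eq {U V W Y Z Y' Z' : T.Box} (hY : IsIdPair U Y) (hZ : IsIdPair Z W)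
    (hV : T.boxV.IsComp Y Z V) (hY' : IsIdPair U Y') (hZ' : IsIdPair Z' W)
    (hV' : T.boxV.IsComp Y' Z' V) : Y = Y' ∧ Z = Z' :=
  ⟨hY.eq_of_top_eq hY' (hV.src.symm.trans hV'.src),
    hZ.eq_of_bottom_eq hZ' (hV.tgt.symm.trans hV'.tgt)⟩

/-! ### The boxes occurring in the source and target maps -/

theorem isComp_phi {A : T.Box} (h : T.hor.IsId (top A)) :
    T.boxV.IsComp (tinv A) (T.boxH.id (right A)) (phi A h).1 := ⟨_, rfl⟩

theorem isComp_psi {A : T.Box} (h : T.hor.IsId (bottom A)) :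
    T.boxV.IsComp (T.boxH.id (left A)) (tinv A) (psi A h).1 := ⟨_, rfl⟩

theorem hinv_id (g : T.Ver) : hinv (T.boxH.id g) = T.boxH.id g :=
  T.boxH.inv_id (T.boxH.isId_id g)

theorem hinv_tinv (A : T.Box) : hinv (tinv A) = vinv A := by
  rw [← hinv_vinv, hinv, T.boxH.inv_inv]

theorem isComp_hinv_phi {A : T.Box} (h : T.hor.IsId (top A)) :
    T.boxV.IsComp (vinv A) (T.boxH.id (right A)) (hinv (phi A h).1) := by
  have := isComp_hinv (isComp_phi h)
  rwa [hinv_id, hinv_tinv] at this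

theorem isComp_hinv_psi {A : T.Box} (h : T.hor.IsId (bottom A)) :
    T.boxV.IsComp (T.boxH.id (left A)) (vinv A) (hinv (psi A h).1) := by
  have := isComp_hinv (isComp_psi h)
  rwa [hinv_id, hinv_tinv] at this

/-- The composite of the column with `A` above `B` is a horizontal identity. -/
def IsIdColumn (A B : T.Box) : Prop := ∃ e, T.boxV.IsComp A B e ∧ T.boxH.IsId e

theorem IsIdColumn.isId_top {A Y : T.Box} (h : IsIdColumn A Y) : T.hor.IsId (top A) := by
  obtain ⟨e, h, he⟩ := h
  exact (DoubleGroupoid.isId_top he).of_eq h.src.symm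

theorem IsIdColumn.isId_bottom {A X : T.Box} (h : IsIdColumn X A) : T.hor.IsId (bottom A) := by
  obtain ⟨e, h, he⟩ := h
  exact (DoubleGroupoid.isId_bottom he).of_eq h.tgt.symm

/-- The boxes `X` that contribute to `ε_s(A)` are those of the form `id z` followed by `φ(A)`. -/
theorem isIdPair_isIdColumn_iff_phi {A X Y : T.Box} (hA : T.hor.IsId (top A)) :
    IsIdPair X Y ∧ IsIdColumn A Y ↔
      Y = hinv (phi A hA).1 ∧ ∃ z, T.boxH.IsComp (T.boxV.id z) (phi A hA).1 X := by
  constructor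
  · rintro ⟨⟨e, he, hid⟩, f, hf, fid⟩
    have hY : T.ver.IsId (right Y) := (isId_right hid).of_eq he.tgt.symm
    have hf' : f = T.boxH.id (right A) :=
      (IsId.eq_tgt _ fid).trans (congrArg _ ((isComp_right hf).eq_left hY))
    have hv := hf.inv_left
    rw [hf'] at hv
    have hYφ : Y = hinv (phi A hA).1 := hv.unique (isComp_hinv_phi hA)
    subst hYφ
    refine ⟨rfl, bottom e, ?_⟩
    have := he.inv_right
    rwa [hinv, T.boxH.inv_inv, eq_id_bottom hid] at this
  · rintro ⟨rfl, z, hz⟩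
    refine ⟨⟨_, hz.inv_right, T.boxV.isId_id _⟩, _, ?_, T.boxH.isId_id (right A)⟩
    have := (isComp_hinv_phi hA).inv_left
    rwa [vinv, T.boxV.inv_inv] at this

/-- The boxes `Y` that contribute to `ε_t(A)` are those of the form `ψ(A)` followed by `id x`. -/
theorem isIdPair_isIdColumn_iff_psi {A X Y : T.Box} (hA : T.hor.IsId (bottom A)) :
    IsIdPair X Y ∧ IsIdColumn X A ↔
      X = hinv (psi A hA).1 ∧ ∃ x, T.boxH.IsComp (psi A hA).1 (T.boxV.id x) Y := by
  constructor
  · rintro ⟨⟨e, he, hid⟩, f, hf, fid⟩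
    have hX : T.ver.IsId (left X) := (isId_left hid).of_eq he.src.symm
    have hf' : f = T.boxH.id (left A) :=
      (IsId.eq_src _ fid).trans (congrArg _ ((isComp_left hf).eq_right hX))
    have hv := hf.inv_right
    rw [hf'] at hv
    have hXψ : X = hinv (psi A hA).1 := hv.unique (isComp_hinv_psi hA)
    subst hXψ
    refine ⟨rfl, bottom e, ?_⟩
    have := he.inv_left
    rwa [hinv, T.boxH.inv_inv, eq_id_bottom hid] at this
  · rintro ⟨rfl, z, hz⟩
    refine ⟨⟨_, hz.inv_left, T.boxV.isId_id _⟩, _, ?_, T.boxH.isId_id (left A)⟩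
    have := (isComp_hinv_psi hA).inv_right
    rwa [vinv, T.boxV.inv_inv] at this

/-- The product `X Y⁻¹` occurring in `(id * S)(A)` is a summand of `1_{ψ(A)}`; it depends on the
factorization `A = XY` only through the top side of `X`. -/
theorem exists_isComp_psi {X Y A : T.Box} (h : T.boxH.IsComp X Y A) (hA : T.hor.IsId (bottom A)) :
    ∃ K, T.boxV.IsComp X (tinv Y) K ∧ T.boxH.IsComp (psi A hA).1 (T.boxV.id (top X)) K := by
  have hc : bottom X = top (tinv Y) := by
    rw [top_tinv, (isComp_bottom h).eq_inv hA, ArrowGroupoid.inv_inv]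
  obtain ⟨K, hK⟩ := exists_isComp hc
  have hX : T.boxH.IsComp (T.boxH.id (left A)) X X := by
    rw [left, h.src]; exact T.boxH.isComp_id_left X
  have := isComp_columns hX (isComp_tinv_right h) (isComp_hinv_psi hA) hK (T.boxV.isComp_inv_right X)
  refine ⟨K, hK, ?_⟩
  have := this.inv_left
  rwa [hinv, T.boxH.inv_inv] at this

theorem isId_bottom_of_composable {X Y A : T.Box} (h : T.boxH.IsComp X Y A)
    (hc : bottom X = top (tinv Y)) : T.hor.IsId (bottom A) := by
  rw [top_tinv] at hc
  have := isComp_bottom h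
  rw [hc] at this
  exact (T.hor.isId_id _).of_eq (this.unique (T.hor.isComp_inv_left _))

/-- The product `X⁻¹ Y` occurring in `(S * id)(A)` is a summand of `_{φ(A)}1`; it depends on the
factorization `A = XY` only through the bottom side of `Y`. -/
theorem exists_isComp_phi {X Y A : T.Box} (h : T.boxH.IsComp X Y A) (hA : T.hor.IsId (top A)) :
    ∃ K, T.boxV.IsComp (tinv X) Y K ∧
      T.boxH.IsComp (T.boxV.id (bottom Y)) (phi A hA).1 K := by
  have hc : bottom (tinv X) = top Y := by
    rw [bottom_tinv, (isComp_top h).eq_inv hA]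
  obtain ⟨K, hK⟩ := exists_isComp hc
  have hY : T.boxH.IsComp Y (T.boxH.id (right A)) Y := by
    rw [right, h.tgt]; exact T.boxH.isComp_id_right Y
  have := isComp_columns (isComp_tinv_left h) hY hK (isComp_hinv_phi hA) (T.boxV.isComp_inv_left Y)
  refine ⟨K, hK, ?_⟩
  have := this.inv_right
  rwa [hinv, T.boxH.inv_inv] at this

theorem isId_top_of_composable {X Y A : T.Box} (h : T.boxH.IsComp X Y A)
    (hc : bottom (tinv X) = top Y) : T.hor.IsId (top A) := by
  rw [bottom_tinv] at hc
  have := isComp_top h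
  rw [← hc] at this
  exact (T.hor.isId_id _).of_eq (this.unique (T.hor.isComp_inv_right _))

/-- The product of `X⁻¹` with a summand of `1_{ψ(Y)}` is `(XY)⁻¹`. -/
theorem tinv_eq_of_isComp_psi {X Y A K L : T.Box} {x : T.Hor} (h : T.boxH.IsComp X Y A)
    (hY : T.hor.IsId (bottom Y)) (hK : T.boxH.IsComp (psi Y hY).1 (T.boxV.id x) K)
    (hL : T.boxV.IsComp (tinv X) K L) : L = tinv A := by
  have hX : T.boxH.IsComp (vinv (T.boxH.id (left Y))) (tinv X) (tinv X) := by
    refine isComp_of_isId_left ?_ ?_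
    · exact isId_hinv (T := T.transpose) (T.boxH.isId_id _)
    · show right _ = left _
      rw [right_vinv, left_tinv, right, T.boxH.tgt_id]
      exact congrArg _ h.composable.symm
  have hx : bottom (tinv X) = x := hL.composable.trans (top_id_right_of (psi Y hY).2.2 hK)
  have hX' : T.boxV.IsComp (tinv X) (T.boxV.id x) (tinv X) := by
    rw [← hx]; exact T.boxV.isComp_id_right _
  exact (isComp_columns hX hK (isComp_psi hY).inv_left hX' hL).unique (isComp_tinv h)

theorem exists_isComp_psi_tinv {X Y A : T.Box} (h : T.boxH.IsComp X Y A)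
    (hY : T.hor.IsId (bottom Y)) :
    ∃ K x, T.boxH.IsComp (psi Y hY).1 (T.boxV.id x) K ∧ T.boxV.IsComp (tinv X) K (tinv A) := by
  have hx : br (psi Y hY).1 = T.hor.src (bottom (tinv X)) := by
    have h₁ : bottom (psi Y hY).1 = bottom (tinv Y) := (isComp_psi hY).tgt
    rw [br, h₁, bottom_tinv, bottom_tinv, T.hor.tgt_inv, T.hor.src_inv]
    exact (top_comp h.composable).symm
  obtain ⟨K, hK⟩ := isComp_id_right_of (psi Y hY).2.1 hx
  obtain ⟨L, hL⟩ := exists_isComp (top_id_right_of (psi Y hY).2.2 hK).symm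
  refine ⟨K, _, hK, ?_⟩
  rwa [← tinv_eq_of_isComp_psi h hY hK hL]

/-! ### Products of rows in the core groupoids -/

/-- `B = (id z) D` for some identity box `id z`. -/
def IsLeftExt (D B : T.Box) : Prop := ∃ z, T.boxH.IsComp (T.boxV.id z) D B

/-- `B = E (id x)` for some identity box `id x`. -/
def IsRightExt (E B : T.Box) : Prop := ∃ x, T.boxH.IsComp E (T.boxV.id x) B

theorem IsLeftExt.isComp {D : T.CoreD} {B : T.Box} (h : IsLeftExt D.1 B) :
    T.boxH.IsComp (T.boxV.id (bottom B)) D.1 B := by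
  obtain ⟨z, hz⟩ := h
  rwa [bottom_id_left_of D.2.2 hz]

theorem IsRightExt.isComp {E : T.CoreE} {B : T.Box} (h : IsRightExt E.1 B) :
    T.boxH.IsComp E.1 (T.boxV.id (top B)) B := by
  obtain ⟨z, hz⟩ := h
  rwa [top_id_right_of E.2.2 hz]

theorem IsLeftExt.top_eq {D : T.CoreD} {B : T.Box} (h : IsLeftExt D.1 B) :
    T.hor.IsComp (bottom B) (top D.1) (top B) := by
  have := isComp_top h.isComp
  rwa [top_boxV_id] at this

theorem IsRightExt.bottom_eq {E : T.CoreE} {B : T.Box} (h : IsRightExt E.1 B) :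
    T.hor.IsComp (bottom E.1) (top B) (bottom B) := by
  have := isComp_bottom h.isComp
  rwa [bottom_boxV_id] at this

/-- A summand of `_D1` above a summand of `_L1` gives a summand of `_{D ⋄ L}1`. -/
theorem IsLeftExt.comp {D L : T.CoreD} (e : tl D.1 = tr L.1) {B C K : T.Box}
    (hB : IsLeftExt D.1 B) (hC : IsLeftExt L.1 C) (hK : T.boxV.IsComp B C K) :
    IsLeftExt (D.comp L e).1 K := by
  obtain ⟨D', hD'⟩ := isComp_id_left_of D.2.1 e.symm
  have hN : T.boxV.IsComp D' L.1 (D.comp L e).1 := by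
    obtain ⟨_, rfl⟩ := hD'; exact ⟨_, rfl⟩
  -- composability forces `B = (id w) (id t(L)) D`, where `C = (id w) L`
  have hb : bottom B = top C := hK.composable
  have hB' := hB.isComp
  rw [hb] at hB'
  obtain ⟨D'', h₁, h₂⟩ := (isComp_hor_id hC.top_eq).assoc hB'
  rw [h₁.unique hD'] at h₂
  refine ⟨bottom C, isComp_columns h₂ hC.isComp ?_ hN hK⟩
  exact isComp_of_isId_left (T.boxV.isId_id _) ((T.boxV.tgt_id _).trans (T.boxV.src_id _).symm)

theorem IsLeftExt.exists_of_comp {D L : T.CoreD} (e : tl D.1 = tr L.1) {K : T.Box}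
    (hK : IsLeftExt (D.comp L e).1 K) :
    ∃ B C, IsLeftExt D.1 B ∧ IsLeftExt L.1 C ∧ T.boxV.IsComp B C K := by
  obtain ⟨D', hD'⟩ := isComp_id_left_of D.2.1 e.symm
  have hN : T.boxV.IsComp D' L.1 (D.comp L e).1 := by
    obtain ⟨_, rfl⟩ := hD'; exact ⟨_, rfl⟩
  have hw : T.hor.tgt (bottom K) = T.hor.src (top L.1) := by
    have h := top_comp hK.isComp.composable
    rwa [top_boxV_id, D.top_comp L e, T.hor.src_comp] at h
  obtain ⟨z, hz⟩ := exists_isComp hw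
  obtain ⟨C, hC⟩ := isComp_id_left_of L.2.1 hw
  obtain ⟨B, hB⟩ := isComp_id_left_of D.2.1 (hz.tgt.trans e.symm)
  obtain ⟨D'', h₁, h₂⟩ := (isComp_hor_id hz).assoc hB
  rw [h₁.unique hD'] at h₂
  refine ⟨B, C, ⟨_, hB⟩, ⟨_, hC⟩, isComp_rows h₂ hC ?_ hN hK.isComp⟩
  exact isComp_of_isId_left (T.boxV.isId_id _) ((T.boxV.tgt_id _).trans (T.boxV.src_id _).symm)

theorem IsLeftExt.eq_of_bottom_eq {D : T.CoreD} {B B' : T.Box} (h : IsLeftExt D.1 B)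
    (h' : IsLeftExt D.1 B') (e : bottom B = bottom B') : B = B' := by
  have h₁ := h.isComp
  rw [e] at h₁
  exact h₁.unique h'.isComp

theorem IsRightExt.eq_of_top_eq {E : T.CoreE} {B B' : T.Box} (h : IsRightExt E.1 B)
    (h' : IsRightExt E.1 B') (e : top B = top B') : B = B' := by
  have h₁ := h.isComp
  rw [e] at h₁
  exact h₁.unique h'.isComp

theorem IsLeftExt.composable {D L : T.CoreD} {B C K : T.Box}
    (hB : IsLeftExt D.1 B) (hC : IsLeftExt L.1 C) (hK : T.boxV.IsComp B C K) :
    tl D.1 = tr L.1 := by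
  have h := hB.top_eq.composable
  rw [show bottom B = top C from hK.composable, hC.top_eq.tgt] at h
  exact h.symm

/-- A summand of `1_E` above a summand of `1_M` gives a summand of `1_{M ∘ E}`. -/
theorem IsRightExt.comp {E M : T.CoreE} (e : br M.1 = bl E.1) {B C K : T.Box}
    (hB : IsRightExt E.1 B) (hC : IsRightExt M.1 C) (hK : T.boxV.IsComp B C K) :
    IsRightExt (M.comp E e).1 K := by
  obtain ⟨M', hM'⟩ := isComp_id_right_of M.2.1 e
  have hN : T.boxV.IsComp E.1 M' (M.comp E e).1 := by
    obtain ⟨_, rfl⟩ := hM'; exact ⟨_, rfl⟩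
  -- composability forces `C = M (id b(E)) (id x)`, where `B = E (id x)`
  have hb : bottom B = top C := hK.composable
  have hC' := hC.isComp
  rw [← hb] at hC'
  obtain ⟨M'', h₁, h₂⟩ := (isComp_hor_id hB.bottom_eq).assoc' hC'
  rw [h₁.unique hM'] at h₂
  refine ⟨top B, isComp_columns hB.isComp h₂ hN ?_ hK⟩
  exact isComp_of_isId_left (T.boxV.isId_id _) ((T.boxV.tgt_id _).trans (T.boxV.src_id _).symm)

theorem IsRightExt.exists_of_comp {E M : T.CoreE} (e : br M.1 = bl E.1) {K : T.Box}
    (hK : IsRightExt (M.comp E e).1 K) :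
    ∃ B C, IsRightExt E.1 B ∧ IsRightExt M.1 C ∧ T.boxV.IsComp B C K := by
  obtain ⟨M', hM'⟩ := isComp_id_right_of M.2.1 e
  have hN : T.boxV.IsComp E.1 M' (M.comp E e).1 := by
    obtain ⟨_, rfl⟩ := hM'; exact ⟨_, rfl⟩
  have hw : T.hor.tgt (bottom E.1) = T.hor.src (top K) := by
    have h := bottom_comp hK.isComp.composable
    rwa [bottom_boxV_id, M.bottom_comp E e, T.hor.tgt_comp] at h
  obtain ⟨z, hz⟩ := exists_isComp hw
  obtain ⟨B, hB⟩ := isComp_id_right_of E.2.1 hw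
  obtain ⟨C, hC⟩ := isComp_id_right_of M.2.1 (e.trans hz.src.symm)
  obtain ⟨M'', h₁, h₂⟩ := (isComp_hor_id hz).assoc' hC
  rw [h₁.unique hM'] at h₂
  refine ⟨B, C, ⟨_, hB⟩, ⟨_, hC⟩, isComp_rows hB h₂ hN ?_ hK.isComp⟩
  exact isComp_of_isId_left (T.boxV.isId_id _) ((T.boxV.tgt_id _).trans (T.boxV.src_id _).symm)

theorem IsRightExt.composable {E M : T.CoreE} {B C K : T.Box}
    (hB : IsRightExt E.1 B) (hC : IsRightExt M.1 C) (hK : T.boxV.IsComp B C K) :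
    br M.1 = bl E.1 := by
  have h := hC.bottom_eq.composable
  rw [← show bottom B = top C from hK.composable, hB.bottom_eq.src] at h
  exact h

/-- An extension `(id z) D` that lies in the core groupoid is `D` itself. -/
theorem IsLeftExt.eq_of_isId {D : T.CoreD} {B : T.Box} (h : IsLeftExt D.1 B)
    (hB : T.hor.IsId (bottom B)) : B = D.1 := by
  refine h.isComp.eq_right ?_
  obtain ⟨p, hp⟩ := hB
  rw [← hp, T.id_id]
  exact T.boxH.isId_id _

theorem IsRightExt.eq_of_isId {E : T.CoreE} {B : T.Box} (h : IsRightExt E.1 B)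
    (hB : T.hor.IsId (top B)) : B = E.1 := by
  refine h.isComp.eq_left ?_
  obtain ⟨p, hp⟩ := hB
  rw [← hp, T.id_id]
  exact T.boxH.isId_id _

theorem isLeftExt_self (D : T.CoreD) : IsLeftExt D.1 D.1 := by
  refine ⟨T.hor.id (tl D.1), isComp_of_isId_left ?_ ?_⟩
  · rw [T.id_id]; exact T.boxH.isId_id _
  · exact id_left_comp D.2.1 (T.hor.tgt_id _)

theorem isRightExt_self (E : T.CoreE) : IsRightExt E.1 E.1 := by
  refine ⟨T.hor.id (br E.1), isComp_of_isId_right ?_ ?_⟩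
  · rw [T.id_id]; exact T.boxH.isId_id _
  · exact id_right_comp E.2.1 (T.hor.src_id _).symm

/-- The extensions of the identities `Θ_P` are the identity boxes `id z` with `r(z) = P`. -/
theorem isLeftExt_id_iff {p : T.Pt} {B : T.Box} :
    IsLeftExt (CoreD.id (T := T) p).1 B ↔ ∃ z, T.hor.tgt z = p ∧ B = T.boxV.id z := by
  have hid : T.boxH.IsId (CoreD.id (T := T) p).1 := by
    simp only [CoreD.id, T.id_id]; exact T.boxH.isId_id _
  constructor
  · rintro ⟨z, hz⟩
    refine ⟨z, ?_, hz.eq_left hid⟩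
    have h := top_comp hz.composable
    simpa [CoreD.id, T.boxV.src_id, T.hor.src_id] using h
  · rintro ⟨z, rfl, rfl⟩
    refine ⟨z, isComp_of_isId_right hid ?_⟩
    exact id_left_comp (CoreD.id _).2.1 (by simp [CoreD.id, tl, top, T.boxV.src_id, T.hor.src_id])

theorem isRightExt_id_iff {p : T.Pt} {B : T.Box} :
    IsRightExt (CoreE.id (T := T) p).1 B ↔ ∃ z, T.hor.src z = p ∧ B = T.boxV.id z := by
  have hid : T.boxH.IsId (CoreE.id (T := T) p).1 := by
    simp only [CoreE.id, T.id_id]; exact T.boxH.isId_id _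
  constructor
  · rintro ⟨z, hz⟩
    refine ⟨z, ?_, hz.eq_right hid⟩
    have h := bottom_comp hz.composable
    simpa [CoreE.id, T.boxV.tgt_id, T.hor.tgt_id] using h.symm
  · rintro ⟨z, rfl, rfl⟩
    refine ⟨z, isComp_of_isId_left hid ?_⟩
    exact id_right_comp (CoreE.id _).2.1
      (by simp [CoreE.id, br, bottom, T.boxV.tgt_id, T.hor.tgt_id])

/-- `φ` is onto the core groupoid `𝐃`: `D = φ(D⁻¹)`. -/
theorem CoreD.exists_phi_eq (D : T.CoreD) : ∃ A, ∃ h : T.hor.IsId (top A), phi A h = D := by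
  have h : T.hor.IsId (top (tinv D.1)) := by
    rw [top_tinv, T.hor.inv_id D.2.2]; exact D.2.2
  refine ⟨tinv D.1, h, Subtype.ext ?_⟩
  have h₁ := isComp_phi h
  rw [tinv_tinv] at h₁
  refine h₁.eq_left ?_
  rw [right_tinv, T.ver.inv_id D.2.1]
  obtain ⟨p, hp⟩ := D.2.1
  rw [← hp, ← T.id_id]
  exact T.boxV.isId_id _

/-- `ψ` is onto the core groupoid `𝐄`: `E = ψ(E⁻¹)`. -/
theorem CoreE.exists_psi_eq (E : T.CoreE) :
    ∃ A, ∃ h : T.hor.IsId (bottom A), psi A h = E := by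
  have h : T.hor.IsId (bottom (tinv E.1)) := by
    rw [bottom_tinv, T.hor.inv_id E.2.2]; exact E.2.2
  refine ⟨tinv E.1, h, Subtype.ext ?_⟩
  have h₁ := isComp_psi h
  rw [tinv_tinv] at h₁
  refine h₁.eq_right ?_
  rw [left_tinv, T.ver.inv_id E.2.1]
  obtain ⟨p, hp⟩ := E.2.1
  rw [← hp, ← T.id_id]
  exact T.boxV.isId_id _

end DoubleGroupoid

/-! ### The structure maps on boxes -/

namespace DoubleGroupoid.Deformed

open Coalgebra ArrowGroupoid

variable {k : Type v} [Field k] {T : DoubleGroupoid.{u}} (ϑ : T.Pt → kˣ)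

/-- The linear form giving the coefficient of the box `C`. -/
noncomputable def coeff (C : T.Box) : T.Deformed k ϑ →ₗ[k] k :=
  open Classical in lift ϑ fun A => if A = C then 1 else 0

open Classical in
theorem coeff_box (C A : T.Box) : coeff ϑ C (box ϑ A) = if A = C then 1 else 0 := lift_box ϑ _ A

theorem daleth_eq_of_isComp {A B C : T.Box} (h : T.boxV.IsComp A B C) :
    daleth ϑ C = daleth ϑ B := congrArg (fun x => (ϑ (T.hor.src x) : k)) h.tgt

theorem daleth_right_of_isIdColumn {A X Y B : T.Box} (h : T.boxH.IsComp X Y B)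
    (hX : IsIdColumn A X) : daleth ϑ Y = daleth ϑ X := by
  have h₁ := bottom_comp h.composable
  rw [← IsId.src_eq_tgt _ hX.isId_bottom] at h₁
  simp only [daleth, bl, h₁]

theorem daleth_tinv (A : T.Box) : daleth ϑ (tinv A) = (ϑ (tr A) : k) := by
  rw [daleth, bl, bottom_tinv, T.hor.src_inv]

theorem daleth_hinv (A : T.Box) : daleth ϑ (hinv A) = (ϑ (br A) : k) := by
  rw [daleth, bl, bottom_hinv, T.hor.src_inv]

section

variable [Finite T.Box]

theorem box_mul_box_of_isComp {A B C : T.Box} (h : T.boxV.IsComp A B C) :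
    box ϑ A * box ϑ B = box ϑ C :=
  GroupoidAlgebra.of_mul_of_isComp k h

theorem box_mul_box_of_ne {A B : T.Box} (h : ¬ bottom A = top B) : box ϑ A * box ϑ B = 0 :=
  GroupoidAlgebra.of_mul_of_eq_zero k h

end

open Classical in
/-- The condition that `∑ ℸ(V) = 1`, the sum over the boxes `V` with given top side `x` and right
side `g`. -/
def IsNormalized [Fintype T.Box] : Prop := ∀ (g : T.Ver) (x : T.Hor), T.ver.src g = T.hor.tgt x →
  ∑ W ∈ Finset.univ.filter (fun W : T.Box => top W = x ∧ right W = g), daleth ϑ W = 1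

open Classical in
theorem isNormalized_iff [Fintype T.Box] : IsNormalized ϑ ↔
    ∀ (g : T.Ver) (x : T.Hor), T.ver.src g = T.hor.tgt x →
      ∑ᶠ W : {W : T.Box // top W = x ∧ right W = g}, daleth ϑ W.1 = 1 := by
  have key : ∀ (g : T.Ver) (x : T.Hor),
      ∑ W ∈ Finset.univ.filter (fun W : T.Box => top W = x ∧ right W = g), daleth ϑ W =
      ∑ᶠ W : {W : T.Box // top W = x ∧ right W = g}, daleth ϑ W.1 := fun g x => by
    rw [finsum_eq_sum_of_fintype]
    exact Finset.sum_subtype _ (fun W => by simp) (fun W : T.Box => daleth ϑ W)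
  simp only [IsNormalized, key]

section

open scoped Classical

variable [Fintype T.Box]

theorem box_mul_box (A B : T.Box) :
    box ϑ A * box ϑ B = ∑ C ∈ Finset.univ.filter (fun C => T.boxV.IsComp A B C), box ϑ C := by
  by_cases h : bottom A = top B
  · obtain ⟨C, hC⟩ := exists_isComp h
    rw [Finset.sum_eq_single_of_mem C (by simpa using hC), box_mul_box_of_isComp ϑ hC]
    intro C' hC' hne
    exact absurd ((Finset.mem_filter.mp hC').2.unique hC) hne
  · rw [box_mul_box_of_ne ϑ h, Finset.sum_eq_zero]
    intro C hC
    exact absurd (Finset.mem_filter.mp hC).2.composable h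

/-- Sums of boxes multiply as sets of arrows do, if every product is attained once. -/
theorem sum_box_mul_sum_box {p q r : T.Box → Prop}
    (hr : ∀ {B C K}, p B → q C → T.boxV.IsComp B C K → r K)
    (hinj : ∀ {B C B' C' K}, p B → q C → T.boxV.IsComp B C K → p B' → q C' →
      T.boxV.IsComp B' C' K → B = B' ∧ C = C')
    (hsurj : ∀ {K}, r K → ∃ B C, p B ∧ q C ∧ T.boxV.IsComp B C K) :
    (∑ B ∈ Finset.univ.filter p, box ϑ B) * (∑ C ∈ Finset.univ.filter q, box ϑ C) =
      ∑ K ∈ Finset.univ.filter r, box ϑ K := by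
  simp only [Finset.sum_mul_sum, box_mul_box]
  simp only [Finset.sum_sigma']
  refine Finset.sum_nbij (fun x => x.2.2) ?_ ?_ ?_ fun _ _ => rfl
  · rintro ⟨B, C, K⟩ h
    simp only [Finset.mem_sigma, Finset.mem_filter, Finset.mem_univ, true_and] at h ⊢
    exact hr h.1 h.2.1 h.2.2
  · rintro ⟨B, C, K⟩ h ⟨B', C', K'⟩ h' e
    simp only [Finset.coe_sigma, Set.mem_sigma_iff, Finset.mem_coe,
      Finset.mem_filter, Finset.mem_univ, true_and] at h h' e
    subst e
    obtain ⟨rfl, rfl⟩ := hinj h.1 h.2.1 h.2.2 h'.1 h'.2.1 h'.2.2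
    rfl
  · intro K hK
    obtain ⟨B, C, hB, hC, h⟩ := hsurj (Finset.mem_filter.mp hK).2
    exact ⟨⟨B, C, K⟩, by simpa using ⟨hB, hC, h⟩, rfl⟩

theorem one_eq : (1 : T.Deformed k ϑ) = ∑ C ∈ Finset.univ.filter (fun C => T.boxV.IsId C),
    box ϑ C := by
  cases nonempty_fintype T.Hor
  have h : (1 : T.Deformed k ϑ) = ∑ x : T.Hor, box ϑ (T.boxV.id x) :=
    (GroupoidAlgebra.one_def k T.boxV).trans (finsum_eq_sum_of_fintype _)
  rw [h]
  refine Finset.sum_nbij T.boxV.id ?_ ?_ ?_ fun _ _ => rfl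
  · intro x _
    simpa using T.boxV.isId_id x
  · intro x _ y _ e
    rw [← top_boxV_id x, e, top_boxV_id]
  · intro C hC
    exact ⟨top C, by simp, (eq_id_top (by simpa using hC)).symm⟩

theorem comul_box (A : T.Box) : comul (R := k) (box ϑ A) =
    ∑ q ∈ Finset.univ.filter (fun q : T.Box × T.Box => T.boxH.IsComp q.1 q.2 A),
      daleth ϑ q.2 • (box ϑ q.1 ⊗ₜ[k] box ϑ q.2) :=
  (lift_box ϑ _ A).trans (comulBox_eq ϑ A)

theorem counit_box (A : T.Box) : counit (R := k) (box ϑ A) =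
    if T.boxH.IsId A then (daleth ϑ A)⁻¹ else 0 := lift_box ϑ _ A

theorem comul_one : comul (R := k) (1 : T.Deformed k ϑ) =
    ∑ q ∈ Finset.univ.filter (fun q : T.Box × T.Box => IsIdPair q.1 q.2),
      daleth ϑ q.2 • (box ϑ q.1 ⊗ₜ[k] box ϑ q.2) := by
  simp only [one_eq, map_sum, comul_box]
  simp only [Finset.sum_sigma']
  refine Finset.sum_nbij (fun x => x.2) ?_ ?_ ?_ fun _ _ => rfl
  · rintro ⟨C, q⟩ h
    simp only [Finset.mem_sigma, Finset.mem_filter, Finset.mem_univ, true_and] at h ⊢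
    exact ⟨C, h.2, h.1⟩
  · rintro ⟨C, q⟩ h ⟨C', q'⟩ h' e
    simp only [Finset.coe_sigma, Set.mem_sigma_iff, Finset.mem_coe,
      Finset.mem_filter, Finset.mem_univ, true_and] at h h' e
    subst e
    obtain rfl := h.2.unique h'.2
    rfl
  · rintro q hq
    obtain ⟨C, hC, hid⟩ := (Finset.mem_filter.mp hq).2
    exact ⟨⟨C, q⟩, by simpa using ⟨hid, hC⟩, rfl⟩

theorem counit_box_mul_box (A B : T.Box) : counit (R := k) (box ϑ A * box ϑ B) =
    if IsIdColumn A B then (daleth ϑ B)⁻¹ else 0 := by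
  by_cases h : bottom A = top B
  · obtain ⟨C, hC⟩ := exists_isComp h
    have : IsIdColumn A B ↔ T.boxH.IsId C :=
      ⟨fun ⟨e, he, hid⟩ => he.unique hC ▸ hid, fun hid => ⟨C, hC, hid⟩⟩
    rw [box_mul_box_of_isComp ϑ hC, counit_box, daleth_eq_of_isComp ϑ hC]
    simp only [this]
  · have : ¬ IsIdColumn A B := fun ⟨e, he, _⟩ => h he.composable
    rw [box_mul_box_of_ne ϑ h, map_zero, if_neg this]

/-! ### Weighted sums over the factorizations of a box -/

/-- The second factors of the factorizations `A = XY` with `t(X) = x` are the boxes with right side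
`r(A)` and top side `x⁻¹ t(A)`. -/
theorem sum_daleth_right {A : T.Box} {x y : T.Hor} (h : T.hor.IsComp x y (top A)) :
    ∑ q ∈ Finset.univ.filter (fun q : T.Box × T.Box => T.boxH.IsComp q.1 q.2 A ∧ top q.1 = x),
      daleth ϑ q.2 =
    ∑ W ∈ Finset.univ.filter (fun W : T.Box => top W = y ∧ right W = right A), daleth ϑ W := by
  refine Finset.sum_nbij Prod.snd ?_ ?_ ?_ fun _ _ => rfl
  · rintro ⟨X, Y⟩ hq
    simp only [Finset.mem_filter, Finset.mem_univ, true_and] at hq ⊢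
    obtain ⟨hq, rfl⟩ := hq
    exact ⟨(isComp_top hq).left_cancel h, hq.tgt.symm⟩
  · rintro ⟨X, Y⟩ hq ⟨X', Y'⟩ hq' e
    simp only [Finset.coe_filter, Finset.mem_univ, true_and, Set.mem_ofPred_eq] at hq hq' e
    subst e
    rw [hq.1.right_cancel hq'.1]
  · intro W hW
    simp only [Finset.coe_filter, Finset.mem_univ, true_and, Set.mem_ofPred_eq] at hW
    obtain ⟨X, hX⟩ := exists_isComp (hW.2.symm.trans (T.boxH.src_inv W).symm)
    have hX' := hX.inv_right
    rw [ArrowGroupoid.inv_inv] at hX'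
    have ht := isComp_top hX'
    rw [hW.1] at ht
    exact ⟨(X, W), by simpa using ⟨hX', ht.right_cancel h⟩, rfl⟩

/-- The inverses of the first factors of the factorizations `A = XY` with `b(Y) = z` are the boxes
with right side `l(A)⁻¹` and top side `z b(A)⁻¹`, and `ϑ(tr(X)) = ℸ(X⁻¹)`. -/
theorem sum_tr_left {A : T.Box} {y z : T.Hor} (h : T.hor.IsComp y z (bottom A)) :
    ∑ q ∈ Finset.univ.filter (fun q : T.Box × T.Box => T.boxH.IsComp q.1 q.2 A ∧ bottom q.2 = z),
      (ϑ (tr q.1) : k) =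
    ∑ W ∈ Finset.univ.filter (fun W : T.Box => top W = T.hor.inv y ∧
      right W = T.ver.inv (left A)), daleth ϑ W := by
  refine Finset.sum_nbij (fun q => tinv q.1) ?_ ?_ ?_ fun q _ => (daleth_tinv ϑ q.1).symm
  · rintro ⟨X, Y⟩ hq
    simp only [Finset.mem_filter, Finset.mem_univ, true_and] at hq ⊢
    obtain ⟨hq, rfl⟩ := hq
    exact ⟨(top_tinv X).trans (congrArg _ ((isComp_bottom hq).right_cancel h)),
      (right_tinv X).trans (congrArg _ hq.src.symm)⟩
  · rintro ⟨X, Y⟩ hq ⟨X', Y'⟩ hq' e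
    simp only [Finset.coe_filter, Finset.mem_univ, true_and, Set.mem_ofPred_eq] at hq hq' e
    obtain rfl : X = X' := by rw [← tinv_tinv X, e, tinv_tinv]
    rw [hq.1.left_cancel hq'.1]
  · intro W hW
    simp only [Finset.coe_filter, Finset.mem_univ, true_and, Set.mem_ofPred_eq] at hW
    have hl : left (tinv W) = left A := by
      rw [left_tinv, hW.2, ArrowGroupoid.inv_inv]
    obtain ⟨Y, hY⟩ := exists_isComp ((T.boxH.tgt_inv _).trans hl)
    have hY' := hY.inv_left
    rw [ArrowGroupoid.inv_inv] at hY'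
    have hb := isComp_bottom hY'
    rw [bottom_tinv, hW.1, ArrowGroupoid.inv_inv] at hb
    exact ⟨(tinv W, Y), by simpa using ⟨hY', hb.left_cancel h⟩, tinv_tinv W⟩

variable {ϑ}

/-- For a function of the top side of the first factor, the weights `ℸ(Y)` of the factorizations
`A = XY` add up to one over each horizontal arrow that starts at `tl(A)`. -/
theorem IsNormalized.sum_smul_top (hϑ : IsNormalized ϑ) [Fintype T.Hor] {M : Type*}
    [AddCommGroup M] [Module k M] (A : T.Box) (F : T.Hor → M) :
    ∑ q ∈ Finset.univ.filter (fun q : T.Box × T.Box => T.boxH.IsComp q.1 q.2 A),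
      daleth ϑ q.2 • F (top q.1) =
    ∑ x ∈ Finset.univ.filter (fun x => T.hor.src x = tl A), F x := by
  rw [← Finset.sum_fiberwise_of_maps_to (g := fun q => top q.1)
    (t := Finset.univ.filter fun x => T.hor.src x = tl A)]
  · refine Finset.sum_congr rfl fun x hx => ?_
    obtain ⟨y, hy⟩ := exists_isComp ((T.hor.tgt_inv x).trans (Finset.mem_filter.mp hx).2)
    have hy' := hy.inv_left
    rw [ArrowGroupoid.inv_inv] at hy'
    have h1 := sum_daleth_right ϑ hy'
    rw [hϑ _ _ ((T.tr_eq A).symm.trans hy'.tgt), ← Finset.filter_filter] at h1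
    rw [← one_smul k (F x), ← h1, Finset.sum_smul]
    refine Finset.sum_congr rfl fun q hq => ?_
    rw [(Finset.mem_filter.mp hq).2]
  · intro q hq
    simp only [Finset.mem_filter, Finset.mem_univ, true_and] at hq ⊢
    exact (isComp_top hq).src.symm

/-- For a function of the bottom side of the second factor, the weights `ϑ(tr(X))` of the
factorizations `A = XY` add up to one over each horizontal arrow that ends at `br(A)`. -/
theorem IsNormalized.sum_smul_bottom (hϑ : IsNormalized ϑ) [Fintype T.Hor] {M : Type*}
    [AddCommGroup M] [Module k M] (A : T.Box) (F : T.Hor → M) :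
    ∑ q ∈ Finset.univ.filter (fun q : T.Box × T.Box => T.boxH.IsComp q.1 q.2 A),
      (ϑ (tr q.1) : k) • F (bottom q.2) =
    ∑ x ∈ Finset.univ.filter (fun x => T.hor.tgt x = br A), F x := by
  rw [← Finset.sum_fiberwise_of_maps_to (g := fun q => bottom q.2)
    (t := Finset.univ.filter fun x => T.hor.tgt x = br A)]
  · refine Finset.sum_congr rfl fun x hx => ?_
    obtain ⟨y, hy⟩ := exists_isComp ((Finset.mem_filter.mp hx).2.symm.trans (T.hor.src_inv x).symm)
    have hy' := hy.inv_right
    rw [ArrowGroupoid.inv_inv] at hy'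
    have h1 := sum_tr_left ϑ hy'
    rw [hϑ, ← Finset.filter_filter] at h1
    · rw [← one_smul k (F x), ← h1, Finset.sum_smul]
      refine Finset.sum_congr rfl fun q hq => ?_
      rw [(Finset.mem_filter.mp hq).2]
    · rw [T.ver.src_inv, T.hor.tgt_inv, ← T.bl_eq]
      exact hy'.src
  · intro q hq
    simp only [Finset.mem_filter, Finset.mem_univ, true_and] at hq ⊢
    exact (isComp_bottom hq).tgt.symm

end

end DoubleGroupoid.Deformed

/-! ### Products of `Δ(1) ⊗ 1` and `1 ⊗ Δ(1)` -/

section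

open Coalgebra

variable {k H ι : Type*} [Field k] [Ring H] [Algebra k H] [Coalgebra k H] {s : Finset ι}
  {d : ι → k} {x y : ι → H}

theorem assoc_comul_one_mul
    (h : comul (R := k) (1 : H) = ∑ i ∈ s, d i • (x i ⊗ₜ[k] y i)) :
    Algebra.TensorProduct.assoc k k k H H H (comul (R := k) (1 : H) ⊗ₜ[k] (1 : H)) *
      ((1 : H) ⊗ₜ[k] comul (R := k) (1 : H)) =
    ∑ i ∈ s, ∑ j ∈ s, (d i * d j) • (x i ⊗ₜ[k] ((y i * x j) ⊗ₜ[k] y j)) := by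
  simp only [h, TensorProduct.sum_tmul, TensorProduct.tmul_sum, map_sum,
    Finset.sum_mul_sum, ← TensorProduct.smul_tmul', TensorProduct.tmul_smul, map_smul,
    Algebra.TensorProduct.assoc_tmul, smul_mul_smul_comm, Algebra.TensorProduct.tmul_mul_tmul,
    one_mul, mul_one]

theorem mul_assoc_comul_one
    (h : comul (R := k) (1 : H) = ∑ i ∈ s, d i • (x i ⊗ₜ[k] y i)) :
    ((1 : H) ⊗ₜ[k] comul (R := k) (1 : H)) *
      Algebra.TensorProduct.assoc k k k H H H (comul (R := k) (1 : H) ⊗ₜ[k] (1 : H)) =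
    ∑ i ∈ s, ∑ j ∈ s, (d i * d j) • (x i ⊗ₜ[k] ((x j * y i) ⊗ₜ[k] y j)) := by
  rw [Finset.sum_comm]
  simp only [h, TensorProduct.sum_tmul, TensorProduct.tmul_sum, map_sum,
    Finset.sum_mul_sum, ← TensorProduct.smul_tmul', TensorProduct.tmul_smul, map_smul,
    Algebra.TensorProduct.assoc_tmul, smul_mul_smul_comm, Algebra.TensorProduct.tmul_mul_tmul,
    one_mul, mul_one]
  exact Finset.sum_congr rfl fun i _ => Finset.sum_congr rfl fun j _ => by rw [mul_comm]

end

/-! ### Multiplicativity of the comultiplication -/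

namespace DoubleGroupoid.Deformed

open Coalgebra ArrowGroupoid
open scoped Classical

variable {k : Type v} [Field k] {T : DoubleGroupoid.{u}} (ϑ : T.Pt → kˣ)

variable {ϑ} in
theorem induction_box {p : T.Deformed k ϑ → Prop} (a : T.Deformed k ϑ) (h0 : p 0)
    (hadd : ∀ x y, p x → p y → p (x + y)) (hbox : ∀ (c : k) (A : T.Box), p (c • box ϑ A)) : p a :=
  GroupoidAlgebra.induction_of (𝒢 := T.boxV) (p := p) a h0 hadd hbox

/-- The part of `Δ(C)` whose first factors have top side `x`. -/
noncomputable def comulPart [Fintype T.Box] (C : T.Box) (x : T.Hor) :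
    T.Deformed k ϑ ⊗[k] T.Deformed k ϑ :=
  ∑ q ∈ Finset.univ.filter (fun q : T.Box × T.Box => T.boxH.IsComp q.1 q.2 C ∧ top q.1 = x),
    daleth ϑ q.2 • (box ϑ q.1 ⊗ₜ[k] box ϑ q.2)

variable [Fintype T.Box]

theorem comul_mul_comul_expand (A B : T.Box) :
    comul (R := k) (box ϑ A) * comul (R := k) (box ϑ B) =
    ∑ q ∈ Finset.univ.filter (fun q : T.Box × T.Box => T.boxH.IsComp q.1 q.2 A),
      daleth ϑ q.2 •
        ∑ r ∈ Finset.univ.filter (fun r : T.Box × T.Box => T.boxH.IsComp r.1 r.2 B),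
          ∑ U ∈ Finset.univ.filter (fun U => T.boxV.IsComp q.1 r.1 U),
            ∑ V ∈ Finset.univ.filter (fun V => T.boxV.IsComp q.2 r.2 V),
              daleth ϑ V • (box ϑ U ⊗ₜ[k] box ϑ V) := by
  rw [comul_box, comul_box, Finset.sum_mul_sum]
  refine Finset.sum_congr rfl fun q _ => ?_
  rw [Finset.smul_sum]
  refine Finset.sum_congr rfl fun r _ => ?_
  rw [smul_mul_smul_comm, Algebra.TensorProduct.tmul_mul_tmul, box_mul_box, box_mul_box,
    TensorProduct.sum_tmul, mul_smul]
  simp only [TensorProduct.tmul_sum, Finset.smul_sum]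
  refine Finset.sum_congr rfl fun U _ => Finset.sum_congr rfl fun V hV => ?_
  rw [daleth_eq_of_isComp ϑ (Finset.mem_filter.mp hV).2]

/-- In `Δ(A)Δ(B)`, the summand `X ⊗ Y` of `Δ(A)` contributes the whole part of `Δ(AB)` whose first
factors have the same top side as `X`. -/
theorem comul_mul_comul {A B C : T.Box} (h : T.boxV.IsComp A B C) :
    comul (R := k) (box ϑ A) * comul (R := k) (box ϑ B) =
    ∑ q ∈ Finset.univ.filter (fun q : T.Box × T.Box => T.boxH.IsComp q.1 q.2 A),
      daleth ϑ q.2 • comulPart ϑ C (top q.1) := by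
  rw [comul_mul_comul_expand]
  refine Finset.sum_congr rfl fun ⟨X, Y⟩ hq => ?_
  have hA := (Finset.mem_filter.mp hq).2
  dsimp only at hA ⊢
  congr 1
  simp only [Finset.sum_sigma', comulPart]
  refine Finset.sum_nbij (fun x => (x.2.1, x.2.2)) ?_ ?_ ?_ fun _ _ => rfl
  · rintro ⟨⟨Z, W⟩, U, V⟩ hx
    simp only [Finset.mem_sigma, Finset.mem_filter, Finset.mem_univ, true_and] at hx ⊢
    obtain ⟨hB, hU, hV⟩ := hx
    exact ⟨isComp_columns hA hB hU hV h, hU.src⟩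
  · rintro ⟨⟨Z, W⟩, U, V⟩ hx ⟨⟨Z', W'⟩, U', V'⟩ hx' e
    simp only [Finset.coe_sigma, Set.mem_sigma_iff, Finset.mem_coe, Finset.mem_filter,
      Finset.mem_univ, true_and, Prod.mk.injEq] at hx hx' e
    obtain ⟨rfl, rfl⟩ := e
    rw [hx.2.1.left_cancel hx'.2.1, hx.2.2.left_cancel hx'.2.2]
  · rintro ⟨U, V⟩ hx
    simp only [Finset.coe_filter, Finset.mem_univ, true_and, Set.mem_ofPred_eq] at hx
    obtain ⟨hC, hU⟩ := hx
    have hV : top Y = top V := by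
      have h₁ := isComp_top hA
      have h₂ := isComp_top hC
      rw [hU, show top C = top A from h.src] at h₂
      exact h₁.left_cancel h₂
    obtain ⟨Z, hZ⟩ := exists_isComp ((T.boxV.tgt_inv X).trans hU.symm)
    obtain ⟨W, hW⟩ := exists_isComp ((T.boxV.tgt_inv Y).trans hV)
    have hB := isComp_columns (isComp_vinv hA) hC hZ hW h.inv_left
    have hZ' := hZ.inv_left
    have hW' := hW.inv_left
    rw [ArrowGroupoid.inv_inv] at hZ' hW'
    exact ⟨⟨(Z, W), U, V⟩, by simpa using ⟨hB, hZ', hW'⟩, rfl⟩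

theorem sum_comulPart [Fintype T.Hor] (C : T.Box) :
    ∑ x ∈ Finset.univ.filter (fun x => T.hor.src x = tl C), comulPart ϑ C x =
      comul (R := k) (box ϑ C) := by
  rw [comul_box]
  refine Eq.trans ?_ (Finset.sum_fiberwise_of_maps_to (g := fun q : T.Box × T.Box => top q.1)
    (t := Finset.univ.filter fun x => T.hor.src x = tl C) ?_ _)
  · simp only [Finset.filter_filter, comulPart]
  · intro q hq
    simp only [Finset.mem_filter, Finset.mem_univ, true_and] at hq ⊢
    exact (isComp_top hq).src.symm

variable {ϑ}

theorem IsNormalized.comul_box_mul_box (hϑ : IsNormalized ϑ) (A B : T.Box) :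
    comul (R := k) (box ϑ A * box ϑ B) = comul (R := k) (box ϑ A) * comul (R := k) (box ϑ B) := by
  cases nonempty_fintype T.Hor
  by_cases h : bottom A = top B
  · obtain ⟨C, hC⟩ := exists_isComp h
    rw [comul_mul_comul ϑ hC, hϑ.sum_smul_top A (comulPart ϑ C), box_mul_box_of_isComp ϑ hC,
      ← sum_comulPart, show tl C = tl A from congrArg T.hor.src hC.src]
  · rw [box_mul_box_of_ne ϑ h, map_zero, comul_mul_comul_expand, Finset.sum_eq_zero]
    intro q hq
    rw [Finset.sum_eq_zero, smul_zero]
    refine fun r hr => Finset.sum_eq_zero fun U hU => Finset.sum_eq_zero fun V hV => ?_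
    simp only [Finset.mem_filter, Finset.mem_univ, true_and] at hq hr hU hV
    obtain ⟨Z, hZ, -⟩ := isComp_interchange hq hr hU hV
    exact absurd hZ.composable h

theorem IsNormalized.comul_mul (hϑ : IsNormalized ϑ) (a b : T.Deformed k ϑ) :
    comul (R := k) (a * b) = comul (R := k) a * comul (R := k) b := by
  induction a using induction_box with
  | h0 => simp
  | hadd x y hx hy => simp only [add_mul, map_add, hx, hy]
  | hbox c A =>
  induction b using induction_box with
  | h0 => simp
  | hadd x y hx hy => simp only [mul_add, map_add, hx, hy]
  | hbox d B => simp only [smul_mul_smul_comm, map_smul, hϑ.comul_box_mul_box]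

variable (ϑ)

/-- The linear form giving the coefficient of `A ⊗ B`. -/
noncomputable def coeff₂ (A B : T.Box) : T.Deformed k ϑ ⊗[k] T.Deformed k ϑ →ₗ[k] k :=
  LinearMap.mul' k k ∘ₗ TensorProduct.map (coeff ϑ A) (coeff ϑ B)

theorem coeff₂_comulPart {U V C : T.Box} (h : T.boxH.IsComp U V C) (x : T.Hor) :
    coeff₂ ϑ U V (comulPart ϑ C x) = if top U = x then daleth ϑ V else 0 := by
  simp only [comulPart, coeff₂, map_sum, map_smul, LinearMap.comp_apply, TensorProduct.map_tmul,
    LinearMap.mul'_apply, coeff_box, smul_eq_mul]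
  split_ifs with hx
  · rw [Finset.sum_eq_single_of_mem (U, V) (by simpa using ⟨h, hx⟩)]
    · simp
    · rintro ⟨U', V'⟩ - hne
      by_cases hU : U' = U
      · have hV : V' ≠ V := fun e => hne (by rw [hU, e])
        simp [hV]
      · simp [hU]
  · refine Finset.sum_eq_zero fun q hq => ?_
    have hU : q.1 ≠ U := fun e => hx (e ▸ (Finset.mem_filter.mp hq).2.2)
    simp [hU]

variable {ϑ}

/-- The normalization condition at `(g, x)` is the comparison of the coefficients of
`id x⁻¹ ⊗ id x` in `Δ(id g · id g⁻¹)` and in `Δ(id g) Δ(id g⁻¹)`. -/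
theorem isNormalized_of_comul_mul (H : ∀ a b : T.Deformed k ϑ,
    comul (R := k) (a * b) = comul (R := k) a * comul (R := k) b) : IsNormalized ϑ := by
  cases nonempty_fintype T.Hor
  intro g x hgx
  set A : T.Box := T.boxH.id g with hA
  have hC : T.boxV.IsComp A (vinv A) (T.boxV.id (top A)) := T.boxV.isComp_inv_right A
  have ht : top A = T.hor.id (T.hor.tgt x) := by rw [hA, top, T.top_id, hgx]
  have hx : T.hor.IsComp (T.hor.inv x) x (top A) := by
    rw [ht]; exact T.hor.isComp_inv_left x
  have hUV := isComp_hor_id (T := T) hx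
  have key := congrArg (coeff₂ ϑ (T.boxV.id (T.hor.inv x)) (T.boxV.id x))
    ((sum_comulPart ϑ (T.boxV.id (top A))).trans
      ((congrArg _ (box_mul_box_of_isComp ϑ hC).symm).trans
        ((H _ _).trans (comul_mul_comul ϑ hC))))
  simp only [map_sum, map_smul, coeff₂_comulPart ϑ hUV, top_boxV_id, smul_eq_mul] at key
  rw [Finset.sum_eq_single_of_mem (T.hor.inv x), if_pos rfl] at key
  · simp only [mul_ite, mul_zero] at key
    rw [← Finset.sum_filter, Finset.filter_filter, ← Finset.sum_mul] at key
    have e : (∑ q ∈ Finset.univ.filter (fun q : T.Box × T.Box =>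
        T.boxH.IsComp q.1 q.2 A ∧ T.hor.inv x = top q.1), daleth ϑ q.2) =
        ∑ W ∈ Finset.univ.filter (fun W : T.Box => top W = x ∧ right W = g), daleth ϑ W := by
      have := sum_daleth_right ϑ hx
      rw [show right A = g from T.boxH.tgt_id g] at this
      rw [← this]
      refine Finset.sum_congr ?_ fun _ _ => rfl
      ext q
      simp [eq_comm]
    rw [← e]
    exact (mul_eq_right₀ (daleth_ne_zero ϑ _)).mp key.symm
  · simp only [Finset.mem_filter, Finset.mem_univ, true_and, tl, top_boxV_id]
    exact hx.src.symm
  · intro y _ hy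
    rw [if_neg hy.symm]

variable (ϑ)

/-! ### The axioms on the unit -/

theorem lTensor_comul_one :
    (comul (R := k)).lTensor _ (comul (R := k) (1 : T.Deformed k ϑ)) =
    ∑ t ∈ Finset.univ.filter (fun t : T.Box × T.Box × T.Box => IsIdRow t.1 t.2.1 t.2.2),
      (daleth ϑ t.2.1 * daleth ϑ t.2.2) •
        (box ϑ t.1 ⊗ₜ[k] (box ϑ t.2.1 ⊗ₜ[k] box ϑ t.2.2)) := by
  simp only [comul_one, map_sum, map_smul, LinearMap.lTensor_tmul, comul_box,
    TensorProduct.tmul_sum, Finset.smul_sum, TensorProduct.tmul_smul, smul_smul]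
  simp only [Finset.sum_sigma']
  refine Finset.sum_nbij (fun x => (x.1.1, x.2.1, x.2.2)) ?_ ?_ ?_ ?_
  · rintro ⟨⟨U, R⟩, V, W⟩ h
    simp only [Finset.mem_sigma, Finset.mem_filter, Finset.mem_univ, true_and] at h ⊢
    obtain ⟨⟨e, he, hid⟩, hR⟩ := h
    exact ⟨R, e, hR, he, hid⟩
  · rintro ⟨⟨U, R⟩, V, W⟩ h ⟨⟨U', R'⟩, V', W'⟩ h' e
    simp only [Finset.coe_sigma, Set.mem_sigma_iff, Finset.mem_coe, Finset.mem_filter,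
      Finset.mem_univ, true_and, Prod.mk.injEq] at h h' e
    obtain ⟨rfl, rfl, rfl⟩ := e
    rw [h.2.unique h'.2]
  · rintro ⟨U, V, W⟩ h
    obtain ⟨R, e, hR, he, hid⟩ := (Finset.mem_filter.mp h).2
    exact ⟨⟨(U, R), V, W⟩, by simpa using ⟨⟨e, he, hid⟩, hR⟩, rfl⟩
  · rintro ⟨⟨U, R⟩, V, W⟩ h
    simp only [Finset.mem_sigma, Finset.mem_filter, Finset.mem_univ, true_and] at h
    rw [daleth_hcomp ϑ h.2]

/-- If `c` is one of the two orders of vertical composition and `m` the corresponding product, the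
decomposition of rows with identity composite computes the product of `Δ(1) ⊗ 1` and
`1 ⊗ Δ(1)`. -/
theorem sum_isIdRow {c : T.Box → T.Box → T.Box → Prop}
    {m : T.Deformed k ϑ → T.Deformed k ϑ → T.Deformed k ϑ}
    (hm : ∀ Y Z, m (box ϑ Y) (box ϑ Z) = ∑ V ∈ Finset.univ.filter (fun V => c Y Z V), box ϑ V)
    (hc : ∀ {U V W}, IsIdRow U V W ↔ ∃ Y Z, IsIdPair U Y ∧ IsIdPair Z W ∧ c Y Z V)
    (huniq : ∀ {U V W Y Z Y' Z'}, IsIdPair U Y → IsIdPair Z W → c Y Z V → IsIdPair U Y' →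
      IsIdPair Z' W → c Y' Z' V → Y = Y' ∧ Z = Z') :
    ∑ t ∈ Finset.univ.filter (fun t : T.Box × T.Box × T.Box => IsIdRow t.1 t.2.1 t.2.2),
      (daleth ϑ t.2.1 * daleth ϑ t.2.2) •
        (box ϑ t.1 ⊗ₜ[k] (box ϑ t.2.1 ⊗ₜ[k] box ϑ t.2.2)) =
    ∑ q ∈ Finset.univ.filter (fun q : T.Box × T.Box => IsIdPair q.1 q.2),
      ∑ r ∈ Finset.univ.filter (fun r : T.Box × T.Box => IsIdPair r.1 r.2),
        (daleth ϑ q.2 * daleth ϑ r.2) •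
          (box ϑ q.1 ⊗ₜ[k] (m (box ϑ q.2) (box ϑ r.1) ⊗ₜ[k] box ϑ r.2)) := by
  simp only [hm, TensorProduct.sum_tmul, TensorProduct.tmul_sum, Finset.smul_sum]
  simp only [Finset.sum_sigma']
  symm
  refine Finset.sum_nbij (fun x => (x.1.1, x.2.2, x.2.1.2)) ?_ ?_ ?_ ?_
  · rintro ⟨⟨U, Y⟩, ⟨Z, W⟩, V⟩ h
    simp only [Finset.mem_sigma, Finset.mem_filter, Finset.mem_univ, true_and] at h ⊢
    exact hc.mpr ⟨Y, Z, h.1, h.2.1, h.2.2⟩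
  · rintro ⟨⟨U, Y⟩, ⟨Z, W⟩, V⟩ h ⟨⟨U', Y'⟩, ⟨Z', W'⟩, V'⟩ h' e
    simp only [Finset.coe_sigma, Set.mem_sigma_iff, Finset.mem_coe, Finset.mem_filter,
      Finset.mem_univ, true_and, Prod.mk.injEq] at h h' e
    obtain ⟨rfl, rfl, rfl⟩ := e
    obtain ⟨rfl, rfl⟩ := huniq h.1 h.2.1 h.2.2 h'.1 h'.2.1 h'.2.2
    rfl
  · rintro ⟨U, V, W⟩ h
    obtain ⟨Y, Z, hY, hZ, hV⟩ := hc.mp (Finset.mem_filter.mp h).2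
    exact ⟨⟨(U, Y), (Z, W), V⟩, by simpa using ⟨hY, hZ, hV⟩, rfl⟩
  · rintro ⟨⟨U, Y⟩, ⟨Z, W⟩, V⟩ h
    simp only [Finset.mem_sigma, Finset.mem_filter, Finset.mem_univ, true_and] at h
    obtain ⟨R, e, hR, he, -⟩ := hc.mpr ⟨Y, Z, h.1, h.2.1, h.2.2⟩
    obtain ⟨N, hN, -⟩ := hR.assoc' he
    obtain ⟨f, hf, -⟩ := h.1
    have h₁ : bl Y = bl V := (bottom_comp hf.composable).symm.trans (bottom_comp hN.composable)
    simp only [daleth, h₁]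

theorem comul_one_left :
    (comul (R := k)).lTensor _ (comul (R := k) (1 : T.Deformed k ϑ)) =
    Algebra.TensorProduct.assoc k k k (T.Deformed k ϑ) (T.Deformed k ϑ) (T.Deformed k ϑ)
      (comul (R := k) (1 : T.Deformed k ϑ) ⊗ₜ[k] (1 : T.Deformed k ϑ)) *
      ((1 : T.Deformed k ϑ) ⊗ₜ[k] comul (R := k) (1 : T.Deformed k ϑ)) := by
  rw [lTensor_comul_one, sum_isIdRow ϑ (m := fun a b => a * b) (box_mul_box ϑ) isIdRow_iff
    IsIdPair.eq_and_eq]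
  exact (assoc_comul_one_mul (comul_one ϑ)).symm

theorem comul_one_right :
    (comul (R := k)).lTensor _ (comul (R := k) (1 : T.Deformed k ϑ)) =
    ((1 : T.Deformed k ϑ) ⊗ₜ[k] comul (R := k) (1 : T.Deformed k ϑ)) *
    Algebra.TensorProduct.assoc k k k (T.Deformed k ϑ) (T.Deformed k ϑ) (T.Deformed k ϑ)
      (comul (R := k) (1 : T.Deformed k ϑ) ⊗ₜ[k] (1 : T.Deformed k ϑ)) := by
  rw [lTensor_comul_one, sum_isIdRow ϑ (c := fun Y Z V => T.boxV.IsComp Z Y V)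
    (m := fun a b => b * a) (fun Y Z => box_mul_box ϑ Z Y)]
  · exact (mul_assoc_comul_one (comul_one ϑ)).symm
  · intro U V W
    have := isIdRow_iff (T := T.vflip) (U := U) (V := V) (W := W)
    exact this.trans (exists_congr fun Y => exists_congr fun Z =>
      and_congr_right fun _ => and_congr_right fun _ => op_isComp)
  · intro U V W Y Z Y' Z' h₁ h₂ h₃ h₁' h₂' h₃'
    exact IsIdPair.eq_and_eq (T := T.vflip) h₁ h₂ (op_isComp.mpr h₃) h₁' h₂' (op_isComp.mpr h₃')

/-! ### The axioms on the counit -/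

/-- The composite of the column `A`, `B`, `C` is a horizontal identity. -/
abbrev IsIdColumn₃ (A B C : T.Box) : Prop := IsIdRow (T := T.transpose) A B C

theorem counit_box_mul_box_mul_box (A B C : T.Box) :
    counit (R := k) (box ϑ A * box ϑ B * box ϑ C) =
      if IsIdColumn₃ A B C then (daleth ϑ C)⁻¹ else 0 := by
  rw [mul_assoc]
  by_cases h : bottom B = top C
  · obtain ⟨R, hR⟩ := exists_isComp h
    have : IsIdColumn₃ A B C ↔ IsIdColumn A R := by
      constructor
      · rintro ⟨R', e, hR', he, hid⟩
        obtain rfl : R = R' := hR.unique hR'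
        exact ⟨e, he, hid⟩
      · rintro ⟨e, he, hid⟩
        exact ⟨R, e, hR, he, hid⟩
    rw [box_mul_box_of_isComp ϑ hR, counit_box_mul_box, daleth_eq_of_isComp ϑ hR]
    simp only [this]
  · have : ¬ IsIdColumn₃ A B C := fun ⟨R, _, hR, _⟩ => h (IsComp.composable (𝒢 := T.boxV) hR)
    rw [box_mul_box_of_ne ϑ h, mul_zero, map_zero, if_neg this]

/-- A sum with at most one nonzero term, equal to `c` when it is present. -/
theorem sum_ite_eq_ite {ι : Type*} {s : Finset ι} {p : ι → Prop} {Q : Prop} {f : ι → k} {c : k}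
    (hQ : Q ↔ ∃ i ∈ s, p i) (huniq : ∀ i ∈ s, ∀ j ∈ s, p i → p j → i = j)
    (hf : ∀ i ∈ s, f i = if p i then c else 0) : ∑ i ∈ s, f i = if Q then c else 0 := by
  rw [Finset.sum_congr rfl hf]
  split_ifs with h
  · obtain ⟨i, hi, hp⟩ := hQ.mp h
    rw [Finset.sum_eq_single_of_mem i hi, if_pos hp]
    intro j hj hne
    rw [if_neg]
    exact fun hj' => hne (huniq j hj i hi hj' hp)
  · refine Finset.sum_eq_zero fun i hi => ?_
    rw [if_neg]
    exact fun hp => h (hQ.mpr ⟨i, hi, hp⟩)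

/-- A column `A`, `B`, `C` is a horizontal identity exactly when `B` factors, uniquely, into `X`
and `Y` such that `A` above `X` and `Y` above `C` are horizontal identities. -/
theorem counit_box_left (A B C : T.Box) :
    counit (R := k) (box ϑ A * box ϑ B * box ϑ C) =
    ∑ q ∈ Finset.univ.filter (fun q : T.Box × T.Box => T.boxH.IsComp q.1 q.2 B),
      daleth ϑ q.2 * (counit (R := k) (box ϑ A * box ϑ q.1) *
        counit (R := k) (box ϑ q.2 * box ϑ C)) := by
  rw [counit_box_mul_box_mul_box]
  symm
  refine sum_ite_eq_ite (p := fun q => IsIdColumn A q.1 ∧ IsIdColumn q.2 C) ?_ ?_ ?_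
  · refine (isIdRow_iff (T := T.transpose)).trans ?_
    constructor
    · rintro ⟨X, Y, hX, hY, h⟩
      exact ⟨(X, Y), Finset.mem_filter.mpr ⟨Finset.mem_univ _, h⟩, hX, hY⟩
    · rintro ⟨⟨X, Y⟩, h, hX, hY⟩
      exact ⟨X, Y, hX, hY, (Finset.mem_filter.mp h).2⟩
  · rintro ⟨X, Y⟩ h ⟨X', Y'⟩ h' hp hp'
    obtain ⟨rfl, rfl⟩ := IsIdPair.eq_and_eq (T := T.transpose) hp.1 hp.2 (Finset.mem_filter.mp h).2
      hp'.1 hp'.2 (Finset.mem_filter.mp h').2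
    rfl
  · rintro ⟨X, Y⟩ h
    simp only [counit_box_mul_box]
    by_cases hX : IsIdColumn A X
    · rw [daleth_right_of_isIdColumn ϑ (Finset.mem_filter.mp h).2 hX]
      by_cases hY : IsIdColumn Y C <;> simp [hX, hY, daleth_ne_zero]
    · simp [hX]

/-- The counterpart of `counit_box_left` for `T` transposed and then turned upside down. -/
theorem counit_box_right (A B C : T.Box) :
    counit (R := k) (box ϑ A * box ϑ B * box ϑ C) =
    ∑ q ∈ Finset.univ.filter (fun q : T.Box × T.Box => T.boxH.IsComp q.1 q.2 B),
      daleth ϑ q.2 * (counit (R := k) (box ϑ q.1 * box ϑ C) *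
        counit (R := k) (box ϑ A * box ϑ q.2)) := by
  rw [counit_box_mul_box_mul_box]
  symm
  refine sum_ite_eq_ite (p := fun q => IsIdColumn A q.2 ∧ IsIdColumn q.1 C) ?_ ?_ ?_
  · refine (isIdRow_iff (T := T.transpose.vflip)).trans ?_
    constructor
    · rintro ⟨X, Y, hX, hY, h⟩
      exact ⟨(Y, X), Finset.mem_filter.mpr ⟨Finset.mem_univ _, op_isComp.mp h⟩, hX, hY⟩
    · rintro ⟨⟨X, Y⟩, h, hX, hY⟩
      exact ⟨Y, X, hX, hY, op_isComp.mpr (Finset.mem_filter.mp h).2⟩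
  · rintro ⟨X, Y⟩ h ⟨X', Y'⟩ h' hp hp'
    obtain ⟨rfl, rfl⟩ := IsIdPair.eq_and_eq (T := T.transpose.vflip) hp.1 hp.2
      (op_isComp.mpr (Finset.mem_filter.mp h).2) hp'.1 hp'.2
      (op_isComp.mpr (Finset.mem_filter.mp h').2)
    rfl
  · rintro ⟨X, Y⟩ h
    simp only [counit_box_mul_box]
    by_cases hX : IsIdColumn A Y
    · by_cases hY : IsIdColumn X C
      · simp only [hX, hY, if_true, and_self]
        rw [mul_comm (daleth ϑ C)⁻¹, mul_inv_cancel_left₀ (daleth_ne_zero ϑ Y)]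
      · simp [hY]
    · simp [hX]

theorem counit_mul_left (a b c : T.Deformed k ϑ) : counit (R := k) (a * b * c) =
    LinearMap.mul' k k (TensorProduct.map
      (counit (R := k) ∘ₗ LinearMap.mulLeft k a) (counit (R := k) ∘ₗ LinearMap.mulRight k c)
      (comul (R := k) b)) := by
  induction b using induction_box with
  | h0 => simp
  | hadd x y hx hy => simp only [mul_add, add_mul, map_add, hx, hy]
  | hbox s B =>
  simp only [mul_smul_comm, smul_mul_assoc, map_smul, comul_box, map_sum, TensorProduct.map_tmul,
    LinearMap.mul'_apply, LinearMap.comp_apply, LinearMap.mulLeft_apply, LinearMap.mulRight_apply,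
    smul_eq_mul]
  congr 1
  induction a using induction_box with
  | h0 => simp
  | hadd x y hx hy => simp only [add_mul, map_add, hx, hy, mul_add, Finset.sum_add_distrib]
  | hbox r A =>
  induction c using induction_box with
  | h0 => simp
  | hadd x y hx hy => simp only [map_add, hx, hy, mul_add, Finset.sum_add_distrib]
  | hbox t C =>
  simp only [mul_smul_comm, smul_mul_assoc, map_smul, counit_box_left, smul_eq_mul, Finset.mul_sum]
  refine Finset.sum_congr rfl fun q _ => ?_
  ring

theorem counit_mul_right (a b c : T.Deformed k ϑ) : counit (R := k) (a * b * c) =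
    LinearMap.mul' k k (TensorProduct.map
      (counit (R := k) ∘ₗ LinearMap.mulRight k c) (counit (R := k) ∘ₗ LinearMap.mulLeft k a)
      (comul (R := k) b)) := by
  induction b using induction_box with
  | h0 => simp
  | hadd x y hx hy => simp only [mul_add, add_mul, map_add, hx, hy]
  | hbox s B =>
  simp only [mul_smul_comm, smul_mul_assoc, map_smul, comul_box, map_sum, TensorProduct.map_tmul,
    LinearMap.mul'_apply, LinearMap.comp_apply, LinearMap.mulLeft_apply, LinearMap.mulRight_apply,
    smul_eq_mul]
  congr 1
  induction a using induction_box with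
  | h0 => simp
  | hadd x y hx hy => simp only [add_mul, map_add, hx, hy, mul_add, Finset.sum_add_distrib]
  | hbox r A =>
  induction c using induction_box with
  | h0 => simp
  | hadd x y hx hy => simp only [map_add, hx, hy, mul_add, add_mul, Finset.sum_add_distrib]
  | hbox t C =>
  simp only [mul_smul_comm, smul_mul_assoc, map_smul, counit_box_right, smul_eq_mul,
    Finset.mul_sum]
  refine Finset.sum_congr rfl fun q _ => ?_
  ring

theorem isWeakBialgebra_iff : IsWeakBialgebra k (T.Deformed k ϑ) ↔ IsNormalized ϑ :=
  ⟨fun h => isNormalized_of_comul_mul h.comul_mul,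
   fun h => ⟨h.comul_mul, comul_one_left ϑ, comul_one_right ϑ, counit_mul_left ϑ,
    counit_mul_right ϑ⟩⟩

end DoubleGroupoid.Deformed

/-! ### Source and target maps, and uniqueness of antipodes -/

section

open Coalgebra WithConv

variable {k H ι : Type*} [Field k] [Ring H] [Algebra k H] [Coalgebra k H] {s : Finset ι}
  {d : ι → k} {x y : ι → H}

theorem sourceMap_eq_sum (h : comul (R := k) (1 : H) = ∑ i ∈ s, d i • (x i ⊗ₜ[k] y i)) (a : H) :
    sourceMap k H a = ∑ i ∈ s, (d i * counit (R := k) (a * y i)) • x i := by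
  simp [sourceMap, h, Finset.mul_sum, mul_smul]

theorem targetMap_eq_sum (h : comul (R := k) (1 : H) = ∑ i ∈ s, d i • (x i ⊗ₜ[k] y i)) (a : H) :
    targetMap k H a = ∑ i ∈ s, (d i * counit (R := k) (x i * a)) • y i := by
  simp [targetMap, h, Finset.sum_mul, mul_smul]

/-- The third antipode axiom says that `S * ε_t = S` for the convolution product. -/
theorem antipode_convolution {S R : H →ₗ[k] H} (h : LinearMap.mul' k H ∘ₗ S.lTensor H ∘ₗ comul = R) :
    LinearMap.mul' k H ∘ₗ
      TensorProduct.map S (LinearMap.mul' k H ∘ₗ S.lTensor H) ∘ₗ comul.lTensor H ∘ₗ comul =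
    LinearMap.mul' k H ∘ₗ TensorProduct.map S R ∘ₗ comul := by
  subst h
  rw [← LinearMap.comp_assoc (comul (R := k) (A := H)) (comul.lTensor H), LinearMap.map_comp_lTensor,
    LinearMap.comp_assoc]

/-- Antipodes are unique: they are two-sided inverses of the identity, relative to `ε_s` and `ε_t`,
in the convolution algebra. -/
theorem IsAntipode.unique {S S' : H →ₗ[k] H} (h : IsAntipode S) (h' : IsAntipode S') : S = S' := by
  have ht : ∀ {S : H →ₗ[k] H}, IsAntipode S →
      toConv (LinearMap.id : H →ₗ[k] H) * toConv S = toConv (targetMap k H) :=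
    fun h => congrArg toConv h.mul_id_antipode
  have hs : ∀ {S : H →ₗ[k] H}, IsAntipode S →
      toConv S * toConv (LinearMap.id : H →ₗ[k] H) = toConv (sourceMap k H) :=
    fun h => congrArg toConv h.mul_antipode_id
  have hS : ∀ {S : H →ₗ[k] H}, IsAntipode S → toConv S * toConv (targetMap k H) = toConv S :=
    fun h => congrArg toConv
      ((antipode_convolution h.mul_id_antipode).symm.trans h.antipode_id_antipode)
  have key : toConv S = toConv S' := by
    rw [← hS h, ← ht h', ← mul_assoc, hs h, ← hs h', mul_assoc, ht h', hS h']
  exact toConv_injective key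

end

namespace DoubleGroupoid.Deformed

open Coalgebra ArrowGroupoid
open scoped Classical

variable {k : Type v} [Field k] {T : DoubleGroupoid.{u}} (ϑ : T.Pt → kˣ)

/-- The coefficient of the antipode at `A`. -/
noncomputable def ratio (A : T.Box) : k := (ϑ (tr A) : k) / (ϑ (br A) : k)

theorem ratio_ne_zero (A : T.Box) : ratio ϑ A ≠ 0 :=
  div_ne_zero (ϑ (tr A)).ne_zero (ϑ (br A)).ne_zero

theorem ratio_eq (A : T.Box) : daleth ϑ (tinv A) / daleth ϑ (hinv A) = ratio ϑ A := by
  rw [daleth_tinv, daleth_hinv, ratio]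

theorem ratio_hcomp {X Y A : T.Box} (h : T.boxH.IsComp X Y A) : ratio ϑ Y = ratio ϑ A := by
  simp only [ratio, tr, br, (isComp_top h).tgt, (isComp_bottom h).tgt]

theorem daleth_mul_ratio {X Y A : T.Box} (h : T.boxH.IsComp X Y A) :
    daleth ϑ Y * ratio ϑ X = (ϑ (tr X) : k) := by
  have hb : bl Y = br X := (bottom_comp h.composable).symm
  rw [daleth, hb, ratio, mul_div_cancel₀ _ (ϑ (br X)).ne_zero]

theorem daleth_of_isRightExt_psi {A Y : T.Box} (hA : T.hor.IsId (bottom A))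
    (h : IsRightExt (psi A hA).1 Y) : daleth ϑ Y = (ϑ (tr A) : k) := by
  have h₁ : bottom (psi A hA).1 = bottom (tinv A) := (isComp_psi hA).tgt
  rw [daleth, bl, h.bottom_eq.src, h₁, bottom_tinv, T.hor.src_inv]

variable [Fintype T.Box]

theorem oneD_eq (D : T.CoreD) :
    oneD ϑ D = ∑ B ∈ Finset.univ.filter (fun B => IsLeftExt D.1 B), box ϑ B := by
  cases nonempty_fintype T.Hor
  rw [oneD, finsum_eq_sum_of_fintype]
  refine Finset.sum_nbij (fun z => T.boxH.comp (T.boxV.id z.1) D.1 (id_left_comp D.2.1 z.2))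
    ?_ ?_ ?_ fun _ _ => rfl
  · intro z _
    exact Finset.mem_filter.mpr ⟨Finset.mem_univ _, z.1, _, rfl⟩
  · intro z _ w _ e
    have hz : T.boxH.IsComp (T.boxV.id z.1) D.1 _ := ⟨id_left_comp D.2.1 z.2, rfl⟩
    have hw : T.boxH.IsComp (T.boxV.id w.1) D.1 _ := ⟨id_left_comp D.2.1 w.2, rfl⟩
    exact Subtype.ext ((bottom_id_left_of D.2.2 hz).symm.trans
      ((congrArg bottom e).trans (bottom_id_left_of D.2.2 hw)))
  · intro B hB
    obtain ⟨z, h, rfl⟩ := (Finset.mem_filter.mp hB).2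
    have hz : T.hor.tgt z = T.coreD.tgt D := by
      have := top_comp h
      rwa [top_boxV_id] at this
    exact ⟨⟨z, hz⟩, Finset.mem_coe.mpr (Finset.mem_univ _), rfl⟩

theorem oneE_eq (E : T.CoreE) :
    oneE ϑ E = ∑ B ∈ Finset.univ.filter (fun B => IsRightExt E.1 B), box ϑ B := by
  cases nonempty_fintype T.Hor
  rw [oneE, finsum_eq_sum_of_fintype]
  refine Finset.sum_nbij
    (fun x => T.boxH.comp E.1 (T.boxV.id x.1) (id_right_comp E.2.1 x.2.symm))
    ?_ ?_ ?_ fun _ _ => rfl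
  · intro z _
    exact Finset.mem_filter.mpr ⟨Finset.mem_univ _, z.1, _, rfl⟩
  · intro z _ w _ e
    have hz : T.boxH.IsComp E.1 (T.boxV.id z.1) _ := ⟨id_right_comp E.2.1 z.2.symm, rfl⟩
    have hw : T.boxH.IsComp E.1 (T.boxV.id w.1) _ := ⟨id_right_comp E.2.1 w.2.symm, rfl⟩
    exact Subtype.ext ((top_id_right_of E.2.2 hz).symm.trans
      ((congrArg top e).trans (top_id_right_of E.2.2 hw)))
  · intro B hB
    obtain ⟨x, h, rfl⟩ := (Finset.mem_filter.mp hB).2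
    have hx : T.hor.src x = T.coreE.tgt E := by
      have := bottom_comp h
      rw [bottom_boxV_id] at this
      exact this.symm
    exact ⟨⟨x, hx⟩, Finset.mem_coe.mpr (Finset.mem_univ _), rfl⟩

theorem sourceMap_box (A : T.Box) (hA : T.hor.IsId (top A)) :
    sourceMap k (T.Deformed k ϑ) (box ϑ A) = oneD ϑ (phi A hA) := by
  rw [sourceMap_eq_sum (comul_one ϑ), oneD_eq]
  have hterm : ∀ q : T.Box × T.Box,
      (daleth ϑ q.2 * counit (R := k) (box ϑ A * box ϑ q.2)) • box ϑ q.1 =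
      if IsIdColumn A q.2 then box ϑ q.1 else 0 := fun q => by
    rw [counit_box_mul_box]
    split_ifs
    · rw [mul_inv_cancel₀ (daleth_ne_zero ϑ _), one_smul]
    · rw [mul_zero, zero_smul]
  simp only [hterm]
  rw [← Finset.sum_filter, Finset.filter_filter]
  refine Finset.sum_nbij Prod.fst ?_ ?_ ?_ fun _ _ => rfl
  · intro q hq
    simp only [Finset.mem_filter, Finset.mem_univ, true_and] at hq ⊢
    exact ((isIdPair_isIdColumn_iff_phi hA).mp hq).2
  · rintro ⟨X, Y⟩ hq ⟨X', Y'⟩ hq' e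
    simp only [Finset.coe_filter, Finset.mem_univ, true_and, Set.mem_ofPred_eq] at hq hq' e
    subst e
    rw [((isIdPair_isIdColumn_iff_phi hA).mp hq).1, ((isIdPair_isIdColumn_iff_phi hA).mp hq').1]
  · intro X hX
    have := (isIdPair_isIdColumn_iff_phi hA).mpr ⟨rfl, (Finset.mem_filter.mp hX).2⟩
    exact ⟨(X, _), Finset.mem_coe.mpr (Finset.mem_filter.mpr ⟨Finset.mem_univ _, this⟩), rfl⟩

theorem sourceMap_box_of_not (A : T.Box) (hA : ¬ T.hor.IsId (top A)) :
    sourceMap k (T.Deformed k ϑ) (box ϑ A) = 0 := by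
  rw [sourceMap_eq_sum (comul_one ϑ)]
  refine Finset.sum_eq_zero fun q _ => ?_
  rw [counit_box_mul_box, if_neg fun h => hA h.isId_top, mul_zero, zero_smul]

theorem targetMap_box (A : T.Box) (hA : T.hor.IsId (bottom A)) :
    targetMap k (T.Deformed k ϑ) (box ϑ A) = ratio ϑ A • oneE ϑ (psi A hA) := by
  rw [targetMap_eq_sum (comul_one ϑ), oneE_eq]
  have hterm : ∀ q : T.Box × T.Box,
      (daleth ϑ q.2 * counit (R := k) (box ϑ q.1 * box ϑ A)) • box ϑ q.2 =
      if IsIdColumn q.1 A then (daleth ϑ q.2 * (daleth ϑ A)⁻¹) • box ϑ q.2 else 0 := fun q => by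
    rw [counit_box_mul_box]
    split_ifs
    · rfl
    · rw [mul_zero, zero_smul]
  simp only [hterm]
  rw [← Finset.sum_filter, Finset.filter_filter, Finset.smul_sum]
  refine Finset.sum_nbij Prod.snd ?_ ?_ ?_ ?_
  · intro q hq
    simp only [Finset.mem_filter, Finset.mem_univ, true_and] at hq ⊢
    exact ((isIdPair_isIdColumn_iff_psi hA).mp hq).2
  · rintro ⟨X, Y⟩ hq ⟨X', Y'⟩ hq' e
    simp only [Finset.coe_filter, Finset.mem_univ, true_and, Set.mem_ofPred_eq] at hq hq' e
    subst e
    rw [((isIdPair_isIdColumn_iff_psi hA).mp hq).1, ((isIdPair_isIdColumn_iff_psi hA).mp hq').1]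
  · intro Y hY
    have := (isIdPair_isIdColumn_iff_psi hA).mpr ⟨rfl, (Finset.mem_filter.mp hY).2⟩
    exact ⟨(_, Y), Finset.mem_coe.mpr (Finset.mem_filter.mpr ⟨Finset.mem_univ _, this⟩), rfl⟩
  · intro q hq
    have h := ((isIdPair_isIdColumn_iff_psi hA).mp (Finset.mem_filter.mp hq).2).2
    have hb : bl A = br A := IsId.src_eq_tgt _ hA
    rw [daleth_of_isRightExt_psi ϑ hA h, daleth, hb, ratio, div_eq_mul_inv]

theorem targetMap_box_of_not (A : T.Box) (hA : ¬ T.hor.IsId (bottom A)) :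
    targetMap k (T.Deformed k ϑ) (box ϑ A) = 0 := by
  rw [targetMap_eq_sum (comul_one ϑ)]
  refine Finset.sum_eq_zero fun q _ => ?_
  rw [counit_box_mul_box, if_neg fun h => hA h.isId_bottom, mul_zero, zero_smul]

/-! ### The antipode -/

/-- The antipode of the deformed algebra. -/
noncomputable def antipode : T.Deformed k ϑ →ₗ[k] T.Deformed k ϑ :=
  lift ϑ fun A => ratio ϑ A • box ϑ (tinv A)

theorem antipode_box (A : T.Box) : antipode ϑ (box ϑ A) = ratio ϑ A • box ϑ (tinv A) :=
  lift_box ϑ _ A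

theorem box_eq_sum_filter {p : T.Box → Prop} [DecidablePred p] {K : T.Box} (hK : p K)
    (huniq : ∀ L, p L → L = K) :
    box ϑ K = ∑ L ∈ Finset.univ.filter p, box ϑ L := by
  rw [Finset.sum_eq_single_of_mem K (by simpa using hK)]
  intro L hL hne
  exact absurd (huniq L (Finset.mem_filter.mp hL).2) hne

variable {ϑ}

theorem IsNormalized.mul_id_antipode (hϑ : IsNormalized ϑ) :
    LinearMap.mul' k (T.Deformed k ϑ) ∘ₗ (antipode ϑ).lTensor (T.Deformed k ϑ) ∘ₗ comul =
      targetMap k (T.Deformed k ϑ) := by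
  cases nonempty_fintype T.Hor
  refine hom_ext ϑ fun A => ?_
  have hL : (LinearMap.mul' k (T.Deformed k ϑ) ∘ₗ (antipode ϑ).lTensor (T.Deformed k ϑ) ∘ₗ comul)
      (box ϑ A) = ∑ q ∈ Finset.univ.filter (fun q : T.Box × T.Box => T.boxH.IsComp q.1 q.2 A),
        daleth ϑ q.2 • (ratio ϑ A • (box ϑ q.1 * box ϑ (tinv q.2))) := by
    simp only [LinearMap.comp_apply, comul_box, map_sum, map_smul, LinearMap.lTensor_tmul,
      LinearMap.mul'_apply, antipode_box, mul_smul_comm]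
    refine Finset.sum_congr rfl fun q hq => ?_
    rw [ratio_hcomp ϑ (Finset.mem_filter.mp hq).2]
  rw [hL]
  by_cases hA : T.hor.IsId (bottom A)
  · -- the summand of `1_{ψ(A)}` with top side `x`, as a function of `x`
    let F : T.Hor → T.Deformed k ϑ := fun x => ratio ϑ A • ∑ K ∈ Finset.univ.filter
      (fun K => IsRightExt (psi A hA).1 K ∧ top K = x), box ϑ K
    rw [targetMap_box ϑ A hA, oneE_eq]
    refine Eq.trans (Finset.sum_congr rfl fun q hq => ?_) ((hϑ.sum_smul_top A F).trans ?_)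
    · obtain ⟨K, hK, hK'⟩ := exists_isComp_psi (Finset.mem_filter.mp hq).2 hA
      rw [box_mul_box_of_isComp ϑ hK]
      congr 2
      exact box_eq_sum_filter ϑ (p := fun K => IsRightExt (psi A hA).1 K ∧ top K = top q.1)
        ⟨⟨_, hK'⟩, hK.src⟩ fun L hL =>
        hL.1.eq_of_top_eq ⟨_, hK'⟩ (hL.2.trans hK.src.symm)
    · simp only [F]
      rw [← Finset.smul_sum]
      congr 1
      refine Eq.trans ?_ (Finset.sum_fiberwise_of_maps_to (g := fun K : T.Box => top K)
        (t := Finset.univ.filter fun x => T.hor.src x = tl A) ?_ _)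
      · simp only [Finset.filter_filter]
      · intro K hK
        simp only [Finset.mem_filter, Finset.mem_univ, true_and] at hK ⊢
        rw [← hK.bottom_eq.composable, show bottom (psi A hA).1 = bottom (tinv A) from
          (isComp_psi hA).tgt, bottom_tinv, T.hor.tgt_inv]
  · rw [targetMap_box_of_not ϑ A hA]
    refine Finset.sum_eq_zero fun q hq => ?_
    rw [box_mul_box_of_ne, smul_zero, smul_zero]
    exact fun h => hA (isId_bottom_of_composable (Finset.mem_filter.mp hq).2 h)

theorem IsNormalized.mul_antipode_id (hϑ : IsNormalized ϑ) :
    LinearMap.mul' k (T.Deformed k ϑ) ∘ₗ (antipode ϑ).rTensor (T.Deformed k ϑ) ∘ₗ comul =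
      sourceMap k (T.Deformed k ϑ) := by
  cases nonempty_fintype T.Hor
  refine hom_ext ϑ fun A => ?_
  have hL : (LinearMap.mul' k (T.Deformed k ϑ) ∘ₗ (antipode ϑ).rTensor (T.Deformed k ϑ) ∘ₗ comul)
      (box ϑ A) = ∑ q ∈ Finset.univ.filter (fun q : T.Box × T.Box => T.boxH.IsComp q.1 q.2 A),
        (ϑ (tr q.1) : k) • (box ϑ (tinv q.1) * box ϑ q.2) := by
    simp only [LinearMap.comp_apply, comul_box, map_sum, map_smul, LinearMap.rTensor_tmul,
      LinearMap.mul'_apply, antipode_box, smul_mul_assoc, smul_smul]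
    refine Finset.sum_congr rfl fun q hq => ?_
    rw [daleth_mul_ratio ϑ (Finset.mem_filter.mp hq).2]
  rw [hL]
  by_cases hA : T.hor.IsId (top A)
  · -- the summand of `_{φ(A)}1` with bottom side `x`, as a function of `x`
    let F : T.Hor → T.Deformed k ϑ := fun x => ∑ K ∈ Finset.univ.filter
      (fun K => IsLeftExt (phi A hA).1 K ∧ bottom K = x), box ϑ K
    rw [sourceMap_box ϑ A hA, oneD_eq]
    refine Eq.trans (Finset.sum_congr rfl fun q hq => ?_) ((hϑ.sum_smul_bottom A F).trans ?_)
    · obtain ⟨K, hK, hK'⟩ := exists_isComp_phi (Finset.mem_filter.mp hq).2 hA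
      rw [box_mul_box_of_isComp ϑ hK]
      congr 1
      exact box_eq_sum_filter ϑ (p := fun K => IsLeftExt (phi A hA).1 K ∧ bottom K = bottom q.2)
        ⟨⟨_, hK'⟩, hK.tgt⟩ fun L hL =>
        hL.1.eq_of_bottom_eq ⟨_, hK'⟩ (hL.2.trans hK.tgt.symm)
    · refine Eq.trans ?_ (Finset.sum_fiberwise_of_maps_to (g := fun K : T.Box => bottom K)
        (t := Finset.univ.filter fun x => T.hor.tgt x = br A) ?_ _)
      · simp only [Finset.filter_filter, F]
      · intro K hK
        simp only [Finset.mem_filter, Finset.mem_univ, true_and] at hK ⊢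
        rw [hK.top_eq.composable, show top (phi A hA).1 = top (tinv A) from
          (isComp_phi hA).src, top_tinv, T.hor.src_inv]
  · rw [sourceMap_box_of_not ϑ A hA]
    refine Finset.sum_eq_zero fun q hq => ?_
    rw [box_mul_box_of_ne, smul_zero]
    exact fun h => hA (isId_top_of_composable (Finset.mem_filter.mp hq).2 h)

variable (ϑ) in
/-- The terms `S(X) ε_t(Y)` of `(S * ε_t)(A)` are all multiples of the box `A⁻¹`. -/
theorem box_tinv_mul_oneE {X Y A : T.Box} (h : T.boxH.IsComp X Y A)
    (hY : T.hor.IsId (bottom Y)) :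
    box ϑ (tinv X) * oneE ϑ (psi Y hY) = box ϑ (tinv A) := by
  rw [oneE_eq, box_eq_sum_filter ϑ (p := fun L => L = tinv X) rfl fun _ => id,
    box_eq_sum_filter ϑ (p := fun L => L = tinv A) rfl fun _ => id]
  refine sum_box_mul_sum_box ϑ ?_ ?_ ?_
  · rintro _ K L rfl ⟨x, hK⟩ hL
    exact tinv_eq_of_isComp_psi h hY hK hL
  · rintro _ K _ K' L rfl hK hL rfl hK' hL'
    exact ⟨rfl, hL.left_cancel hL'⟩
  · rintro _ rfl
    obtain ⟨K, x, hK, hL⟩ := exists_isComp_psi_tinv h hY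
    exact ⟨_, K, rfl, ⟨x, hK⟩, hL⟩

theorem IsNormalized.isAntipode (hϑ : IsNormalized ϑ) : IsAntipode (antipode ϑ) := by
  refine ⟨hϑ.mul_id_antipode, hϑ.mul_antipode_id, ?_⟩
  rw [antipode_convolution hϑ.mul_id_antipode]
  cases nonempty_fintype T.Hor
  refine hom_ext ϑ fun A => ?_
  -- `ε_t(Y)` vanishes unless `b(Y)` is an identity, that is, `b(Y)` is the identity of `br(A)`
  let F : T.Hor → T.Deformed k ϑ := fun z =>
    if T.hor.IsId z then ratio ϑ A • box ϑ (tinv A) else 0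
  have hterm : ∀ q ∈ Finset.univ.filter (fun q : T.Box × T.Box => T.boxH.IsComp q.1 q.2 A),
      daleth ϑ q.2 • (antipode ϑ (box ϑ q.1) * targetMap k (T.Deformed k ϑ) (box ϑ q.2)) =
      (ϑ (tr q.1) : k) • F (bottom q.2) := fun q hq => by
    have h := (Finset.mem_filter.mp hq).2
    by_cases hY : T.hor.IsId (bottom q.2)
    · simp only [F, if_pos hY]
      rw [antipode_box, targetMap_box ϑ _ hY, ratio_hcomp ϑ h, smul_mul_smul_comm,
        box_tinv_mul_oneE ϑ h hY, ← daleth_mul_ratio ϑ h, mul_smul, mul_smul]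
    · simp only [F, if_neg hY]
      rw [targetMap_box_of_not ϑ _ hY, mul_zero, smul_zero, smul_zero]
  simp only [LinearMap.comp_apply, comul_box, map_sum, map_smul, TensorProduct.map_tmul,
    LinearMap.mul'_apply]
  rw [Finset.sum_congr rfl hterm, hϑ.sum_smul_bottom A F, antipode_box,
    Finset.sum_eq_single_of_mem (T.hor.id (br A))]
  · exact if_pos (T.hor.isId_id _)
  · simpa using T.hor.tgt_id _
  · intro z hz hne
    refine if_neg fun hid => hne ?_
    rw [← (Finset.mem_filter.mp hz).2]
    exact IsId.eq_tgt _ hid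

/-! ### The source and target subalgebras -/

variable (ϑ)

theorem oneD_mul_oneD {D L : T.CoreD} (e : tl D.1 = tr L.1) :
    oneD ϑ D * oneD ϑ L = oneD ϑ (D.comp L e) := by
  simp only [oneD_eq]
  refine sum_box_mul_sum_box ϑ (fun hB hC hK => hB.comp e hC hK) ?_ fun hK => hK.exists_of_comp e
  intro B C B' C' K hB hC hK hB' hC' hK'
  obtain rfl := hC.eq_of_bottom_eq hC' (hK.tgt.symm.trans hK'.tgt)
  exact ⟨hK.right_cancel hK', rfl⟩

theorem oneD_mul_oneD_of_ne {D L : T.CoreD} (e : ¬ tl D.1 = tr L.1) :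
    oneD ϑ D * oneD ϑ L = 0 := by
  simp only [oneD_eq, Finset.sum_mul_sum]
  refine Finset.sum_eq_zero fun B hB => Finset.sum_eq_zero fun C hC => ?_
  refine box_mul_box_of_ne ϑ fun h => e ?_
  obtain ⟨K, hK⟩ := exists_isComp h
  exact (Finset.mem_filter.mp hB).2.composable (Finset.mem_filter.mp hC).2 hK

theorem oneE_mul_oneE {E M : T.CoreE} (e : br M.1 = bl E.1) :
    oneE ϑ E * oneE ϑ M = oneE ϑ (M.comp E e) := by
  simp only [oneE_eq]
  refine sum_box_mul_sum_box ϑ (fun hB hC hK => hB.comp e hC hK) ?_ fun hK => hK.exists_of_comp e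
  intro B C B' C' K hB hC hK hB' hC' hK'
  obtain rfl := hB.eq_of_top_eq hB' (hK.src.symm.trans hK'.src)
  exact ⟨rfl, hK.left_cancel hK'⟩

theorem oneE_mul_oneE_of_ne {E M : T.CoreE} (e : ¬ br M.1 = bl E.1) :
    oneE ϑ E * oneE ϑ M = 0 := by
  simp only [oneE_eq, Finset.sum_mul_sum]
  refine Finset.sum_eq_zero fun B hB => Finset.sum_eq_zero fun C hC => ?_
  refine box_mul_box_of_ne ϑ fun h => e ?_
  obtain ⟨K, hK⟩ := exists_isComp h
  exact (Finset.mem_filter.mp hB).2.composable (Finset.mem_filter.mp hC).2 hK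

theorem sum_oneD_id [Fintype T.Pt] : ∑ p : T.Pt, oneD ϑ (CoreD.id (T := T) p) = 1 := by
  simp only [oneD_eq, one_eq]
  rw [← Finset.sum_fiberwise (g := fun C : T.Box => tr C)]
  refine Finset.sum_congr rfl fun p _ => Finset.sum_congr ?_ fun _ _ => rfl
  rw [Finset.filter_filter]
  ext C
  simp only [Finset.mem_filter, Finset.mem_univ, true_and, isLeftExt_id_iff]
  constructor
  · rintro ⟨z, rfl, rfl⟩
    exact ⟨T.boxV.isId_id z, by rw [tr, top_boxV_id]⟩
  · rintro ⟨h, rfl⟩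
    exact ⟨top C, rfl, eq_id_top h⟩

theorem sum_oneE_id [Fintype T.Pt] : ∑ p : T.Pt, oneE ϑ (CoreE.id (T := T) p) = 1 := by
  simp only [oneE_eq, one_eq]
  rw [← Finset.sum_fiberwise (g := fun C : T.Box => tl C)]
  refine Finset.sum_congr rfl fun p _ => Finset.sum_congr ?_ fun _ _ => rfl
  rw [Finset.filter_filter]
  ext C
  simp only [Finset.mem_filter, Finset.mem_univ, true_and, isRightExt_id_iff]
  constructor
  · rintro ⟨z, rfl, rfl⟩
    exact ⟨T.boxV.isId_id z, by rw [tl, top_boxV_id]⟩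
  · rintro ⟨h, rfl⟩
    exact ⟨top C, rfl, eq_id_top h⟩

/-- The linear map `k𝐃 → k^(ϑ)T`, `D ↦ _D1`. -/
noncomputable def liftD : GroupoidAlgebra k T.coreD →ₗ[k] T.Deformed k ϑ :=
  GroupoidAlgebra.lift k T.coreD (oneD ϑ)

theorem liftD_of (D : T.CoreD) : liftD ϑ (GroupoidAlgebra.of k T.coreD D) = oneD ϑ D :=
  GroupoidAlgebra.lift_of _ D

theorem liftD_one : liftD ϑ 1 = 1 := by
  cases nonempty_fintype T.Pt
  rw [GroupoidAlgebra.one_def, finsum_eq_sum_of_fintype, map_sum, ← sum_oneD_id ϑ]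
  exact Finset.sum_congr rfl fun p _ => liftD_of ϑ _

theorem liftD_mul (a b : GroupoidAlgebra k T.coreD) : liftD ϑ (a * b) = liftD ϑ a * liftD ϑ b := by
  induction a using GroupoidAlgebra.induction_of with
  | h0 => simp
  | hadd x y hx hy => simp only [add_mul, map_add, hx, hy]
  | hof r D =>
  induction b using GroupoidAlgebra.induction_of with
  | h0 => simp
  | hadd x y hx hy => simp only [mul_add, map_add, hx, hy]
  | hof t L =>
  rw [smul_mul_smul_comm, map_smul, map_smul, map_smul, smul_mul_smul_comm,
    GroupoidAlgebra.of_mul_of, liftD_of, liftD_of]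
  congr 1
  by_cases e : T.coreD.tgt D = T.coreD.src L
  · rw [GroupoidAlgebra.mulArrows_pos k _ e, liftD_of, oneD_mul_oneD ϑ e]
    rfl
  · rw [GroupoidAlgebra.mulArrows_neg k _ e, map_zero, oneD_mul_oneD_of_ne ϑ e]

/-- The only summand of `_D1` that lies in the core groupoid is `D`. -/
theorem liftD_injective : Function.Injective (liftD ϑ) := by
  let π : T.Deformed k ϑ →ₗ[k] GroupoidAlgebra k T.coreD := lift ϑ fun B =>
    if h : T.ver.IsId (left B) ∧ T.hor.IsId (bottom B) then
      GroupoidAlgebra.of k T.coreD ⟨B, h⟩ else 0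
  have hπ : π ∘ₗ liftD ϑ = LinearMap.id := by
    refine GroupoidAlgebra.hom_ext fun D => ?_
    rw [LinearMap.comp_apply, liftD_of, oneD_eq, map_sum,
      Finset.sum_eq_single_of_mem D.1 (by simpa using isLeftExt_self D)]
    · simp only [π, lift_box]
      exact dif_pos D.2
    · intro B hB hne
      simp only [π, lift_box]
      exact dif_neg fun h => hne ((Finset.mem_filter.mp hB).2.eq_of_isId h.2)
  exact Function.LeftInverse.injective (g := π) fun a => LinearMap.congr_fun hπ a

theorem range_liftD : LinearMap.range (liftD ϑ) =
    LinearMap.range (sourceMap k (T.Deformed k ϑ)) := by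
  refine le_antisymm ?_ ?_
  · rintro _ ⟨a, rfl⟩
    induction a using GroupoidAlgebra.induction_of with
    | h0 => rw [map_zero]; exact Submodule.zero_mem _
    | hadd x y hx hy => rw [map_add]; exact Submodule.add_mem _ hx hy
    | hof c D =>
      obtain ⟨A, hA, rfl⟩ := D.exists_phi_eq
      rw [map_smul, liftD_of, ← sourceMap_box]
      exact Submodule.smul_mem _ _ ⟨_, rfl⟩
  · rintro _ ⟨a, rfl⟩
    induction a using induction_box with
    | h0 => rw [map_zero]; exact Submodule.zero_mem _
    | hadd x y hx hy => rw [map_add]; exact Submodule.add_mem _ hx hy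
    | hbox c A =>
      rw [map_smul]
      refine Submodule.smul_mem _ _ ?_
      by_cases hA : T.hor.IsId (top A)
      · rw [sourceMap_box ϑ A hA, ← liftD_of]
        exact ⟨_, rfl⟩
      · rw [sourceMap_box_of_not ϑ A hA]
        exact Submodule.zero_mem _

/-- The linear map `k𝐄 → k^(ϑ)T`, `E ↦ 1_E`. -/
noncomputable def liftE : GroupoidAlgebra k T.coreE →ₗ[k] T.Deformed k ϑ :=
  GroupoidAlgebra.lift k T.coreE (oneE ϑ)

theorem liftE_of (E : T.CoreE) : liftE ϑ (GroupoidAlgebra.of k T.coreE E) = oneE ϑ E :=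
  GroupoidAlgebra.lift_of _ E

theorem liftE_one : liftE ϑ 1 = 1 := by
  cases nonempty_fintype T.Pt
  rw [GroupoidAlgebra.one_def, finsum_eq_sum_of_fintype, map_sum, ← sum_oneE_id ϑ]
  exact Finset.sum_congr rfl fun p _ => liftE_of ϑ _

theorem liftE_mul (a b : GroupoidAlgebra k T.coreE) : liftE ϑ (a * b) = liftE ϑ b * liftE ϑ a := by
  induction a using GroupoidAlgebra.induction_of with
  | h0 => simp
  | hadd x y hx hy => simp only [add_mul, mul_add, map_add, hx, hy]
  | hof r M =>
  induction b using GroupoidAlgebra.induction_of with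
  | h0 => simp
  | hadd x y hx hy => simp only [mul_add, add_mul, map_add, hx, hy]
  | hof t E =>
  rw [smul_mul_smul_comm, map_smul, map_smul, map_smul, smul_mul_smul_comm, mul_comm t r,
    GroupoidAlgebra.of_mul_of, liftE_of, liftE_of]
  congr 1
  by_cases e : T.coreE.tgt M = T.coreE.src E
  · rw [GroupoidAlgebra.mulArrows_pos k _ e, liftE_of, oneE_mul_oneE ϑ e]
    rfl
  · rw [GroupoidAlgebra.mulArrows_neg k _ e, map_zero, oneE_mul_oneE_of_ne ϑ e]

/-- The only summand of `1_E` that lies in the core groupoid is `E`. -/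
theorem liftE_injective : Function.Injective (liftE ϑ) := by
  let π : T.Deformed k ϑ →ₗ[k] GroupoidAlgebra k T.coreE := lift ϑ fun B =>
    if h : T.ver.IsId (right B) ∧ T.hor.IsId (top B) then
      GroupoidAlgebra.of k T.coreE ⟨B, h⟩ else 0
  have hπ : π ∘ₗ liftE ϑ = LinearMap.id := by
    refine GroupoidAlgebra.hom_ext fun E => ?_
    rw [LinearMap.comp_apply, liftE_of, oneE_eq, map_sum,
      Finset.sum_eq_single_of_mem E.1 (by simpa using isRightExt_self E)]
    · simp only [π, lift_box]
      exact dif_pos E.2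
    · intro B hB hne
      simp only [π, lift_box]
      exact dif_neg fun h => hne ((Finset.mem_filter.mp hB).2.eq_of_isId h.2)
  exact Function.LeftInverse.injective (g := π) fun a => LinearMap.congr_fun hπ a

theorem range_liftE : LinearMap.range (liftE ϑ) =
    LinearMap.range (targetMap k (T.Deformed k ϑ)) := by
  refine le_antisymm ?_ ?_
  · rintro _ ⟨a, rfl⟩
    induction a using GroupoidAlgebra.induction_of with
    | h0 => rw [map_zero]; exact Submodule.zero_mem _
    | hadd x y hx hy => rw [map_add]; exact Submodule.add_mem _ hx hy
    | hof c E =>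
      obtain ⟨A, hA, rfl⟩ := E.exists_psi_eq
      have h := targetMap_box ϑ A hA
      rw [← inv_smul_eq_iff₀ (ratio_ne_zero ϑ A)] at h
      rw [map_smul, liftE_of, ← h]
      exact Submodule.smul_mem _ _ (Submodule.smul_mem _ _ ⟨_, rfl⟩)
  · rintro _ ⟨a, rfl⟩
    induction a using induction_box with
    | h0 => rw [map_zero]; exact Submodule.zero_mem _
    | hadd x y hx hy => rw [map_add]; exact Submodule.add_mem _ hx hy
    | hbox c A =>
      rw [map_smul]
      refine Submodule.smul_mem _ _ ?_
      by_cases hA : T.hor.IsId (bottom A)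
      · rw [targetMap_box ϑ A hA, ← liftE_of]
        exact Submodule.smul_mem _ _ ⟨_, rfl⟩
      · rw [targetMap_box_of_not ϑ A hA]
        exact Submodule.zero_mem _

/-- The algebra embedding `k𝐃 → k^(ϑ)T`, `D ↦ _D1`. -/
noncomputable def algHomD : GroupoidAlgebra k T.coreD →ₐ[k] T.Deformed k ϑ :=
  AlgHom.ofLinearMap (liftD ϑ) (liftD_one ϑ) (liftD_mul ϑ)

/-- The algebra embedding `(k𝐄)ᵒᵖ → k^(ϑ)T`, `E ↦ 1_E`. -/
noncomputable def algHomE : (GroupoidAlgebra k T.coreE)ᵐᵒᵖ →ₐ[k] T.Deformed k ϑ :=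
  AlgHom.ofLinearMap (liftE ϑ ∘ₗ (MulOpposite.opLinearEquiv k).symm.toLinearMap) (liftE_one ϑ)
    fun a b => liftE_mul ϑ b.unop a.unop

end DoubleGroupoid.Deformed

theorem mainTheorem2 {k : Type v} [Field k] [CharZero k] (T : DoubleGroupoid.{u}) [Finite T.Box]
    (ϑ : T.Pt → kˣ) :
    (IsWeakBialgebra k (T.Deformed k ϑ) ↔
      ∀ (g : T.Ver) (x : T.Hor), T.ver.src g = T.hor.tgt x →
        ∑ᶠ W : {W : T.Box // top W = x ∧ right W = g},
          daleth ϑ W.1 = 1) ∧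
    ((∀ (g : T.Ver) (x : T.Hor), T.ver.src g = T.hor.tgt x →
        ∑ᶠ W : {W : T.Box // top W = x ∧ right W = g},
          daleth ϑ W.1 = 1) →
      IsWeakHopfAlgebra k (T.Deformed k ϑ) ∧
      IsSemisimpleRing (T.Deformed k ϑ) ∧
      (∀ S : T.Deformed k ϑ →ₗ[k] T.Deformed k ϑ, IsAntipode S → ∀ A : T.Box,
        S (box ϑ A) =
            (daleth ϑ (tinv A) /
              daleth ϑ (hinv A)) •
                box ϑ (tinv A) ∧
        S (box ϑ A) =
            ((ϑ (tr A) : k) / (ϑ (br A) : k)) •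
              box ϑ (tinv A)) ∧
      (∀ A : T.Box,
        (∀ h : T.hor.IsId (top A),
          sourceMap k (T.Deformed k ϑ) (box ϑ A) = oneD ϑ (phi A h)) ∧
        (¬ T.hor.IsId (top A) →
          sourceMap k (T.Deformed k ϑ) (box ϑ A) = 0)) ∧
      (∀ A : T.Box,
        (∀ h : T.hor.IsId (bottom A),
          targetMap k (T.Deformed k ϑ) (box ϑ A) =
            (daleth ϑ (tinv A) /
              daleth ϑ (hinv A)) •
                oneE ϑ (psi A h)) ∧
        (¬ T.hor.IsId (bottom A) →
          targetMap k (T.Deformed k ϑ) (box ϑ A) = 0)) ∧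
      (∃ Hs : Subalgebra k (T.Deformed k ϑ),
        Subalgebra.toSubmodule Hs = LinearMap.range (sourceMap k (T.Deformed k ϑ)) ∧
        Nonempty (GroupoidAlgebra k T.coreD ≃ₐ[k] Hs)) ∧
      (∃ Ht : Subalgebra k (T.Deformed k ϑ),
        Subalgebra.toSubmodule Ht = LinearMap.range (targetMap k (T.Deformed k ϑ)) ∧
        Nonempty ((GroupoidAlgebra k T.coreE)ᵐᵒᵖ ≃ₐ[k] Ht))) := by
  classical
  cases nonempty_fintype T.Box
  rw [← isNormalized_iff]
  refine ⟨isWeakBialgebra_iff ϑ, fun hϑ => ⟨⟨(isWeakBialgebra_iff ϑ).mpr hϑ, _, hϑ.isAntipode⟩,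
    GroupoidAlgebra.isSemisimpleRing k T.boxV, fun S hS A => ?_,
    fun A => ⟨sourceMap_box ϑ A, sourceMap_box_of_not ϑ A⟩,
    fun A => ⟨fun h => ?_, targetMap_box_of_not ϑ A⟩,
    ⟨(algHomD ϑ).range, range_liftD ϑ, ⟨AlgEquiv.ofInjective _ (liftD_injective ϑ)⟩⟩,
    ⟨(algHomE ϑ).range, ?_, ⟨AlgEquiv.ofInjective _ ?_⟩⟩⟩⟩
  · rw [ratio_eq, hS.unique hϑ.isAntipode]
    exact ⟨antipode_box ϑ A, antipode_box ϑ A⟩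
  · rw [ratio_eq]
    exact targetMap_box ϑ A h
  · refine Eq.trans ?_ (range_liftE ϑ)
    exact LinearMap.range_comp_of_range_eq_top (liftE ϑ)
      (LinearEquiv.range (MulOpposite.opLinearEquiv k (M := GroupoidAlgebra k T.coreE)).symm)
  · exact (liftE_injective ϑ).comp MulOpposite.unop_injective
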